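/- **Theorem (Private regret).** *Setting.* Consider episodic linear quadratic control with state dimension $n$, control dimension $d$, horizon $H$ and $K\ge 2$ episodes: $x_{k,h+1}=A_*x_{k,h}+B_*u_{k,h}+w_{k,h}$, with cost $x_{k,h}^\top Qx_{k,h}+u_{k,h}^\top Ru_{k,h}$ and $Q,R$ positive definite. For $\Theta=[A,B]^\top$ let $P_{H+1}(\Theta)=0$, $$P_h=Q+A^\top P_{h+1}A-A^\top P_{h+1}B(R+B^\top P_{h+1}B)^{-1}B^\top P_{h+1}A,\qquad K_h(\Theta)=-(R+B^\top P_{h+1}B)^{-1}B^\top P_{h+1}A .$$ For a policy $\pi$ let $J_1^\pi(\Theta,x)$ be its expected cost in an episode started at $x$, and let $J_1^*(\Theta,x)=x^\top P_1(\Theta)x+\sum_{h=1}^H\mathbb E[w_h^\top P_{h+1}(\Theta)w_h]$ (with the noise laws of that episode). The regret is $\mathcal R(K)=\sum_{k=1}^K\big(J_1^{\pi_k}(\Theta_*,x_{k,1})-J_1^*(\Theta_*,x_{k,1})\big)$. Write $\|A\|_B=\sqrt{\operatorname{tr}(A^\top BA)}$. *Assumptions.* (a) $\Theta_*=[A_*,B_*]^\top\in\mathcal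 S:=\{\Theta=[A,B]^\top:\|\Theta\|_F\le1,\ [A,B]\text{ controllable}\}$. (b) $\|A_*\|\le C_A<1$, $\|B_*\|\le C_B<1$, $\|Q\|,\|R\|\le C$. (c) $\|x_{k,1}\|\le1$; the starting state may depend on everything that precedes episode $k$. (d) $w_{k,h}$ is independent of all preceding randomness (including all privacy noise), has mean zero, and $\|w_{k,h}\|\le C_w<1$. (e) $C_A+\gamma C_B+C_w\le1$, where $\gamma$ bounds the gains: $\|K_h(\Theta)\|\le\gamma$ for all $\Theta\in\mathcal S$, $1\le h\le H$. *Algorithm (Private-OFU-RL)*, with $\epsilon>0$, $\delta\in(0,1]$, $\alpha\in(0,1]$ and a numerical constant $\kappa>0$ (e.g. $\kappa=8$). Let $m=\lceil\log_2K\rceil$, $\Delta_1=H(1+\gamma)^2$, $\Delta_2=H(1+\gamma)$, $\sigma_i^2=\kappa\, m\Delta_i^2\ln(2/\delta)/\epsilon^2$, and $$\Lambda=\sigma_1\sqrt m\Big(4\sqrt{n+d}+\sqrt{8\ln(4K/\alpha)}\Big),\quad \lambda_{\min}=\Lambda,\ \ \lambda_{\max}=3\Lambda,\ \ \eta=2\Lambda,\quad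 \nu=\sigma_2\sqrt{m/\Lambda}\Big(\sqrt{2n(n+d)}+\sqrt{4\ln(2K/\alpha)}\Big).$$ Let $z_{k,h}=[x_{k,h}^\top,u_{k,h}^\top]^\top$. For each node of the binary interval tree over episodes, covering episodes $i,\dots,j$, the P-sum $\sum_{k=i}^j\sum_h z_{k,h}z_{k,h}^\top$ is perturbed by a symmetric matrix whose entries on and above the diagonal are i.i.d. $\mathcal N(0,\sigma_1^2)$, and $\sum_{k=i}^j\sum_h z_{k,h}x_{k,h+1}^\top$ by a matrix with i.i.d. $\mathcal N(0,\sigma_2^2)$ entries; all these noises are independent. $T_{1,k},T_{2,k}$ are the sums of the noisy P-sums over the nodes that uniquely cover $\{1,\dots,k-1\}$ (one node per binary digit $1$ of $k-1$). With $V_k=T_{1,k}+\eta I$, $\hat\Theta_k=V_k^{-1}T_{2,k}$, $Z_k^\top Z_k=\sum_{k'<k}\sum_h z_{k',h}z_{k',h}^\top$ and $$\beta_k=C_w\sqrt{2\ln(2/\alpha)+n\ln\det(I+\lambda_{\min}^{-1}Z_k^\top Z_k)}+\sqrt{\lambda_{\max}}+\nu,\qquad \mathcal C_k=\{\Theta:\|\Theta-\hat\Theta_k\|_{V_k}\le\beta_k\},$$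 the algorithm chooses $\widetilde\Theta_k\in\mathcal C_k\cap\mathcal S$ minimizing $J_1^*(\cdot,x_{k,1})$ over $\mathcal C_k\cap\mathcal S$ up to an error of at most $1/\sqrt k$ (any element of $\mathcal S$ if $\mathcal C_k\cap\mathcal S=\emptyset$), and plays $u_{k,h}=K_h(\widetilde\Theta_k)x_{k,h}$ throughout episode $k$. *Claim.* For all constants $C,C_A,C_B,C_w,\gamma,\kappa$ as above and every $q\in\mathbb R$ there is a constant $M>0$, depending only on these, such that for all $n,d,H$, all $K\ge2$, all $\delta,\alpha\in(0,1]$, all $0<\epsilon\le K^q$, all systems satisfying the assumptions and all runs of the algorithm, with probability at least $1-\alpha$, $$\mathcal R(K)\le M H^{3/2}\sqrt K\,\big(n(n+d)\ln K+\ln(1/\alpha)\big)+M H^{3/2}\sqrt K\,\ln K\,\Big(n(n+d)+\sqrt{\ln(K/\alpha)}\Big)\frac{\ln(2/\delta)^{1/4}}{\epsilon^{1/2}} .$$ -/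

import Mathlib

open MeasureTheory ProbabilityTheory Matrix Finset
open scoped NNReal ENNReal

namespace PrivateLQ

noncomputable section

/-! ### Norms -/

/-- The Euclidean norm of a vector. -/
def euclNorm {ι : Type*} [Fintype ι] (v : ι → ℝ) : ℝ := ‖WithLp.toLp 2 v‖

/-- The operator norm of a (rectangular) matrix between Euclidean spaces. -/
def opNorm {ι κ : Type*} [Fintype ι] [Fintype κ] [DecidableEq κ] (A : Matrix ι κ ℝ) : ℝ :=
  ‖LinearMap.toContinuousLinearMap (Matrix.toEuclideanLin A)‖

/-- The Frobenius norm of a matrix. -/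
def frobNorm {ι κ : Type*} [Fintype ι] [Fintype κ] (A : Matrix ι κ ℝ) : ℝ :=
  √ (Matrix.trace (Aᵀ * A))

/-- The weighted norm `‖A‖_B`, with `‖A‖_B ^ 2 = trace (Aᵀ B A)`. -/
def weightedNorm {ι κ : Type*} [Fintype ι] [Fintype κ] (B : Matrix ι ι ℝ) (A : Matrix ι κ ℝ) : ℝ :=
  √ (Matrix.trace (Aᵀ * B * A))

/-! ### Linear quadratic control

A system with state dimension `n` and control dimension `d` is given by `Θ = [A, B]ᵀ`, a matrix with
`n + d` rows, indexed by `Fin n ⊕ Fin d`, and `n` columns. -/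

/-- System matrices `Θ = [A, B]ᵀ`. -/
abbrev Param (n d : ℕ) : Type := Matrix (Fin n ⊕ Fin d) (Fin n) ℝ

/-- The matrix `A` of `Θ = [A, B]ᵀ`. -/
def Amat {n d : ℕ} (Θ : Param n d) : Matrix (Fin n) (Fin n) ℝ := (Matrix.toRows₁ Θ)ᵀ

/-- The matrix `B` of `Θ = [A, B]ᵀ`. -/
def Bmat {n d : ℕ} (Θ : Param n d) : Matrix (Fin n) (Fin d) ℝ := (Matrix.toRows₂ Θ)ᵀ

/-- Controllability of `[A, B]`: the matrix `[B, AB, …, A ^ (n - 1) B]` has rank `n`. -/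
def Controllable {n d : ℕ} (Θ : Param n d) : Prop :=
  (Matrix.of fun (i : Fin n) (p : Fin n × Fin d) =>
    (Amat Θ ^ (p.1 : ℕ) * Bmat Θ) i p.2).rank = n

/-- The set `𝒮` of admissible parameters. -/
def paramSet (n d : ℕ) : Set (Param n d) := {Θ | frobNorm Θ ≤ 1 ∧ Controllable Θ}

/-- The Riccati iteration, indexed by the number of steps to go. -/
def riccati {n d : ℕ} (Q : Matrix (Fin n) (Fin n) ℝ) (R : Matrix (Fin d) (Fin d) ℝ)
    (Θ : Param n d) : ℕ → Matrix (Fin n) (Fin n) ℝ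
  | 0 => 0
  | j + 1 =>
    let A := Amat Θ
    let B := Bmat Θ
    let P := riccati Q R Θ j
    Q + Aᵀ * P * A - Aᵀ * P * B * (R + Bᵀ * P * B)⁻¹ * Bᵀ * P * A

/-- `P_h(Θ)` for horizon `H` and `1 ≤ h ≤ H + 1`; in particular `P_{H+1}(Θ) = 0`. -/
def Pmat {n d : ℕ} (Q : Matrix (Fin n) (Fin n) ℝ) (R : Matrix (Fin d) (Fin d) ℝ) (H : ℕ)
    (Θ : Param n d) (h : ℕ) : Matrix (Fin n) (Fin n) ℝ :=
  riccati Q R Θ (H + 1 - h)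

/-- The optimal gain `K_h(Θ) = -(R + Bᵀ P_{h+1} B)⁻¹ Bᵀ P_{h+1} A`, `1 ≤ h ≤ H`. -/
def gain {n d : ℕ} (Q : Matrix (Fin n) (Fin n) ℝ) (R : Matrix (Fin d) (Fin d) ℝ) (H : ℕ)
    (Θ : Param n d) (h : ℕ) : Matrix (Fin d) (Fin n) ℝ :=
  let A := Amat Θ
  let B := Bmat Θ
  let P := Pmat Q R H Θ (h + 1)
  (-1 : ℝ) • ((R + Bᵀ * P * B)⁻¹ * Bᵀ * P * A)

/-- The policy `(h, x) ↦ K_h(Θ) x`. -/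
def gainPolicy {n d : ℕ} (Q : Matrix (Fin n) (Fin n) ℝ) (R : Matrix (Fin d) (Fin d) ℝ) (H : ℕ)
    (Θ : Param n d) (h : ℕ) (x : Fin n → ℝ) : Fin d → ℝ :=
  gain Q R H Θ h *ᵥ x

/-- The one-step cost `xᵀ Q x + uᵀ R u`. -/
def stepCost {n d : ℕ} (Q : Matrix (Fin n) (Fin n) ℝ) (R : Matrix (Fin d) (Fin d) ℝ)
    (x : Fin n → ℝ) (u : Fin d → ℝ) : ℝ :=
  x ⬝ᵥ (Q *ᵥ x) + u ⬝ᵥ (R *ᵥ u)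

/-- The state reached at time `h + j` from state `x` at time `h` when the system `Θ` is run with
policy `π` and noise sequence `w` (`w h'` enters in the step from `h'` to `h' + 1`). -/
def rollout {n d : ℕ} (Θ : Param n d) (π : ℕ → (Fin n → ℝ) → (Fin d → ℝ)) (w : ℕ → Fin n → ℝ)
    (h : ℕ) (x : Fin n → ℝ) : ℕ → Fin n → ℝ
  | 0 => x
  | j + 1 =>
    let y := rollout Θ π w h x j
    Amat Θ *ᵥ y + Bmat Θ *ᵥ (π (h + j) y) + w (h + j)

/-- `J_h^π(Θ, x)`: expected cost of the fixed policy `π` from state `x` at time `h` to time `H`. -/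
def policyCost {n d : ℕ} {Ω : Type*} [MeasurableSpace Ω] (μ : Measure Ω)
    (Q : Matrix (Fin n) (Fin n) ℝ) (R : Matrix (Fin d) (Fin d) ℝ) (H : ℕ)
    (w : ℕ → Ω → Fin n → ℝ) (Θ : Param n d) (π : ℕ → (Fin n → ℝ) → (Fin d → ℝ))
    (h : ℕ) (x : Fin n → ℝ) : ℝ :=
  ∫ ω, ∑ j ∈ Finset.range (H + 1 - h),
    stepCost Q R (rollout Θ π (fun i => w i ω) h x j)
      (π (h + j) (rollout Θ π (fun i => w i ω) h x j)) ∂μ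

/-- `J_h^*(Θ, x) = xᵀ P_h(Θ) x + ∑_{h' = h}^{H} 𝔼[w_{h'}ᵀ P_{h'+1}(Θ) w_{h'}]`. -/
def optCost {n d : ℕ} {Ω : Type*} [MeasurableSpace Ω] (μ : Measure Ω)
    (Q : Matrix (Fin n) (Fin n) ℝ) (R : Matrix (Fin d) (Fin d) ℝ) (H : ℕ)
    (w : ℕ → Ω → Fin n → ℝ) (Θ : Param n d) (h : ℕ) (x : Fin n → ℝ) : ℝ :=
  x ⬝ᵥ (Pmat Q R H Θ h *ᵥ x) +
    ∑ i ∈ Finset.Icc h H, ∫ ω, (w i ω) ⬝ᵥ (Pmat Q R H Θ (i + 1) *ᵥ (w i ω)) ∂μ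

/-! ### The binary interval tree

Episodes are numbered from `1`. The node `(l, i)` of the tree (level `l`, position `i`) represents the
episodes `i * 2 ^ l + 1, …, (i + 1) * 2 ^ l`. -/

/-- First episode of a node. -/
def nodeLo (v : ℕ × ℕ) : ℕ := v.2 * 2 ^ v.1 + 1

/-- Last episode of a node. -/
def nodeHi (v : ℕ × ℕ) : ℕ := (v.2 + 1) * 2 ^ v.1

/-- The nodes that uniquely cover the episodes `1, …, t`: one for each binary digit `1` of `t`. -/
def cover (t : ℕ) : Finset (ℕ × ℕ) :=
  ((Finset.range t.size).filter fun l => t.testBit l).image fun l => (l, 2 * (t / 2 ^ (l + 1)))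

/-- Index set of the scalar privacy noises: at every node of the tree, one for each unordered pair of
coordinates (the symmetric noise of the first counter), and one for each entry of an
`(n + d) × n` matrix (the noise of the second counter). -/
abbrev NoiseIdx (n d : ℕ) : Type :=
  (ℕ × ℕ) × (Sym2 (Fin n ⊕ Fin d) ⊕ ((Fin n ⊕ Fin d) × Fin n))

/-! ### The algorithm -/

/-- The data of a run of the algorithm on a sample space `Ω`. Episodes and steps are numbered from
`1`. This structure carries no assumptions: the model is `Boundedness` and `StochasticModel`, the
algorithm is `IsPrivateOFURL`, below. -/
structure Run (n d : ℕ) (Ω : Type*) where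
  /-- state cost matrix -/
  Q : Matrix (Fin n) (Fin n) ℝ
  /-- control cost matrix -/
  R : Matrix (Fin d) (Fin d) ℝ
  /-- true system -/
  Θs : Param n d
  /-- horizon -/
  H : ℕ
  /-- number of episodes -/
  K : ℕ
  /-- bound on the gains -/
  γ : ℝ
  /-- bound on the system noise -/
  Cw : ℝ
  /-- privacy parameter -/
  ε : ℝ
  /-- privacy parameter -/
  δ : ℝ
  /-- confidence parameter -/
  α : ℝ
  /-- numerical constant in the variances of the privacy noise -/
  κ : ℝ
  /-- starting states `x_{k,1}` -/
  x₁ : ℕ → Ω → Fin n → ℝ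
  /-- system noises `w_{k,h}` -/
  w : ℕ → ℕ → Ω → Fin n → ℝ
  /-- scalar privacy noises -/
  g : NoiseIdx n d → Ω → ℝ
  /-- the parameters `Θ̃_k` chosen by the algorithm -/
  Θt : ℕ → Ω → Param n d

namespace Run

variable {n d : ℕ} {Ω : Type*} (S : Run n d Ω)

/-- `m = ⌈log₂ K⌉`. -/
def m : ℕ := Nat.clog 2 S.K

/-- Variance of the noise of the first counter, `σ₁² = κ m Δ₁² ln(2/δ) / ε²`, where
`Δ₁ = H (1 + γ)²`. -/
def var₁ : ℝ := S.κ * S.m * (S.H * (1 + S.γ) ^ 2) ^ 2 * Real.log (2 / S.δ) / S.ε ^ 2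

/-- Variance of the noise of the second counter, `σ₂² = κ m Δ₂² ln(2/δ) / ε²`, where
`Δ₂ = H (1 + γ)`. -/
def var₂ : ℝ := S.κ * S.m * (S.H * (1 + S.γ)) ^ 2 * Real.log (2 / S.δ) / S.ε ^ 2

/-- `Λ = σ₁ √m (4 √(n+d) + √(8 ln(4K/α)))`. -/
def lam : ℝ :=
  √S.var₁ * √(S.m : ℝ) * (4 * √((n : ℝ) + d) + √(8 * Real.log (4 * S.K / S.α)))

/-- `λ_min = Λ`. -/
def lamMin : ℝ := S.lam

/-- `λ_max = 3 Λ`. -/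
def lamMax : ℝ := 3 * S.lam

/-- `η = 2 Λ`. -/
def eta : ℝ := 2 * S.lam

/-- `ν = σ₂ √(m/Λ) (√(2n(n+d)) + √(4 ln(2K/α)))`. -/
def nu : ℝ :=
  √S.var₂ * √(S.m / S.lam) *
    (√(2 * n * ((n : ℝ) + d)) + √(4 * Real.log (2 * S.K / S.α)))

/-- The policy `π_k`. -/
def policy (k : ℕ) (ω : Ω) : ℕ → (Fin n → ℝ) → (Fin d → ℝ) :=
  gainPolicy S.Q S.R S.H (S.Θt k ω)

/-- The state `x_{k,h}`, `1 ≤ h ≤ H + 1`, of the true system run with `π_k`. -/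
def x (k h : ℕ) (ω : Ω) : Fin n → ℝ :=
  rollout S.Θs (S.policy k ω) (fun i => S.w k i ω) 1 (S.x₁ k ω) (h - 1)

/-- The control `u_{k,h} = π_{k,h}(x_{k,h})`. -/
def u (k h : ℕ) (ω : Ω) : Fin d → ℝ := S.policy k ω h (S.x k h ω)

/-- The state-control pair `z_{k,h}`. -/
def z (k h : ℕ) (ω : Ω) : Fin n ⊕ Fin d → ℝ := Sum.elim (S.x k h ω) (S.u k h ω)

/-- The P-sum `Σ₁[i,j] = ∑_{k = i}^{j} ∑_{h = 1}^{H} z_{k,h} z_{k,h}ᵀ`. -/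
def psum₁ (i j : ℕ) (ω : Ω) : Matrix (Fin n ⊕ Fin d) (Fin n ⊕ Fin d) ℝ :=
  ∑ k ∈ Finset.Icc i j, ∑ h ∈ Finset.Icc 1 S.H, Matrix.vecMulVec (S.z k h ω) (S.z k h ω)

/-- The P-sum `Σ₂[i,j] = ∑_{k = i}^{j} ∑_{h = 1}^{H} z_{k,h} x_{k,h+1}ᵀ`. -/
def psum₂ (i j : ℕ) (ω : Ω) : Param n d :=
  ∑ k ∈ Finset.Icc i j, ∑ h ∈ Finset.Icc 1 S.H, Matrix.vecMulVec (S.z k h ω) (S.x k (h + 1) ω)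

/-- The noisy P-sum of the first counter at a node. -/
def noisyPsum₁ (v : ℕ × ℕ) (ω : Ω) : Matrix (Fin n ⊕ Fin d) (Fin n ⊕ Fin d) ℝ :=
  S.psum₁ (nodeLo v) (nodeHi v) ω + Matrix.of fun p q => S.g (v, Sum.inl s(p, q)) ω

/-- The noisy P-sum of the second counter at a node. -/
def noisyPsum₂ (v : ℕ × ℕ) (ω : Ω) : Param n d :=
  S.psum₂ (nodeLo v) (nodeHi v) ω + Matrix.of fun p q => S.g (v, Sum.inr (p, q)) ω

/-- The private statistics `T_{1,k}`. -/
def T₁ (k : ℕ) (ω : Ω) : Matrix (Fin n ⊕ Fin d) (Fin n ⊕ Fin d) ℝ :=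
  ∑ v ∈ cover (k - 1), S.noisyPsum₁ v ω

/-- The private statistics `T_{2,k}`. -/
def T₂ (k : ℕ) (ω : Ω) : Param n d := ∑ v ∈ cover (k - 1), S.noisyPsum₂ v ω

/-- `V_k = T_{1,k} + η I`. -/
def V (k : ℕ) (ω : Ω) : Matrix (Fin n ⊕ Fin d) (Fin n ⊕ Fin d) ℝ :=
  S.T₁ k ω + S.eta • (1 : Matrix (Fin n ⊕ Fin d) (Fin n ⊕ Fin d) ℝ)

/-- `Θ̂_k = V_k⁻¹ U_k` with `U_k = T_{2,k}`. -/
def Θhat (k : ℕ) (ω : Ω) : Param n d := (S.V k ω)⁻¹ * S.T₂ k ω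

/-- `Z_kᵀ Z_k`. -/
def gram (k : ℕ) (ω : Ω) : Matrix (Fin n ⊕ Fin d) (Fin n ⊕ Fin d) ℝ := S.psum₁ 1 (k - 1) ω

/-- The confidence radius `β_k(α)`. -/
def beta (k : ℕ) (ω : Ω) : ℝ :=
  S.Cw * √(2 * Real.log (2 / S.α) +
      n * Real.log (1 + S.lamMin⁻¹ • S.gram k ω).det)
    + √S.lamMax + S.nu

/-- The confidence set `𝒞_k(α)`. -/
def confSet (k : ℕ) (ω : Ω) : Set (Param n d) :=
  {Θ | weightedNorm (S.V k ω) (Θ - S.Θhat k ω) ≤ S.beta k ω}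

/-- The deterministic part of the boundedness assumption, with the constants `C, C_A, C_B` (and `γ`,
`C_w` from the run). -/
structure Boundedness (C CA CB : ℝ) : Prop where
  posDef_Q : S.Q.PosDef
  posDef_R : S.R.PosDef
  mem_paramSet : S.Θs ∈ paramSet n d
  norm_A : opNorm (Amat S.Θs) ≤ CA
  norm_B : opNorm (Bmat S.Θs) ≤ CB
  norm_Q : opNorm S.Q ≤ C
  norm_R : opNorm S.R ≤ C
  norm_gain : ∀ Θ ∈ paramSet n d, ∀ h ∈ Finset.Icc 1 S.H, opNorm (gain S.Q S.R S.H Θ h) ≤ S.γ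

variable [MeasurableSpace Ω] (μ : Measure Ω)

/-- The σ-algebra of the randomness present before `w_{k,h}` is drawn: all privacy noises, the
starting states and the chosen parameters of the episodes up to `k`, and the earlier system noises. -/
abbrev past (k h : ℕ) : MeasurableSpace Ω :=
  (⨆ i, MeasurableSpace.comap (S.g i) inferInstance)
    ⊔ (⨆ k' ∈ Finset.Icc 1 k, MeasurableSpace.comap (S.x₁ k') inferInstance)
    ⊔ (⨆ k' ∈ Finset.Icc 1 k, ⨆ p, ⨆ q,
        MeasurableSpace.comap (fun ω => S.Θt k' ω p q) inferInstance)
    ⊔ (⨆ k' ∈ Finset.Icc 1 (k - 1), ⨆ h' ∈ Finset.Icc 1 S.H,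
        MeasurableSpace.comap (S.w k' h') inferInstance)
    ⊔ (⨆ h' ∈ Finset.Icc 1 (h - 1), MeasurableSpace.comap (S.w k h') inferInstance)

/-- The stochastic model: random variables, laws, and independence. The starting state of an episode
may depend on everything that precedes the episode. -/
structure StochasticModel : Prop where
  measurable_x₁ : ∀ k, Measurable (S.x₁ k)
  measurable_w : ∀ k h, Measurable (S.w k h)
  measurable_g : ∀ i, Measurable (S.g i)
  measurable_Θt : ∀ k p q, Measurable fun ω => S.Θt k ω p q
  norm_x₁ : ∀ᵐ ω ∂μ, ∀ k ∈ Finset.Icc 1 S.K, euclNorm (S.x₁ k ω) ≤ 1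
  norm_w : ∀ᵐ ω ∂μ, ∀ k ∈ Finset.Icc 1 S.K, ∀ h ∈ Finset.Icc 1 S.H, euclNorm (S.w k h ω) ≤ S.Cw
  mean_w : ∀ k ∈ Finset.Icc 1 S.K, ∀ h ∈ Finset.Icc 1 S.H, ∀ i, ∫ ω, S.w k h ω i ∂μ = 0
  indep_w : ∀ k ∈ Finset.Icc 1 S.K, ∀ h ∈ Finset.Icc 1 S.H,
    Indep (MeasurableSpace.comap (S.w k h) inferInstance) (S.past k h) μ
  indep_g : iIndepFun S.g μ
  law_g₁ : ∀ v s, μ.map (S.g (v, Sum.inl s)) = gaussianReal 0 S.var₁.toNNReal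
  law_g₂ : ∀ v e, μ.map (S.g (v, Sum.inr e)) = gaussianReal 0 S.var₂.toNNReal

/-- `J_1^*(Θ, x_{k,1})` in episode `k`. -/
def optStart (k : ℕ) (Θ : Param n d) (ω : Ω) : ℝ :=
  optCost μ S.Q S.R S.H (S.w k) Θ 1 (S.x₁ k ω)

/-- The optimistic choice in episode `k`. If `𝒞_k(α) ∩ 𝒮` is nonempty, then `Θ̃_k` is a point of it
that minimizes `J_1^*(·, x_{k,1})` up to `1/√k` (in particular it may be an exact minimizer; the
minimum need not be attained, since `𝒮` is not closed). Otherwise `Θ̃_k` is any point of `𝒮`. -/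
def OptimisticChoice (k : ℕ) (ω : Ω) : Prop :=
  S.Θt k ω ∈ paramSet n d ∧
    ((S.confSet k ω ∩ paramSet n d).Nonempty →
      S.Θt k ω ∈ S.confSet k ω ∧
        ∀ Θ ∈ S.confSet k ω ∩ paramSet n d,
          S.optStart μ k (S.Θt k ω) ω ≤ S.optStart μ k Θ ω + 1 / √(k : ℝ))

/-- The run is one of the algorithm Private-OFU-RL. -/
def IsPrivateOFURL : Prop :=
  ∀ᵐ ω ∂μ, ∀ k ∈ Finset.Icc 1 S.K, S.OptimisticChoice μ k ω

/-- The cumulative regret `∑_{k = 1}^{K} (J_1^{π_k}(Θ_*, x_{k,1}) - J_1^*(Θ_*, x_{k,1}))`. -/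
def regret (ω : Ω) : ℝ :=
  ∑ k ∈ Finset.Icc 1 S.K,
    (policyCost μ S.Q S.R S.H (S.w k) S.Θs (S.policy k ω) 1 (S.x₁ k ω)
      - S.optStart μ k S.Θs ω)

end Run

end

end PrivateLQ

open PrivateLQ

/-!
Private optimistic control of linear quadratic systems has regret of order `√K`: the argument is
optimism, with all randomness confined to four events of total probability at most `α`.

*Optimism.* If `Θ_*` lies in the confidence set, then `J^*(Θ̃_k) ≤ J^*(Θ_*) + 1/√k`, and the regret of
episode `k` is, up to `1/√k`, the excess `J^{π_k}(Θ_*) - J^*(Θ̃_k)`: the same policy is costed under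
two systems. By `exists_excess_le` this excess is at most `θ 𝔼X_k + c H² / θ` for every `θ > 0`, where
`X_k = ∑_h ‖(Θ_* - Θ̃_k)ᵀ z_{k,h}‖²` is the prediction error of the episode (`predErr`). When
`C_A + γ C_B < 1`, the true closed loop contracts, its cost matrices are bounded uniformly in `H`, and
the Riccati equation gives a recursion for the excess without a second-order term. When
`C_A + γ C_B = 1`, the system noise vanishes, and near-optimality of `Θ̃_k` together with `‖Θ̃_k‖_F ≤ 1`
controls the trajectory along the top eigenvector of `P_1(Θ̃_k)`. Since `θ` is free and constant over
episodes, choosing it at the end (`exists_pos_balanced_le`) replaces the Cauchy-Schwarz step and turns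
a bound on `∑ 𝔼X_k` into one on the regret.

*From expected to actual prediction errors.* As `0 ≤ X_k ≤ 4 (1 + γ)² H`, an exponential
supermartingale over the episodes and Ville's inequality give `∑ 𝔼X_k ≤ 2 ∑ X_k + O(H log (1/α))`;
an additive deviation of order `√K` would be too large here, the multiplicative form costs nothing.

*Confidence.* With `G` the regularized Gram matrix of the `z_{k,h}` and `B = ∑ z_{k,h} w_{k,h}ᵀ`, the
process `exp (tr (Bᵀ G⁻¹ B) / (2 C_w²)) * det (G / Λ) ^ (-1/2)` is dominated by a supermartingale, by
Hoeffding's lemma and rank-one updates; no Gaussian mixture is needed. The symmetric privacy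
noise is bounded by `Λ` in operator norm through a `1/4`-net of the sphere, and the other one by `ν`
in Frobenius norm through the moment generating function of a squared Gaussian. On these events
`V_k` dominates `G_k = Λ I + Z_kᵀ Z_k`, and `Θ_*` lies in the confidence set (`Run.mem_confSet`).

*Elliptical potential.* Both `Θ_*` and `Θ̃_k` lie in the confidence set, so
`X_k ≤ 4 β_k² tr (G_k⁻¹ ∑_h z_{k,h} z_{k,h}ᵀ)`; with the a priori bound on `X_k`, and since
`∑ min (1, tr (G_k⁻¹ S_k)) ≤ 2 log det (G_{K+1} / Λ)` with `S_k = G_{k+1} - G_k`, the sum `∑ X_k` is of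
order `(H + β²) (n + d) log K`. The logarithm is of order `log K` because `ε ≤ K ^ q`.
-/


namespace PrivateLQ

/-! ### Quadratic forms -/

section QuadraticForms

variable {ι κ : Type*} [Fintype ι] [Fintype κ]

/-- The quadratic form `vᵀ M v`. -/
def quad (M : Matrix ι ι ℝ) (v : ι → ℝ) : ℝ := v ⬝ᵥ (M *ᵥ v)

theorem dotProduct_self_nonneg_real (v : ι → ℝ) : 0 ≤ v ⬝ᵥ v :=
  Finset.sum_nonneg fun i _ => mul_self_nonneg (v i)

theorem euclNorm_nonneg (v : ι → ℝ) : 0 ≤ euclNorm v := norm_nonneg _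

theorem euclNorm_sq (v : ι → ℝ) : euclNorm v ^ 2 = v ⬝ᵥ v := by
  unfold euclNorm
  rw [EuclideanSpace.real_norm_sq_eq]
  simp [dotProduct, pow_two]

theorem euclNorm_add_le (v w : ι → ℝ) : euclNorm (v + w) ≤ euclNorm v + euclNorm w := by
  unfold euclNorm
  rw [WithLp.toLp_add]
  exact norm_add_le _ _

theorem abs_dotProduct_le (v w : ι → ℝ) : |v ⬝ᵥ w| ≤ euclNorm v * euclNorm w := by
  have h := abs_real_inner_le_norm (WithLp.toLp 2 w) (WithLp.toLp 2 v)
  rw [EuclideanSpace.inner_eq_star_dotProduct] at h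
  simpa [euclNorm, mul_comm] using h

theorem euclNorm_mulVec_le [DecidableEq κ] (A : Matrix ι κ ℝ) (v : κ → ℝ) :
    euclNorm (A *ᵥ v) ≤ opNorm A * euclNorm v := by
  have h := (LinearMap.toContinuousLinearMap (Matrix.toEuclideanLin A)).le_opNorm (WithLp.toLp 2 v)
  simpa [euclNorm, opNorm, Matrix.toLpLin_apply] using h

theorem opNorm_nonneg [DecidableEq κ] (A : Matrix ι κ ℝ) : 0 ≤ opNorm A := norm_nonneg _

theorem quad_le_opNorm [DecidableEq ι] (A : Matrix ι ι ℝ) (v : ι → ℝ) :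
    quad A v ≤ opNorm A * (v ⬝ᵥ v) := by
  have h1 := (le_abs_self _).trans (abs_dotProduct_le v (A *ᵥ v))
  have h2 := mul_le_mul_of_nonneg_left (euclNorm_mulVec_le A v) (euclNorm_nonneg v)
  rw [← euclNorm_sq]
  unfold quad
  linarith [h1.trans h2]

theorem quad_add_left (M N : Matrix ι ι ℝ) (v : ι → ℝ) : quad (M + N) v = quad M v + quad N v := by
  simp [quad, Matrix.add_mulVec]

theorem quad_sub_left (M N : Matrix ι ι ℝ) (v : ι → ℝ) : quad (M - N) v = quad M v - quad N v := by
  simp [quad, Matrix.sub_mulVec]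

theorem quad_smul_left (c : ℝ) (M : Matrix ι ι ℝ) (v : ι → ℝ) : quad (c • M) v = c * quad M v := by
  simp [quad, Matrix.smul_mulVec]

@[simp] theorem quad_one [DecidableEq ι] (v : ι → ℝ) : quad (1 : Matrix ι ι ℝ) v = v ⬝ᵥ v := by
  simp [quad]

@[simp] theorem quad_zero_left (v : ι → ℝ) : quad (0 : Matrix ι ι ℝ) v = 0 := by
  simp [quad]

@[simp] theorem quad_zero_right (M : Matrix ι ι ℝ) : quad M 0 = 0 := by
  simp [quad]

theorem quad_smul_right (M : Matrix ι ι ℝ) (c : ℝ) (v : ι → ℝ) :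
    quad M (c • v) = c ^ 2 * quad M v := by
  simp [quad, Matrix.mulVec_smul]; ring

theorem quad_conj (F : Matrix ι κ ℝ) (M : Matrix ι ι ℝ) (v : κ → ℝ) :
    quad (Fᵀ * M * F) v = quad M (F *ᵥ v) := by
  unfold quad
  rw [← Matrix.mulVec_mulVec, ← Matrix.mulVec_mulVec, Matrix.dotProduct_mulVec,
    Matrix.vecMul_transpose]

theorem quad_transpose_mul (F : Matrix ι κ ℝ) (v : κ → ℝ) :
    quad (Fᵀ * F) v = (F *ᵥ v) ⬝ᵥ (F *ᵥ v) := by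
  unfold quad
  rw [← Matrix.mulVec_mulVec, Matrix.dotProduct_mulVec, Matrix.vecMul_transpose]

theorem dotProduct_mulVec_comm {M : Matrix ι ι ℝ} (hM : Mᵀ = M) (v w : ι → ℝ) :
    v ⬝ᵥ (M *ᵥ w) = w ⬝ᵥ (M *ᵥ v) := by
  rw [Matrix.dotProduct_mulVec, ← Matrix.mulVec_transpose, hM, dotProduct_comm]

theorem quad_add_right {M : Matrix ι ι ℝ} (hM : Mᵀ = M) (v w : ι → ℝ) :
    quad M (v + w) = quad M v + 2 * (v ⬝ᵥ (M *ᵥ w)) + quad M w := by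
  unfold quad
  rw [Matrix.mulVec_add, add_dotProduct, dotProduct_add, dotProduct_add,
    dotProduct_mulVec_comm hM w v]
  ring

theorem quad_sub_right {M : Matrix ι ι ℝ} (hM : Mᵀ = M) (v w : ι → ℝ) :
    quad M (v - w) = quad M v - 2 * (v ⬝ᵥ (M *ᵥ w)) + quad M w := by
  unfold quad
  rw [Matrix.mulVec_sub, sub_dotProduct, dotProduct_sub, dotProduct_sub,
    dotProduct_mulVec_comm hM w v]
  ring

/-- Cauchy–Schwarz for a positive semidefinite form. -/
theorem sq_dotProduct_mulVec_le {M : Matrix ι ι ℝ} (hM : Mᵀ = M) (h0 : ∀ v, 0 ≤ quad M v)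
    (v w : ι → ℝ) : (v ⬝ᵥ (M *ᵥ w)) ^ 2 ≤ quad M v * quad M w := by
  have h : ∀ t : ℝ, 0 ≤ quad M w * (t * t) + (2 * (v ⬝ᵥ (M *ᵥ w))) * t + quad M v := by
    intro t
    have h1 := h0 (v + t • w)
    rw [quad_add_right hM, Matrix.mulVec_smul, dotProduct_smul, quad_smul_right, smul_eq_mul] at h1
    linarith
  have := discrim_le_zero h
  unfold discrim at this
  nlinarith

theorem abs_dotProduct_mulVec_le {M : Matrix ι ι ℝ} (hM : Mᵀ = M) (h0 : ∀ v, 0 ≤ quad M v)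
    (v w : ι → ℝ) : |v ⬝ᵥ (M *ᵥ w)| ≤ √(quad M v) * √(quad M w) := by
  rw [← Real.sqrt_mul (h0 v), ← Real.sqrt_sq_eq_abs]
  exact Real.sqrt_le_sqrt (sq_dotProduct_mulVec_le hM h0 v w)

theorem quad_nonneg_of_posDef {M : Matrix ι ι ℝ} (hM : M.PosDef) (v : ι → ℝ) : 0 ≤ quad M v := by
  simpa [quad] using hM.posSemidef.dotProduct_mulVec_nonneg v

theorem transpose_eq_of_posDef {M : Matrix ι ι ℝ} (hM : M.PosDef) : Mᵀ = M := by
  rw [← Matrix.conjTranspose_eq_transpose_of_trivial]; exact hM.isHermitian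

theorem posDef_of_quad {M : Matrix ι ι ℝ} (hM : Mᵀ = M) (h : ∀ v, v ≠ 0 → 0 < quad M v) :
    M.PosDef := by
  refine Matrix.PosDef.of_dotProduct_mulVec_pos ?_ ?_
  · rw [Matrix.IsHermitian, Matrix.conjTranspose_eq_transpose_of_trivial]; exact hM
  · intro x hx
    simpa [quad] using h x hx

/-- The comparison that avoids a second-order term: `|y - δ|²` is expanded around whichever of
`√s` and `|y|` is smaller. -/
theorem sub_quad_sub_le {P : Matrix ι ι ℝ} (hP : Pᵀ = P) (h0 : ∀ v, 0 ≤ quad P v)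
    {s : ℝ} (hs : 0 ≤ s) (y e : ι → ℝ) :
    s - quad P (y - e) ≤ max (s - quad P y) 0 + 2 * √s * √(quad P e) := by
  have hcs := (le_abs_self _).trans (abs_dotProduct_mulVec_le hP h0 y e)
  rw [quad_sub_right hP]
  obtain ⟨p, hp, rfl⟩ : ∃ p, 0 ≤ p ∧ p ^ 2 = s := ⟨√s, Real.sqrt_nonneg _, Real.sq_sqrt hs⟩
  have hq := Real.sq_sqrt (h0 y)
  have hd := Real.sq_sqrt (h0 e)
  have hq0 := Real.sqrt_nonneg (quad P y)
  have hd0 := Real.sqrt_nonneg (quad P e)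
  rw [Real.sqrt_sq hp]
  set q := √(quad P y)
  set d := √(quad P e)
  rw [← hq, ← hd]
  rcases le_total q p with h | h
  · have := le_max_left (p ^ 2 - q ^ 2) 0
    nlinarith
  · have := le_max_right (p ^ 2 - q ^ 2) 0
    rcases le_total p d with h' | h'
    · nlinarith [sq_nonneg (q - d)]
    · nlinarith [mul_nonneg (sub_nonneg.2 h) (sub_nonneg.2 h')]

theorem two_mul_sqrt_mul_sqrt_le {a b u v θ : ℝ} (ha : 0 ≤ a) (hθ : 0 < θ)
    (hu : 0 ≤ u) (hv : 0 ≤ v) (h : a * b ≤ u * v) : 2 * √a * √b ≤ θ * u + v / θ := by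
  rw [mul_assoc, ← Real.sqrt_mul ha]
  have h1 : √(a * b) ≤ √(u * v) := Real.sqrt_le_sqrt h
  have h2 : u * v = (θ * u) * (v / θ) := by field_simp
  have h3 : √(u * v) ≤ (θ * u + v / θ) / 2 := by
    rw [h2]
    apply Real.sqrt_le_iff.2
    have : 0 ≤ θ * u := by positivity
    have : 0 ≤ v / θ := by positivity
    constructor
    · positivity
    · nlinarith [sq_nonneg (θ * u - v / θ)]
  linarith

end QuadraticForms

/-! ### The Riccati recursion -/

section Riccati

variable {n d : ℕ} {Q : Matrix (Fin n) (Fin n) ℝ} {R : Matrix (Fin d) (Fin d) ℝ}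

/-- The optimal gain with `j + 1` steps to go. -/
noncomputable def gainToGo (Q : Matrix (Fin n) (Fin n) ℝ) (R : Matrix (Fin d) (Fin d) ℝ)
    (Θ : Param n d) (j : ℕ) : Matrix (Fin d) (Fin n) ℝ :=
  -((R + (Bmat Θ)ᵀ * riccati Q R Θ j * Bmat Θ)⁻¹ * (Bmat Θ)ᵀ * riccati Q R Θ j * Amat Θ)

theorem riccati_succ_eq (Θ : Param n d) (j : ℕ) :
    riccati Q R Θ (j + 1) = Q + (Amat Θ)ᵀ * riccati Q R Θ j * Amat Θ
      - (Amat Θ)ᵀ * riccati Q R Θ j * Bmat Θ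
        * (R + (Bmat Θ)ᵀ * riccati Q R Θ j * Bmat Θ)⁻¹
        * (Bmat Θ)ᵀ * riccati Q R Θ j * Amat Θ := rfl

theorem gain_eq_gainToGo {H h : ℕ} (Θ : Param n d) (h2 : h ≤ H) :
    gain Q R H Θ h = gainToGo Q R Θ (H - h) := by
  have : H + 1 - (h + 1) = H - h := by omega
  simp only [gain, gainToGo, Pmat, this, neg_smul, one_smul]

theorem transpose_conj {ι κ : Type*} [Fintype ι] {P : Matrix ι ι ℝ} (hP : Pᵀ = P)
    (B : Matrix ι κ ℝ) : (Bᵀ * P * B)ᵀ = Bᵀ * P * B := by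
  rw [Matrix.transpose_mul, Matrix.transpose_mul, Matrix.transpose_transpose, hP, Matrix.mul_assoc]

theorem riccati_transpose (hQ : Q.PosDef) (hR : R.PosDef) (Θ : Param n d) (j : ℕ) :
    (riccati Q R Θ j)ᵀ = riccati Q R Θ j := by
  induction j with
  | zero => simp [riccati]
  | succ j ih =>
    rw [riccati_succ_eq]
    simp only [Matrix.transpose_add, Matrix.transpose_sub, transpose_eq_of_posDef hR,
      transpose_eq_of_posDef hQ, Matrix.transpose_mul, Matrix.transpose_nonsing_inv, ih,
      Matrix.transpose_transpose, Matrix.mul_assoc]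

/-- Completing the square in the Bellman equation. -/
theorem stepCost_add_quad (hR : R.PosDef) (Θ : Param n d) (j : ℕ)
    (hP : (riccati Q R Θ j)ᵀ = riccati Q R Θ j) (h0 : ∀ v, 0 ≤ quad (riccati Q R Θ j) v)
    (x : Fin n → ℝ) (u : Fin d → ℝ) :
    stepCost Q R x u + quad (riccati Q R Θ j) (Amat Θ *ᵥ x + Bmat Θ *ᵥ u)
      = quad (riccati Q R Θ (j + 1)) x
        + quad (R + (Bmat Θ)ᵀ * riccati Q R Θ j * Bmat Θ) (u - gainToGo Q R Θ j *ᵥ x) := by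
  set P := riccati Q R Θ j with hPdef
  set A := Amat Θ
  set B := Bmat Θ
  have hSt : (R + Bᵀ * P * B)ᵀ = R + Bᵀ * P * B := by
    rw [Matrix.transpose_add, transpose_conj hP, transpose_eq_of_posDef hR]
  have hSpos : (R + Bᵀ * P * B).PosDef := by
    refine posDef_of_quad hSt fun v hv => ?_
    rw [quad_add_left, quad_conj]
    have h1 : 0 < quad R v := by simpa [quad] using hR.dotProduct_mulVec_pos hv
    linarith [h0 (B *ᵥ v)]
  have hSdet : IsUnit (R + Bᵀ * P * B).det := (Matrix.isUnit_iff_isUnit_det _).1 hSpos.isUnit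
  set S := R + Bᵀ * P * B with hS
  have hric : riccati Q R Θ (j + 1) = Q + Aᵀ * P * A - (Bᵀ * P * A)ᵀ * S⁻¹ * (Bᵀ * P * A) := by
    rw [riccati_succ_eq]
    simp only [Matrix.transpose_mul, Matrix.transpose_transpose, hP, Matrix.mul_assoc, A, B, S, P]
  have hK : gainToGo Q R Θ j *ᵥ x = -(S⁻¹ *ᵥ ((Bᵀ * P * A) *ᵥ x)) := by
    simp only [gainToGo, Matrix.neg_mulVec, Matrix.mulVec_mulVec, Matrix.mul_assoc, A, B, S, P]
  rw [hric, hK, sub_neg_eq_add, quad_add_right hSt, quad_add_right hP]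
  have e1 : S *ᵥ (S⁻¹ *ᵥ ((Bᵀ * P * A) *ᵥ x)) = (Bᵀ * P * A) *ᵥ x := by
    rw [Matrix.mulVec_mulVec, Matrix.mul_nonsing_inv _ hSdet, Matrix.one_mulVec]
  have e2 : quad S (S⁻¹ *ᵥ ((Bᵀ * P * A) *ᵥ x)) = quad S⁻¹ ((Bᵀ * P * A) *ᵥ x) := by
    unfold quad
    rw [e1, dotProduct_comm]
  have e3 : (A *ᵥ x) ⬝ᵥ (P *ᵥ (B *ᵥ u)) = u ⬝ᵥ ((Bᵀ * P * A) *ᵥ x) := by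
    rw [dotProduct_mulVec_comm hP, ← Matrix.mulVec_mulVec, ← Matrix.mulVec_mulVec,
      Matrix.dotProduct_mulVec u, Matrix.vecMul_transpose]
  rw [e1, e2, e3, quad_sub_left, quad_add_left, quad_conj, quad_conj (Bᵀ * P * A) S⁻¹, hS,
    quad_add_left, quad_conj]
  unfold stepCost
  simp only [quad]
  ring

theorem riccati_quad_nonneg (hQ : Q.PosDef) (hR : R.PosDef) (Θ : Param n d) (j : ℕ)
    (x : Fin n → ℝ) : 0 ≤ quad (riccati Q R Θ j) x := by
  induction j generalizing x with
  | zero => simp [riccati]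
  | succ j ih =>
    have h := stepCost_add_quad (Q := Q) hR Θ j (riccati_transpose hQ hR Θ j) ih x
      (gainToGo Q R Θ j *ᵥ x)
    rw [sub_self, quad_zero_right, add_zero] at h
    rw [← h]
    have h1 := quad_nonneg_of_posDef hQ x
    have h2 := quad_nonneg_of_posDef hR (gainToGo Q R Θ j *ᵥ x)
    unfold stepCost
    simp only [quad] at h1 h2 ih ⊢
    linarith [ih (Amat Θ *ᵥ x + Bmat Θ *ᵥ (gainToGo Q R Θ j *ᵥ x))]

theorem stepCost_nonneg (hQ : Q.PosDef) (hR : R.PosDef) (x : Fin n → ℝ) (u : Fin d → ℝ) :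
    0 ≤ stepCost Q R x u :=
  add_nonneg (quad_nonneg_of_posDef hQ x) (quad_nonneg_of_posDef hR u)

/-- The Bellman equation at the optimal control. -/
theorem riccati_succ_quad_eq (hQ : Q.PosDef) (hR : R.PosDef) (Θ : Param n d) (j : ℕ)
    (x : Fin n → ℝ) :
    quad (riccati Q R Θ (j + 1)) x = stepCost Q R x (gainToGo Q R Θ j *ᵥ x)
      + quad (riccati Q R Θ j) (Amat Θ *ᵥ x + Bmat Θ *ᵥ (gainToGo Q R Θ j *ᵥ x)) := by
  have h := stepCost_add_quad (Q := Q) hR Θ j (riccati_transpose hQ hR Θ j)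
    (riccati_quad_nonneg hQ hR Θ j) x (gainToGo Q R Θ j *ᵥ x)
  rw [sub_self, quad_zero_right, add_zero] at h
  exact h.symm

/-- The Bellman inequality for an arbitrary control. -/
theorem riccati_succ_quad_le (hQ : Q.PosDef) (hR : R.PosDef) (Θ : Param n d) (j : ℕ)
    (x : Fin n → ℝ) (u : Fin d → ℝ) :
    quad (riccati Q R Θ (j + 1)) x ≤ stepCost Q R x u
      + quad (riccati Q R Θ j) (Amat Θ *ᵥ x + Bmat Θ *ᵥ u) := by
  rw [stepCost_add_quad hR Θ j (riccati_transpose hQ hR Θ j) (riccati_quad_nonneg hQ hR Θ j) x u,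
    quad_add_left, quad_conj]
  have h1 := quad_nonneg_of_posDef hR (u - gainToGo Q R Θ j *ᵥ x)
  have h2 := riccati_quad_nonneg hQ hR Θ j (Bmat Θ *ᵥ (u - gainToGo Q R Θ j *ᵥ x))
  linarith

theorem riccati_quad_mono (hQ : Q.PosDef) (hR : R.PosDef) (Θ : Param n d) (j : ℕ)
    (x : Fin n → ℝ) : quad (riccati Q R Θ j) x ≤ quad (riccati Q R Θ (j + 1)) x := by
  induction j generalizing x with
  | zero => simpa [riccati] using riccati_quad_nonneg hQ hR Θ 1 x
  | succ j ih =>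
    rw [riccati_succ_quad_eq hQ hR Θ (j + 1)]
    exact (riccati_succ_quad_le hQ hR Θ j x _).trans (by linarith [ih (Amat Θ *ᵥ x
      + Bmat Θ *ᵥ (gainToGo Q R Θ (j + 1) *ᵥ x))])

/-- The bound obtained from the zero control. -/
theorem riccati_succ_quad_le_zero (hQ : Q.PosDef) (hR : R.PosDef) (Θ : Param n d) (j : ℕ)
    (x : Fin n → ℝ) :
    quad (riccati Q R Θ (j + 1)) x ≤ quad Q x + quad (riccati Q R Θ j) (Amat Θ *ᵥ x) := by
  have h := riccati_succ_quad_le hQ hR Θ j x 0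
  simpa [stepCost, quad] using h

theorem riccati_quad_le_nat_mul (hQ : Q.PosDef) (hR : R.PosDef) {C : ℝ} (hC : 0 ≤ C)
    (hQC : opNorm Q ≤ C)
    (Θ : Param n d) (hA : ∀ x, (Amat Θ *ᵥ x) ⬝ᵥ (Amat Θ *ᵥ x) ≤ x ⬝ᵥ x) (j : ℕ)
    (x : Fin n → ℝ) : quad (riccati Q R Θ j) x ≤ C * j * (x ⬝ᵥ x) := by
  induction j generalizing x with
  | zero => simp [riccati]
  | succ j ih =>
    have h1 := riccati_succ_quad_le_zero hQ hR Θ j x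
    have h2 := quad_le_opNorm Q x
    have h3 := mul_le_mul_of_nonneg_right hQC (dotProduct_self_nonneg_real x)
    have h4 := ih (Amat Θ *ᵥ x)
    have h5 := mul_le_mul_of_nonneg_left (hA x) (by positivity : 0 ≤ C * j)
    push_cast
    linarith

/-- For a contractive `A` the optimal cost is bounded independently of the horizon. -/
theorem riccati_quad_le_of_contraction (hQ : Q.PosDef) (hR : R.PosDef) {C a : ℝ} (hC : 0 ≤ C)
    (ha0 : 0 ≤ a) (ha1 : a < 1) (hQC : opNorm Q ≤ C) (Θ : Param n d)
    (hA : opNorm (Amat Θ) ≤ a) (j : ℕ) (x : Fin n → ℝ) :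
    quad (riccati Q R Θ j) x ≤ C / (1 - a ^ 2) * (x ⬝ᵥ x) := by
  have ha : 0 < 1 - a ^ 2 := by nlinarith
  induction j generalizing x with
  | zero =>
    have := dotProduct_self_nonneg_real x
    simp only [riccati, quad_zero_left]
    positivity
  | succ j ih =>
    have h1 := riccati_succ_quad_le_zero hQ hR Θ j x
    have h2 := quad_le_opNorm Q x
    have h3 := mul_le_mul_of_nonneg_right hQC (dotProduct_self_nonneg_real x)
    have h4 := ih (Amat Θ *ᵥ x)
    have h6 : (Amat Θ *ᵥ x) ⬝ᵥ (Amat Θ *ᵥ x) ≤ a ^ 2 * (x ⬝ᵥ x) := by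
      rw [← euclNorm_sq, ← euclNorm_sq, ← mul_pow]
      exact pow_le_pow_left₀ (euclNorm_nonneg _) ((euclNorm_mulVec_le _ _).trans
        (mul_le_mul_of_nonneg_right hA (euclNorm_nonneg _))) 2
    have h5 := mul_le_mul_of_nonneg_left h6 (by positivity : 0 ≤ C / (1 - a ^ 2))
    have h7 : C / (1 - a ^ 2) * (a ^ 2 * (x ⬝ᵥ x)) + C * (x ⬝ᵥ x)
        = C / (1 - a ^ 2) * (x ⬝ᵥ x) := by field_simp; ring
    linarith

end Riccati

end PrivateLQ

namespace PrivateLQ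

/-! ### Extremal vectors of a symmetric matrix -/

section Extremal

variable {ι : Type*} [Fintype ι]

theorem quad_nonneg_mulVec_eq_zero {M : Matrix ι ι ℝ} (hM : Mᵀ = M) (h0 : ∀ v, 0 ≤ quad M v)
    {v : ι → ℝ} (hv : quad M v = 0) : M *ᵥ v = 0 := by
  have h := sq_dotProduct_mulVec_le hM h0 (M *ᵥ v) v
  rw [hv, mul_zero] at h
  have h2 : (M *ᵥ v) ⬝ᵥ (M *ᵥ v) = 0 := by nlinarith
  exact dotProduct_self_eq_zero.1 h2

theorem continuous_quad_toLp (M : Matrix ι ι ℝ) :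
    Continuous fun v : EuclideanSpace ℝ ι => quad M (v : ι → ℝ) := by
  unfold quad dotProduct Matrix.mulVec dotProduct
  fun_prop

/-- A symmetric form attains its maximum on the unit sphere, at an eigenvector. -/
theorem exists_max_quad [DecidableEq ι] [Nonempty ι] {M : Matrix ι ι ℝ} (hM : Mᵀ = M) :
    ∃ e : ι → ℝ, e ⬝ᵥ e = 1 ∧ (∀ y, quad M y ≤ quad M e * (y ⬝ᵥ y)) ∧
      M *ᵥ e = quad M e • e := by
  obtain ⟨e, he, hmax⟩ := (isCompact_sphere (0 : EuclideanSpace ℝ ι) 1).exists_isMaxOn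
    (NormedSpace.sphere_nonempty.2 zero_le_one) (continuous_quad_toLp M).continuousOn
  have he1 : (e : ι → ℝ) ⬝ᵥ (e : ι → ℝ) = 1 := by
    rw [← euclNorm_sq]
    have : euclNorm (e : ι → ℝ) = 1 := by simpa [euclNorm] using he
    rw [this]; norm_num
  have hle : ∀ y, quad M y ≤ quad M e * (y ⬝ᵥ y) := by
    intro y
    by_cases hy : y ⬝ᵥ y = 0
    · have : y = 0 := dotProduct_self_eq_zero.1 hy
      subst this
      simp
    · have hpos : 0 < y ⬝ᵥ y := lt_of_le_of_ne (dotProduct_self_nonneg_real y) (Ne.symm hy)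
      have hn : euclNorm y ^ 2 = y ⬝ᵥ y := euclNorm_sq y
      have hn0 : 0 < euclNorm y := by
        rcases (euclNorm_nonneg y).eq_or_lt with h | h
        · rw [← h] at hn; norm_num at hn; exact absurd hn.symm hy
        · exact h
      have hmem : WithLp.toLp 2 ((euclNorm y)⁻¹ • y) ∈ Metric.sphere (0 : EuclideanSpace ℝ ι) 1 := by
        rw [mem_sphere_zero_iff_norm, WithLp.toLp_smul, norm_smul, norm_inv, Real.norm_eq_abs,
          abs_of_nonneg hn0.le]
        exact inv_mul_cancel₀ hn0.ne'
      have := hmax hmem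
      simp only [Set.mem_ofPred_eq] at this
      rw [quad_smul_right, inv_pow, hn] at this
      rw [inv_mul_le_iff₀ hpos] at this
      linarith
  refine ⟨e, he1, hle, ?_⟩
  have hz : (quad M e • (1 : Matrix ι ι ℝ) - M) *ᵥ (e : ι → ℝ) = 0 := by
    apply quad_nonneg_mulVec_eq_zero
    · rw [Matrix.transpose_sub, Matrix.transpose_smul, Matrix.transpose_one, hM]
    · intro v
      rw [quad_sub_left, quad_smul_left, quad_one]
      linarith [hle v]
    · rw [quad_sub_left, quad_smul_left, quad_one, he1]
      ring
  rw [Matrix.sub_mulVec, Matrix.smul_mulVec, Matrix.one_mulVec, sub_eq_zero] at hz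
  exact hz.symm

end Extremal

/-! ### Frobenius norm -/

section Frobenius

variable {ι κ : Type*} [Fintype ι] [Fintype κ]

theorem trace_transpose_mul_self_eq (A : Matrix ι κ ℝ) :
    Matrix.trace (Aᵀ * A) = ∑ j, (fun i => A i j) ⬝ᵥ (fun i => A i j) := by
  simp [Matrix.trace, Matrix.mul_apply, dotProduct]

theorem trace_transpose_mul_self_nonneg (A : Matrix ι κ ℝ) : 0 ≤ Matrix.trace (Aᵀ * A) := by
  rw [trace_transpose_mul_self_eq]
  exact Finset.sum_nonneg fun j _ => dotProduct_self_nonneg_real _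

theorem frobNorm_sq (A : Matrix ι κ ℝ) : frobNorm A ^ 2 = Matrix.trace (Aᵀ * A) :=
  Real.sq_sqrt (trace_transpose_mul_self_nonneg A)

theorem dotProduct_self_transpose_mulVec (A : Matrix ι κ ℝ) (z : ι → ℝ) :
    (Aᵀ *ᵥ z) ⬝ᵥ (Aᵀ *ᵥ z) = ∑ j, ((fun i => A i j) ⬝ᵥ z) ^ 2 := by
  simp [Matrix.mulVec, dotProduct, pow_two]

theorem transpose_mulVec_le_frobNorm (A : Matrix ι κ ℝ) (z : ι → ℝ) :
    (Aᵀ *ᵥ z) ⬝ᵥ (Aᵀ *ᵥ z) ≤ frobNorm A ^ 2 * (z ⬝ᵥ z) := by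
  rw [frobNorm_sq, trace_transpose_mul_self_eq, dotProduct_self_transpose_mulVec, Finset.sum_mul]
  refine Finset.sum_le_sum fun j _ => ?_
  rw [← euclNorm_sq, ← euclNorm_sq, ← mul_pow, ← sq_abs]
  exact pow_le_pow_left₀ (abs_nonneg _) (abs_dotProduct_le _ _) 2

/-- Bessel's inequality for two orthogonal vectors, summed over the columns of `A`. -/
theorem transpose_mulVec_add_le_frobNorm (A : Matrix ι κ ℝ) {e z : ι → ℝ} (he : e ⬝ᵥ e = 1)
    (hez : e ⬝ᵥ z = 0) :
    ((Aᵀ *ᵥ e) ⬝ᵥ (Aᵀ *ᵥ e)) * (z ⬝ᵥ z) + (Aᵀ *ᵥ z) ⬝ᵥ (Aᵀ *ᵥ z)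
      ≤ frobNorm A ^ 2 * (z ⬝ᵥ z) := by
  rw [frobNorm_sq, trace_transpose_mul_self_eq, dotProduct_self_transpose_mulVec,
    dotProduct_self_transpose_mulVec, Finset.sum_mul, Finset.sum_mul, ← Finset.sum_add_distrib]
  refine Finset.sum_le_sum fun j _ => ?_
  set c : ι → ℝ := fun i => A i j
  have h1 := abs_dotProduct_le (c - (c ⬝ᵥ e) • e) z
  have h2 : (c - (c ⬝ᵥ e) • e) ⬝ᵥ z = c ⬝ᵥ z := by
    rw [sub_dotProduct, smul_dotProduct, hez, smul_zero, sub_zero]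
  have h3 : (c - (c ⬝ᵥ e) • e) ⬝ᵥ (c - (c ⬝ᵥ e) • e) = c ⬝ᵥ c - (c ⬝ᵥ e) ^ 2 := by
    simp only [sub_dotProduct, dotProduct_sub, smul_dotProduct, dotProduct_smul, he, smul_eq_mul,
      dotProduct_comm e c]
    ring
  have h4 := pow_le_pow_left₀ (abs_nonneg _) h1 2
  rw [sq_abs, h2, mul_pow, euclNorm_sq, euclNorm_sq, h3] at h4
  linarith

end Frobenius

/-! ### Comparing the cost of a policy with its predicted cost -/

section Comparison

variable {n d : ℕ}

theorem transpose_mulVec_sumElim (Θ : Param n d) (x : Fin n → ℝ) (u : Fin d → ℝ) :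
    Θᵀ *ᵥ (Sum.elim x u) = Amat Θ *ᵥ x + Bmat Θ *ᵥ u := by
  ext i
  simp [Matrix.mulVec, dotProduct, Amat, Bmat, Matrix.toRows₁, Matrix.toRows₂]

theorem sumElim_dotProduct_self {ι κ : Type*} [Fintype ι] [Fintype κ] (x : ι → ℝ) (u : κ → ℝ) :
    Sum.elim x u ⬝ᵥ Sum.elim x u = x ⬝ᵥ x + u ⬝ᵥ u := by
  simp

theorem Amat_mulVec_le (Θ : Param n d) (hΘ : frobNorm Θ ≤ 1) (x : Fin n → ℝ) :
    (Amat Θ *ᵥ x) ⬝ᵥ (Amat Θ *ᵥ x) ≤ x ⬝ᵥ x := by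
  have h := transpose_mulVec_le_frobNorm Θ (Sum.elim x 0)
  rw [transpose_mulVec_sumElim, sumElim_dotProduct_self] at h
  simp only [Matrix.mulVec_zero, add_zero, dotProduct_zero] at h
  have : frobNorm Θ ^ 2 ≤ 1 := pow_le_one₀ (Real.sqrt_nonneg _) hΘ
  nlinarith [dotProduct_self_nonneg_real x]

theorem Amat_sub (Θ Θ' : Param n d) : Amat (Θ - Θ') = Amat Θ - Amat Θ' := rfl

theorem Bmat_sub (Θ Θ' : Param n d) : Bmat (Θ - Θ') = Bmat Θ - Bmat Θ' := rfl

/-- The closed loop matrix `A + B K`. -/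
def closedLoop (Θ : Param n d) (K : Matrix (Fin d) (Fin n) ℝ) : Matrix (Fin n) (Fin n) ℝ :=
  Amat Θ + Bmat Θ * K

theorem closedLoop_mulVec (Θ : Param n d) (K : Matrix (Fin d) (Fin n) ℝ) (x : Fin n → ℝ) :
    closedLoop Θ K *ᵥ x = Amat Θ *ᵥ x + Bmat Θ *ᵥ (K *ᵥ x) := by
  rw [closedLoop, Matrix.add_mulVec, Matrix.mulVec_mulVec]

theorem closedLoop_sub_mulVec (Θ Θ' : Param n d) (K : Matrix (Fin d) (Fin n) ℝ) (x : Fin n → ℝ) :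
    closedLoop (Θ - Θ') K *ᵥ x = closedLoop Θ K *ᵥ x - closedLoop Θ' K *ᵥ x := by
  simp only [closedLoop_mulVec, Amat_sub, Bmat_sub, Matrix.sub_mulVec]
  abel

/-- The backward recursion `W_{j+1} = M_j + F_jᵀ W_j F_j`, indexed by the number of steps to go: the
quadratic form `W_j` sums the forms `M` along the path of `x ↦ F x`. -/
def backward (F M : ℕ → Matrix (Fin n) (Fin n) ℝ) : ℕ → Matrix (Fin n) (Fin n) ℝ
  | 0 => 0
  | j + 1 => M j + (F j)ᵀ * backward F M j * F j

@[simp] theorem backward_zero (F M : ℕ → Matrix (Fin n) (Fin n) ℝ) : backward F M 0 = 0 := rfl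

theorem quad_backward_succ (F M : ℕ → Matrix (Fin n) (Fin n) ℝ) (j : ℕ) (y : Fin n → ℝ) :
    quad (backward F M (j + 1)) y = quad (M j) y + quad (backward F M j) (F j *ᵥ y) := by
  rw [backward, quad_add_left, quad_conj]

theorem backward_transpose (F : ℕ → Matrix (Fin n) (Fin n) ℝ) {M : ℕ → Matrix (Fin n) (Fin n) ℝ}
    (hM : ∀ j, (M j)ᵀ = M j) (j : ℕ) : (backward F M j)ᵀ = backward F M j := by
  induction j with
  | zero => simp
  | succ j ih => rw [backward, Matrix.transpose_add, hM, transpose_conj ih]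

theorem quad_backward_nonneg (F : ℕ → Matrix (Fin n) (Fin n) ℝ) {M : ℕ → Matrix (Fin n) (Fin n) ℝ}
    (hM : ∀ j y, 0 ≤ quad (M j) y) (j : ℕ) (y : Fin n → ℝ) : 0 ≤ quad (backward F M j) y := by
  induction j generalizing y with
  | zero => simp
  | succ j ih => rw [quad_backward_succ]; exact add_nonneg (hM j y) (ih _)

theorem quad_backward_le_of_contraction {F M : ℕ → Matrix (Fin n) (Fin n) ℝ} {J : ℕ} {c r : ℝ}
    (hc : 0 ≤ c) (hr0 : 0 ≤ r) (hr1 : r < 1) (hM : ∀ j < J, ∀ y, quad (M j) y ≤ c * (y ⬝ᵥ y))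
    (hF : ∀ j < J, ∀ y, euclNorm (F j *ᵥ y) ≤ r * euclNorm y) {j : ℕ} (hj : j ≤ J)
    (y : Fin n → ℝ) : quad (backward F M j) y ≤ c / (1 - r ^ 2) * (y ⬝ᵥ y) := by
  have hr : 0 < 1 - r ^ 2 := by nlinarith
  induction j generalizing y with
  | zero =>
    have := dotProduct_self_nonneg_real y
    simp only [backward_zero, quad_zero_left]
    positivity
  | succ j ih =>
    rw [quad_backward_succ]
    have h1 := hM j (by omega) y
    have h2 := ih (by omega) (F j *ᵥ y)
    have h3 : (F j *ᵥ y) ⬝ᵥ (F j *ᵥ y) ≤ r ^ 2 * (y ⬝ᵥ y) := by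
      rw [← euclNorm_sq, ← euclNorm_sq, ← mul_pow]
      exact pow_le_pow_left₀ (euclNorm_nonneg _) (hF j (by omega) y) 2
    have h4 := mul_le_mul_of_nonneg_left h3 (by positivity : 0 ≤ c / (1 - r ^ 2))
    have h7 : c / (1 - r ^ 2) * (r ^ 2 * (y ⬝ᵥ y)) + c * (y ⬝ᵥ y)
        = c / (1 - r ^ 2) * (y ⬝ᵥ y) := by field_simp; ring
    linarith

theorem quad_backward_le_of_nonexpansive {F M : ℕ → Matrix (Fin n) (Fin n) ℝ} {J : ℕ} {c : ℝ}
    (hc : 0 ≤ c) (hM : ∀ j < J, ∀ y, quad (M j) y ≤ c * (y ⬝ᵥ y))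
    (hF : ∀ j < J, ∀ y, euclNorm (F j *ᵥ y) ≤ euclNorm y) {j : ℕ} (hj : j ≤ J)
    (y : Fin n → ℝ) : quad (backward F M j) y ≤ c * j * (y ⬝ᵥ y) := by
  induction j generalizing y with
  | zero => simp
  | succ j ih =>
    rw [quad_backward_succ]
    have h1 := hM j (by omega) y
    have h2 := ih (by omega) (F j *ᵥ y)
    have h3 : (F j *ᵥ y) ⬝ᵥ (F j *ᵥ y) ≤ y ⬝ᵥ y := by
      rw [← euclNorm_sq, ← euclNorm_sq]
      exact pow_le_pow_left₀ (euclNorm_nonneg _) (hF j (by omega) y) 2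
    have h4 := mul_le_mul_of_nonneg_left h3 (by positivity : 0 ≤ c * j)
    push_cast
    linarith

variable (Q : Matrix (Fin n) (Fin n) ℝ) (R : Matrix (Fin d) (Fin d) ℝ) (Θs Θt : Param n d)

/-- The closed loop of the system `Θs` under the optimal gains of `Θt`, by steps to go. -/
noncomputable def loopMat (j : ℕ) : Matrix (Fin n) (Fin n) ℝ :=
  closedLoop Θs (gainToGo Q R Θt j)

/-- The one-step prediction error of `Θt` in the closed loop, by steps to go. -/
noncomputable def devMat (j : ℕ) : Matrix (Fin n) (Fin n) ℝ :=
  closedLoop (Θs - Θt) (gainToGo Q R Θt j)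

/-- The one-step cost under the optimal gains of `Θt`, by steps to go. -/
noncomputable def costMat (j : ℕ) : Matrix (Fin n) (Fin n) ℝ :=
  Q + (gainToGo Q R Θt j)ᵀ * R * gainToGo Q R Θt j

theorem quad_costMat (j : ℕ) (x : Fin n → ℝ) :
    quad (costMat Q R Θt j) x = stepCost Q R x (gainToGo Q R Θt j *ᵥ x) := by
  rw [costMat, quad_add_left, quad_conj]
  rfl

variable {Q R}

theorem costMat_transpose (hQ : Q.PosDef) (hR : R.PosDef) (j : ℕ) :
    (costMat Q R Θt j)ᵀ = costMat Q R Θt j := by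
  rw [costMat, Matrix.transpose_add, transpose_conj (transpose_eq_of_posDef hR),
    transpose_eq_of_posDef hQ]

/-- The predicted cost of a state along the true closed loop. -/
theorem riccati_succ_quad_eq_dev (hQ : Q.PosDef) (hR : R.PosDef) (j : ℕ) (y : Fin n → ℝ) :
    quad (riccati Q R Θt (j + 1)) y = quad (costMat Q R Θt j) y
      + quad (riccati Q R Θt j) (loopMat Q R Θs Θt j *ᵥ y - devMat Q R Θs Θt j *ᵥ y) := by
  rw [riccati_succ_quad_eq hQ hR, quad_costMat, devMat, closedLoop_sub_mulVec, loopMat,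
    sub_sub_cancel, closedLoop_mulVec]

/-- One backward step of the excess cost; the excess is truncated at zero. -/
theorem excess_succ_le (hQ : Q.PosDef) (hR : R.PosDef) (j : ℕ) (y : Fin n → ℝ) :
    max (quad (backward (loopMat Q R Θs Θt) (costMat Q R Θt) (j + 1)) y
        - quad (riccati Q R Θt (j + 1)) y) 0
      ≤ max (quad (backward (loopMat Q R Θs Θt) (costMat Q R Θt) j) (loopMat Q R Θs Θt j *ᵥ y)
          - quad (riccati Q R Θt j) (loopMat Q R Θs Θt j *ᵥ y)) 0
        + 2 * √(quad (backward (loopMat Q R Θs Θt) (costMat Q R Θt) j) (loopMat Q R Θs Θt j *ᵥ y))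
          * √(quad (riccati Q R Θt j) (devMat Q R Θs Θt j *ᵥ y)) := by
  have hc : ∀ j y, 0 ≤ quad (costMat Q R Θt j) y := fun j y => by
    rw [quad_costMat]; exact stepCost_nonneg hQ hR _ _
  apply max_le
  · rw [quad_backward_succ, riccati_succ_quad_eq_dev Θs Θt hQ hR, add_sub_add_left_eq_sub]
    exact sub_quad_sub_le (riccati_transpose hQ hR Θt j) (riccati_quad_nonneg hQ hR Θt j)
      (quad_backward_nonneg _ hc _ _) _ _
  · positivity

/-- If both cost forms are bounded, the excess cost is controlled by the prediction errors along the
path, with a linear (rather than quadratic) dependence on the bounds. -/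
theorem excess_le_backward (hQ : Q.PosDef) (hR : R.PosDef) {J : ℕ} {c₁ c₂ θ : ℝ} (h1 : 0 ≤ c₁)
    (h2 : 0 ≤ c₂) (hθ : 0 < θ)
    (hP : ∀ j ≤ J, ∀ y, quad (riccati Q R Θt j) y ≤ c₁ * (y ⬝ᵥ y))
    (hW : ∀ j ≤ J, ∀ y, quad (backward (loopMat Q R Θs Θt) (costMat Q R Θt) j) y ≤ c₂ * (y ⬝ᵥ y))
    {j : ℕ} (hj : j ≤ J) (y : Fin n → ℝ) :
    quad (backward (loopMat Q R Θs Θt) (costMat Q R Θt) j) y - quad (riccati Q R Θt j) y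
      ≤ θ * quad (backward (loopMat Q R Θs Θt)
          (fun i => (devMat Q R Θs Θt i)ᵀ * devMat Q R Θs Θt i) j) y
        + c₁ * c₂ / θ * quad (backward (loopMat Q R Θs Θt)
          (fun i => (loopMat Q R Θs Θt i)ᵀ * loopMat Q R Θs Θt i) j) y := by
  have hc : ∀ j y, 0 ≤ quad (costMat Q R Θt j) y := fun j y => by
    rw [quad_costMat]; exact stepCost_nonneg hQ hR _ _
  have hpos : ∀ (N : ℕ → Matrix (Fin n) (Fin n) ℝ) j y, 0 ≤ quad ((N j)ᵀ * N j) y := fun N j y => by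
    rw [quad_transpose_mul]; exact dotProduct_self_nonneg_real _
  refine (le_max_left _ 0).trans ?_
  induction j generalizing y with
  | zero => simp [riccati]
  | succ j ih =>
    refine (excess_succ_le Θs Θt hQ hR j y).trans ?_
    have h3 := ih (by omega) (loopMat Q R Θs Θt j *ᵥ y)
    rw [quad_backward_succ, quad_backward_succ, quad_transpose_mul, quad_transpose_mul]
    set y' := loopMat Q R Θs Θt j *ᵥ y
    set e := devMat Q R Θs Θt j *ᵥ y
    have h4 : quad (backward (loopMat Q R Θs Θt) (costMat Q R Θt) j) y' * quad (riccati Q R Θt j) e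
        ≤ (e ⬝ᵥ e) * (c₁ * c₂ * (y' ⬝ᵥ y')) := by
      have := mul_le_mul (hW j (by omega) y') (hP j (by omega) e) (riccati_quad_nonneg hQ hR _ _ _)
        (mul_nonneg h2 (dotProduct_self_nonneg_real y'))
      linarith
    have h5 := two_mul_sqrt_mul_sqrt_le (quad_backward_nonneg _ hc j y') hθ
      (dotProduct_self_nonneg_real e)
      (mul_nonneg (mul_nonneg h1 h2) (dotProduct_self_nonneg_real y')) h4
    have h6 : c₁ * c₂ * (y' ⬝ᵥ y') / θ = c₁ * c₂ / θ * (y' ⬝ᵥ y') := by ring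
    rw [h6] at h5
    linarith

end Comparison

end PrivateLQ

namespace PrivateLQ

/-! ### The noise-free case with a non-expansive closed loop -/

section NonExpansive

variable {n d : ℕ} {Q : Matrix (Fin n) (Fin n) ℝ} {R : Matrix (Fin d) (Fin d) ℝ}

/-- If the optimal cost has a large maximal value `T`, then `A` nearly preserves the norm of the
maximizing direction `e`, so that the Frobenius bound leaves only `O(1/T)` for everything else: the
predicted next state is `O(1/T)` up to the component of the state in direction `e`, and that
component is paid for by the cost of the state. -/
theorem exists_riccati_quad_le_and_prediction_le [Nonempty (Fin n)] (hQ : Q.PosDef) (hR : R.PosDef)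
    {C : ℝ} (hC : 0 ≤ C) (hQC : opNorm Q ≤ C) {Θ : Param n d} (hΘ : frobNorm Θ ≤ 1) (j : ℕ) :
    ∃ T : ℝ, 0 < T ∧ T ≤ C * (j + 1) ∧
      (∀ i ≤ j + 1, ∀ y, quad (riccati Q R Θ i) y ≤ T * (y ⬝ᵥ y)) ∧
      ∀ (y : Fin n → ℝ) (u : Fin d → ℝ),
        T * ((Amat Θ *ᵥ y + Bmat Θ *ᵥ u) ⬝ᵥ (Amat Θ *ᵥ y + Bmat Θ *ᵥ u))
          ≤ 2 * quad (riccati Q R Θ (j + 1)) y + 2 * C * (y ⬝ᵥ y + u ⬝ᵥ u) := by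
  obtain ⟨e, he, hmax, heig⟩ := exists_max_quad (riccati_transpose hQ hR Θ (j + 1))
  set P := riccati Q R Θ (j + 1) with hP
  set T := quad P e with hT
  have hmono : ∀ i ≤ j + 1, ∀ y, quad (riccati Q R Θ i) y ≤ quad P y := by
    intro i hi y
    exact monotone_nat_of_le_succ (f := fun i => quad (riccati Q R Θ i) y)
      (fun i => riccati_quad_mono hQ hR Θ i y) hi
  -- `T` is at least the value of `Q = P_1` at `e`, since the optimal cost grows with the horizon
  have hTpos : 0 < T := by
    have h1 := hmono 1 (by omega) e
    have h2 : quad (riccati Q R Θ 1) e = quad Q e := by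
      have h : riccati Q R Θ 1 = Q := by rw [riccati_succ_eq]; simp [riccati]
      rw [h]
    have h3 : 0 < quad Q e := by
      have : e ≠ 0 := by rintro rfl; simp at he
      simpa [quad] using hQ.dotProduct_mulVec_pos this
    linarith
  have hle : ∀ i ≤ j + 1, ∀ y, quad (riccati Q R Θ i) y ≤ T * (y ⬝ᵥ y) := fun i hi y =>
    (hmono i hi y).trans (hmax y)
  have hA1 := Amat_mulVec_le Θ hΘ
  refine ⟨T, hTpos, ?_, hle, fun y u => ?_⟩
  · have := riccati_quad_le_nat_mul hQ hR hC hQC Θ hA1 (j + 1) e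
    rw [he, mul_one] at this
    exact_mod_cast this
  · have hTA : T ≤ C + T * ((Amat Θ *ᵥ e) ⬝ᵥ (Amat Θ *ᵥ e)) := by
      have h1 := riccati_succ_quad_le_zero hQ hR Θ j e
      have h2 := quad_le_opNorm Q e
      have h3 := hle j (by omega) (Amat Θ *ᵥ e)
      rw [he, mul_one] at h2
      linarith
    -- split the state-control pair into its component along `e` and the rest
    set ê : Fin n ⊕ Fin d → ℝ := Sum.elim e 0 with hê
    set z' : Fin n ⊕ Fin d → ℝ := Sum.elim (y - (e ⬝ᵥ y) • e) u with hz'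
    have hêê : ê ⬝ᵥ ê = 1 := by rw [hê, sumElim_dotProduct_self, he]; simp
    have hêz : ê ⬝ᵥ z' = 0 := by
      have : ê ⬝ᵥ z' = e ⬝ᵥ (y - (e ⬝ᵥ y) • e) := by simp [hê, hz']
      rw [this, dotProduct_sub, dotProduct_smul, he]; simp
    have hB := transpose_mulVec_add_le_frobNorm Θ hêê hêz
    have hf : frobNorm Θ ^ 2 ≤ 1 := pow_le_one₀ (Real.sqrt_nonneg _) hΘ
    have hê' : Θᵀ *ᵥ ê = Amat Θ *ᵥ e := by rw [hê, transpose_mulVec_sumElim]; simp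
    have hz'' : Θᵀ *ᵥ z' = Amat Θ *ᵥ (y - (e ⬝ᵥ y) • e) + Bmat Θ *ᵥ u := by
      rw [hz', transpose_mulVec_sumElim]
    have hzz : z' ⬝ᵥ z' = y ⬝ᵥ y - (e ⬝ᵥ y) ^ 2 + u ⬝ᵥ u := by
      rw [hz', sumElim_dotProduct_self]
      simp only [sub_dotProduct, dotProduct_sub, smul_dotProduct, dotProduct_smul, he, smul_eq_mul,
        dotProduct_comm y e]
      ring
    have hdec : Amat Θ *ᵥ y + Bmat Θ *ᵥ u = (e ⬝ᵥ y) • (Amat Θ *ᵥ e) + Θᵀ *ᵥ z' := by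
      rw [hz'', Matrix.mulVec_sub, Matrix.mulVec_smul]; abel
    rw [hê'] at hB
    set a := Amat Θ *ᵥ e
    set r := Θᵀ *ᵥ z'
    have hz0 := dotProduct_self_nonneg_real z'
    have ha0 := dotProduct_self_nonneg_real a
    have ha1 : a ⬝ᵥ a ≤ 1 := by rw [← he]; exact hA1 e
    -- what the Frobenius bound leaves for directions orthogonal to `e`
    have hr : T * (r ⬝ᵥ r) ≤ C * (z' ⬝ᵥ z') := by
      have h1 : r ⬝ᵥ r ≤ (1 - a ⬝ᵥ a) * (z' ⬝ᵥ z') := by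
        nlinarith [mul_le_mul_of_nonneg_right hf hz0]
      have h2 := mul_le_mul_of_nonneg_left h1 hTpos.le
      have h3 : T * (1 - a ⬝ᵥ a) ≤ C := by linarith
      nlinarith [mul_le_mul_of_nonneg_right h3 hz0]
    -- `e` is an eigenvector for `T`, so the component along `e` alone costs `T (e · y)²`
    have hey : T * (e ⬝ᵥ y) ^ 2 ≤ quad P y := by
      have h := sq_dotProduct_mulVec_le (riccati_transpose hQ hR Θ (j + 1))
        (riccati_quad_nonneg hQ hR Θ (j + 1)) y e
      rw [← hP, heig, dotProduct_smul, smul_eq_mul, ← hT, dotProduct_comm y e] at h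
      have h' : T * (T * (e ⬝ᵥ y) ^ 2) ≤ T * quad P y := by linarith
      exact le_of_mul_le_mul_left h' hTpos
    have hsq : ((e ⬝ᵥ y) • a + r) ⬝ᵥ ((e ⬝ᵥ y) • a + r)
        ≤ 2 * ((e ⬝ᵥ y) ^ 2 * (a ⬝ᵥ a)) + 2 * (r ⬝ᵥ r) := by
      have h := dotProduct_self_nonneg_real ((e ⬝ᵥ y) • a - r)
      simp only [sub_dotProduct, dotProduct_sub, add_dotProduct, dotProduct_add, smul_dotProduct,
        dotProduct_smul, smul_eq_mul] at h ⊢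
      linarith
    rw [hdec]
    have h1 := mul_le_mul_of_nonneg_left hsq hTpos.le
    have h2 : T * (e ⬝ᵥ y) ^ 2 * (a ⬝ᵥ a) ≤ T * (e ⬝ᵥ y) ^ 2 :=
      mul_le_of_le_one_right (by positivity) ha1
    have h3 : z' ⬝ᵥ z' ≤ y ⬝ᵥ y + u ⬝ᵥ u := by rw [hzz]; linarith [sq_nonneg (e ⬝ᵥ y)]
    have h4 := mul_le_mul_of_nonneg_left h3 hC
    linarith

/-- The sum of the norms of the prediction errors along the closed loop path from `y`. -/
noncomputable def devSum (F N : ℕ → Matrix (Fin n) (Fin n) ℝ) : ℕ → (Fin n → ℝ) → ℝ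
  | 0, _ => 0
  | j + 1, y => euclNorm (N j *ᵥ y) + devSum F N j (F j *ᵥ y)

theorem devSum_nonneg (F N : ℕ → Matrix (Fin n) (Fin n) ℝ) (j : ℕ) (y : Fin n → ℝ) :
    0 ≤ devSum F N j y := by
  induction j generalizing y with
  | zero => exact le_rfl
  | succ j ih => exact add_nonneg (euclNorm_nonneg _) (ih _)

theorem devSum_sq_le (F N : ℕ → Matrix (Fin n) (Fin n) ℝ) (j : ℕ) (y : Fin n → ℝ) :
    devSum F N j y ^ 2 ≤ j * quad (backward F (fun i => (N i)ᵀ * N i) j) y := by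
  induction j generalizing y with
  | zero => simp [devSum]
  | succ j ih =>
    have h := ih (F j *ᵥ y)
    rw [quad_backward_succ, quad_transpose_mul, ← euclNorm_sq]
    have h0 : 0 ≤ quad (backward F (fun i => (N i)ᵀ * N i) j) (F j *ᵥ y) :=
      quad_backward_nonneg _ (fun i y => by
        rw [quad_transpose_mul]; exact dotProduct_self_nonneg_real _) _ _
    simp only [devSum]
    set a := euclNorm (N j *ᵥ y)
    set b := devSum F N j (F j *ᵥ y)
    set S := quad (backward F (fun i => (N i)ᵀ * N i) j) (F j *ᵥ y)
    push_cast
    have h2 : 2 * a * b ≤ j * a ^ 2 + S := by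
      have h3 : (a * b) ^ 2 ≤ (j * a ^ 2) * S := by
        rw [mul_pow]; nlinarith [sq_nonneg a]
      have h4 : (2 * (a * b)) ^ 2 ≤ (j * a ^ 2 + S) ^ 2 := by nlinarith [sq_nonneg (j * a ^ 2 - S)]
      have h5 := abs_le_of_sq_le_sq h4 (by positivity)
      linarith [(abs_le.1 (abs_le_of_sq_le_sq h4 (by positivity))).2]
    nlinarith

/-- The numerical core of `excess_le_of_nonexpansive`. -/
theorem excess_arith {D₀ D₁ s t e ℓ L Y k c C H θ : ℝ} (hc : 0 ≤ c) (hC : 0 ≤ C) (hH : 1 ≤ H)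
    (hθ : 0 < θ) (hs : 0 ≤ s) (hs2 : s ^ 2 = c * H) (ht : 0 < t) (ht2 : t ^ 2 ≤ C * H)
    (he : 0 ≤ e) (hℓ : 0 ≤ ℓ) (hL : 0 ≤ L) (hLℓ : L ^ 2 ≤ H * ℓ ^ 2) (hY : 0 ≤ Y)
    (hD0 : D₀ ≤ D₁ + 2 * (s * Y) * (t * e)) (hD0' : D₀ ≤ s ^ 2) (hD1 : D₁ ≤ (s * Y) ^ 2)
    (hD1' : D₁ ≤ 2 * (s * Y) * (t * L)) (htY : t * Y ≤ k + t * e) :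
    D₀ ≤ θ * (e ^ 2 + ℓ ^ 2) + (8 * k ^ 2 * c + (6 * c + 2 * C) * c) * H ^ 2 / θ := by
  have hH0 : 0 ≤ H := by linarith
  have amgm : ∀ a v : ℝ, 0 ≤ v → 0 ≤ a → ∀ D, D ^ 2 ≤ a * H ^ 2 * v ^ 2 →
      D ≤ θ * v ^ 2 + a * H ^ 2 / (4 * θ) := by
    intro a v hv ha D hD
    have h1 : a * H ^ 2 * v ^ 2 = 4 * (θ * v ^ 2) * (a * H ^ 2 / (4 * θ)) := by
      field_simp
    rw [h1] at hD
    have h2 : 0 ≤ θ * v ^ 2 := by positivity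
    have h3 : 0 ≤ a * H ^ 2 / (4 * θ) := by positivity
    have h4 : D ^ 2 ≤ (θ * v ^ 2 + a * H ^ 2 / (4 * θ)) ^ 2 := by
      nlinarith [sq_nonneg (θ * v ^ 2 - a * H ^ 2 / (4 * θ))]
    exact (abs_le.1 (abs_le_of_sq_le_sq h4 (by positivity))).2
  have hq : ∀ a : ℝ, a * H ^ 2 / (4 * θ) = a / 4 * H ^ 2 / θ := fun a => by field_simp
  have hpos : ∀ a b : ℝ, a ≤ b → a * H ^ 2 / θ ≤ b * H ^ 2 / θ := fun a b h => by gcongr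
  rcases le_total (t * e) k with h | h
  · -- small first error: the scaled state after one step is bounded by `2 k`
    have h2k : t * Y ≤ 2 * k := by linarith
    have hA : 2 * (s * Y) * (t * L) ≤ 4 * k * s * L := by
      nlinarith [mul_le_mul_of_nonneg_right h2k (mul_nonneg hs hL)]
    have hB : 2 * (s * Y) * (t * e) ≤ 4 * k * s * e := by
      nlinarith [mul_le_mul_of_nonneg_right h2k (mul_nonneg hs he)]
    have h1 := amgm (16 * k ^ 2 * c) ℓ hℓ (by positivity) (4 * k * s * L) (by
      have : (4 * k * s * L) ^ 2 = 16 * k ^ 2 * (c * H) * L ^ 2 := by rw [← hs2]; ring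
      rw [this]
      have := mul_le_mul_of_nonneg_left hLℓ (by positivity : 0 ≤ 16 * k ^ 2 * (c * H))
      linarith)
    have h2 := amgm (16 * k ^ 2 * c) e he (by positivity) (4 * k * s * e) (by
      have : (4 * k * s * e) ^ 2 = 16 * k ^ 2 * c * e ^ 2 * H := by
        have : (4 * k * s * e) ^ 2 = 16 * k ^ 2 * s ^ 2 * e ^ 2 := by ring
        rw [this, hs2]; ring
      rw [this]
      have : 16 * k ^ 2 * c * e ^ 2 * H ≤ 16 * k ^ 2 * c * e ^ 2 * H ^ 2 := by
        apply mul_le_mul_of_nonneg_left _ (by positivity)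
        nlinarith
      linarith)
    rw [hq] at h1 h2
    have h3 := hpos (8 * k ^ 2 * c) (8 * k ^ 2 * c + (6 * c + 2 * C) * c)
      (le_add_of_nonneg_right (by positivity))
    have h4 : 8 * k ^ 2 * c * H ^ 2 / θ = 2 * (16 * k ^ 2 * c / 4 * H ^ 2 / θ) := by ring
    linarith
  · -- large first error: the state after one step is at most twice that error
    have hY2 : Y ≤ 2 * e := by
      have : t * Y ≤ t * (2 * e) := by linarith
      exact le_of_mul_le_mul_left this ht
    have hA : (s * Y) ^ 2 ≤ 4 * (c * H) * e ^ 2 := by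
      rw [mul_pow, hs2]
      have : Y ^ 2 ≤ (2 * e) ^ 2 := pow_le_pow_left₀ hY hY2 2
      nlinarith [mul_le_mul_of_nonneg_left this (mul_nonneg hc hH0)]
    have hB : 2 * (s * Y) * (t * e) ≤ (2 * (c * H) + 2 * (C * H)) * e ^ 2 := by
      have h1 : 2 * (s * Y) * (t * e) ≤ 4 * (s * t) * e ^ 2 := by
        nlinarith [mul_le_mul_of_nonneg_right hY2 (mul_nonneg (mul_nonneg hs ht.le) he)]
      have h2 : 2 * (s * t) ≤ c * H + C * H := by nlinarith [sq_nonneg (s - t)]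
      nlinarith [sq_nonneg e]
    have hD : D₀ ≤ (6 * c + 2 * C) * H * e ^ 2 := by linarith
    rcases le_total D₀ 0 with hneg | hnn
    · exact hneg.trans (by positivity)
    · have h1 := amgm ((6 * c + 2 * C) * c) e he (by positivity) D₀ (by
        rw [hs2] at hD0'
        have := mul_le_mul hD hD0' hnn (by positivity)
        linarith)
      rw [hq] at h1
      have h3 := hpos ((6 * c + 2 * C) * c / 4) (8 * k ^ 2 * c + (6 * c + 2 * C) * c) (by
        have : 0 ≤ (6 * c + 2 * C) * c := by positivity
        have : 0 ≤ 8 * k ^ 2 * c := by positivity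
        linarith)
      have : 0 ≤ θ * ℓ ^ 2 := by positivity
      linarith

/-- Without noise the excess cost is controlled by the prediction errors even if the closed loop is
only non-expansive, provided that the predicted cost of the initial state is bounded. After one step
the state is as small as `O(1/√T)` plus the first prediction error, and it never grows again. -/
theorem excess_le_of_nonexpansive [Nonempty (Fin n)] (hQ : Q.PosDef) (hR : R.PosDef)
    {C c c₀ g θ : ℝ} (hC : 0 ≤ C) (hc : 0 ≤ c) (hc₀ : 0 ≤ c₀) (hg : 0 ≤ g) (hθ : 0 < θ)
    (hQC : opNorm Q ≤ C)
    (Θs : Param n d) {Θt : Param n d} (hΘ : frobNorm Θt ≤ 1) {H : ℕ} (hH : 1 ≤ H)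
    (hF : ∀ j < H, ∀ y, euclNorm (loopMat Q R Θs Θt j *ᵥ y) ≤ euclNorm y)
    (hM : ∀ j < H, ∀ y, quad (costMat Q R Θt j) y ≤ c * (y ⬝ᵥ y))
    (hK : ∀ j < H, ∀ y, (gainToGo Q R Θt j *ᵥ y) ⬝ᵥ (gainToGo Q R Θt j *ᵥ y) ≤ g * (y ⬝ᵥ y))
    {x : Fin n → ℝ} (hx : x ⬝ᵥ x ≤ 1) (hx0 : quad (riccati Q R Θt H) x ≤ c₀) :
    quad (backward (loopMat Q R Θs Θt) (costMat Q R Θt) H) x - quad (riccati Q R Θt H) x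
      ≤ θ * quad (backward (loopMat Q R Θs Θt)
          (fun i => (devMat Q R Θs Θt i)ᵀ * devMat Q R Θs Θt i) H) x
        + (8 * (2 * c₀ + 2 * C * (1 + g)) * c + (6 * c + 2 * C) * c) * (H : ℝ) ^ 2 / θ := by
  obtain ⟨j, rfl⟩ : ∃ j, H = j + 1 := ⟨H - 1, by omega⟩
  obtain ⟨T, hT0, hTC, hTle, hpred⟩ :=
    exists_riccati_quad_le_and_prediction_le hQ hR hC hQC hΘ j
  have hcpos : ∀ j y, 0 ≤ quad (costMat Q R Θt j) y := fun j y => by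
    rw [quad_costMat]; exact stepCost_nonneg hQ hR _ _
  have hWle : ∀ i ≤ j + 1, ∀ y, quad (backward (loopMat Q R Θs Θt) (costMat Q R Θt) i) y
      ≤ c * ((j : ℝ) + 1) * (y ⬝ᵥ y) := by
    intro i hi y
    refine (quad_backward_le_of_nonexpansive hc hM hF hi y).trans ?_
    have : (i : ℝ) ≤ (j : ℝ) + 1 := by exact_mod_cast hi
    have := dotProduct_self_nonneg_real y
    gcongr
  -- the excess after `i` steps to go, from a state of norm at most `Y`
  have hsum : ∀ i ≤ j + 1, ∀ y Y, euclNorm y ≤ Y →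
      max (quad (backward (loopMat Q R Θs Θt) (costMat Q R Θt) i) y
        - quad (riccati Q R Θt i) y) 0
      ≤ 2 * (√(c * (j + 1)) * Y) * (√T * devSum (loopMat Q R Θs Θt) (devMat Q R Θs Θt) i y) := by
    intro i
    induction i with
    | zero => intro _ y Y _; simp [riccati, devSum]
    | succ i ih =>
      intro hi y Y hY
      refine (excess_succ_le Θs Θt hQ hR i y).trans ?_
      have hY' := (hF i (by omega) y).trans hY
      have h1 := ih (by omega) (loopMat Q R Θs Θt i *ᵥ y) Y hY'
      have h2 : √(quad (backward (loopMat Q R Θs Θt) (costMat Q R Θt) i) (loopMat Q R Θs Θt i *ᵥ y))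
          ≤ √(c * (j + 1)) * Y := by
        apply Real.sqrt_le_iff.2
        have hY0 := (euclNorm_nonneg _).trans hY
        refine ⟨by positivity, ?_⟩
        rw [mul_pow, Real.sq_sqrt (by positivity)]
        refine (hWle i (by omega) _).trans ?_
        rw [← euclNorm_sq]
        have := pow_le_pow_left₀ (euclNorm_nonneg _) hY' 2
        gcongr
      have h3 : √(quad (riccati Q R Θt i) (devMat Q R Θs Θt i *ᵥ y))
          ≤ √T * euclNorm (devMat Q R Θs Θt i *ᵥ y) := by
        apply Real.sqrt_le_iff.2
        have := euclNorm_nonneg (devMat Q R Θs Θt i *ᵥ y)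
        refine ⟨by positivity, ?_⟩
        rw [mul_pow, Real.sq_sqrt hT0.le, euclNorm_sq]
        exact hTle i (by omega) _
      have h4 := mul_le_mul h2 h3 (Real.sqrt_nonneg _) ((Real.sqrt_nonneg _).trans h2)
      simp only [devSum]
      linarith
  have hstep := (le_max_left _ 0).trans (excess_succ_le Θs Θt hQ hR j x)
  set y := loopMat Q R Θs Θt j *ᵥ x with hy
  set e := devMat Q R Θs Θt j *ᵥ x with he
  -- the predicted next state is `y - e`, and it is small by the choice of `T`
  have hnext : Amat Θt *ᵥ x + Bmat Θt *ᵥ (gainToGo Q R Θt j *ᵥ x) = y - e := by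
    rw [he, devMat, closedLoop_sub_mulVec, hy, loopMat, sub_sub_cancel, closedLoop_mulVec]
  have hk : √T * euclNorm (y - e) ≤ √(2 * c₀ + 2 * C * (1 + g)) := by
    apply Real.le_sqrt_of_sq_le
    rw [mul_pow, Real.sq_sqrt hT0.le, euclNorm_sq, ← hnext]
    refine (hpred x _).trans ?_
    have h1 := hK j (by omega) x
    have h2 : x ⬝ᵥ x + (gainToGo Q R Θt j *ᵥ x) ⬝ᵥ (gainToGo Q R Θt j *ᵥ x) ≤ 1 + g := by
      nlinarith
    have := mul_le_mul_of_nonneg_left h2 (by positivity : 0 ≤ 2 * C)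
    linarith
  have hYtri : √T * euclNorm y ≤ √(2 * c₀ + 2 * C * (1 + g)) + √T * euclNorm e := by
    have h1 : euclNorm y ≤ euclNorm (y - e) + euclNorm e := by
      simpa using euclNorm_add_le (y - e) e
    have := mul_le_mul_of_nonneg_left h1 (Real.sqrt_nonneg T)
    linarith
  have hdev := devSum_sq_le (loopMat Q R Θs Θt) (devMat Q R Θs Θt) j y
  have hS0 : 0 ≤ quad (backward (loopMat Q R Θs Θt)
      (fun i => (devMat Q R Θs Θt i)ᵀ * devMat Q R Θs Θt i) j) y :=
    quad_backward_nonneg _ (fun i y => by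
      rw [quad_transpose_mul]; exact dotProduct_self_nonneg_real _) _ _
  have hfin := excess_arith (D₀ := quad (backward (loopMat Q R Θs Θt) (costMat Q R Θt) (j + 1)) x
      - quad (riccati Q R Θt (j + 1)) x)
    (D₁ := max (quad (backward (loopMat Q R Θs Θt) (costMat Q R Θt) j) y
      - quad (riccati Q R Θt j) y) 0)
    (s := √(c * (j + 1))) (t := √T) (e := euclNorm e)
    (ℓ := √(quad (backward (loopMat Q R Θs Θt)
      (fun i => (devMat Q R Θs Θt i)ᵀ * devMat Q R Θs Θt i) j) y))
    (L := devSum (loopMat Q R Θs Θt) (devMat Q R Θs Θt) j y)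
    (Y := euclNorm y) (k := √(2 * c₀ + 2 * C * (1 + g))) (c := c) (C := C)
    (H := (j : ℝ) + 1) (θ := θ) hc hC (by linarith [(Nat.cast_nonneg j : (0 : ℝ) ≤ j)]) hθ
    (Real.sqrt_nonneg _) (Real.sq_sqrt (by positivity)) (Real.sqrt_pos.2 hT0)
    (by rw [Real.sq_sqrt hT0.le]; exact hTC) (euclNorm_nonneg _) (Real.sqrt_nonneg _)
    (devSum_nonneg _ _ _ _)
    (by rw [Real.sq_sqrt hS0]; nlinarith) (euclNorm_nonneg _)
    (by
      refine hstep.trans (add_le_add_right ?_ _)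
      have h2 : √(quad (backward (loopMat Q R Θs Θt) (costMat Q R Θt) j) y)
          ≤ √(c * (j + 1)) * euclNorm y := by
        apply Real.sqrt_le_iff.2
        have := euclNorm_nonneg y
        refine ⟨by positivity, ?_⟩
        rw [mul_pow, Real.sq_sqrt (by positivity), euclNorm_sq]
        exact hWle j (by omega) _
      have h3 : √(quad (riccati Q R Θt j) e) ≤ √T * euclNorm e := by
        apply Real.sqrt_le_iff.2
        have := euclNorm_nonneg e
        refine ⟨by positivity, ?_⟩
        rw [mul_pow, Real.sq_sqrt hT0.le, euclNorm_sq]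
        exact hTle j (by omega) _
      have h4 := mul_le_mul h2 h3 (Real.sqrt_nonneg _) ((Real.sqrt_nonneg _).trans h2)
      linarith)
    (by
      rw [Real.sq_sqrt (by positivity)]
      have h1 := hWle (j + 1) le_rfl x
      have h2 := riccati_quad_nonneg hQ hR Θt (j + 1) x
      have : c * ((j : ℝ) + 1) * (x ⬝ᵥ x) ≤ c * ((j : ℝ) + 1) :=
        mul_le_of_le_one_right (by positivity) hx
      linarith)
    (by
      have h1 := hWle j (by omega) y
      have h2 := riccati_quad_nonneg hQ hR Θt j y
      rw [mul_pow, Real.sq_sqrt (by positivity), euclNorm_sq]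
      have := dotProduct_self_nonneg_real y
      exact max_le (by linarith) (by positivity))
    (hsum j (by omega) y _ le_rfl) hYtri
  refine hfin.trans (le_of_eq ?_)
  rw [quad_backward_succ, quad_transpose_mul, Real.sq_sqrt hS0, Real.sq_sqrt (by positivity),
    euclNorm_sq]
  push_cast
  ring

end NonExpansive

end PrivateLQ

namespace PrivateLQ

/-! ### Measurability of matrix expressions -/

section Measurability

variable {Ω ι κ : Type*} {mΩ : MeasurableSpace Ω} [Fintype ι]

theorem measurable_mulVec {A : Ω → Matrix κ ι ℝ} {v : Ω → ι → ℝ}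
    (hA : ∀ i j, Measurable fun ω => A ω i j) (hv : Measurable v) :
    Measurable fun ω => A ω *ᵥ v ω := by
  refine measurable_pi_iff.2 fun i => ?_
  unfold Matrix.mulVec dotProduct
  exact Finset.measurable_sum _ fun j _ => (hA i j).mul (measurable_pi_iff.1 hv j)

theorem measurable_const_mulVec (A : Matrix κ ι ℝ) {v : Ω → ι → ℝ} (hv : Measurable v) :
    Measurable fun ω => A *ᵥ v ω :=
  measurable_mulVec (fun _ _ => measurable_const) hv

theorem measurable_dotProduct {u v : Ω → ι → ℝ} (hu : Measurable u) (hv : Measurable v) :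
    Measurable fun ω => u ω ⬝ᵥ v ω := by
  unfold dotProduct
  exact Finset.measurable_sum _ fun j _ => (measurable_pi_iff.1 hu j).mul (measurable_pi_iff.1 hv j)

theorem measurable_euclNorm {v : Ω → ι → ℝ} (hv : Measurable v) :
    Measurable fun ω => euclNorm (v ω) := by
  have : (fun ω => euclNorm (v ω)) = fun ω => √(v ω ⬝ᵥ v ω) := by
    ext ω; rw [← euclNorm_sq, Real.sqrt_sq (euclNorm_nonneg _)]
  rw [this]
  exact (measurable_dotProduct hv hv).sqrt

end Measurability

/-! ### Expected costs within an episode -/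

section Episode

variable {n d : ℕ}

theorem abs_quad_le {ι : Type*} [Fintype ι] [DecidableEq ι] (M : Matrix ι ι ℝ) (v : ι → ℝ) :
    |quad M v| ≤ opNorm M * euclNorm v ^ 2 := by
  have h1 := abs_dotProduct_le v (M *ᵥ v)
  have h2 := mul_le_mul_of_nonneg_left (euclNorm_mulVec_le M v) (euclNorm_nonneg v)
  unfold quad
  linarith [h1.trans h2]

variable {Ω : Type*} [MeasurableSpace Ω] {μ : Measure Ω} [IsProbabilityMeasure μ]

theorem integrable_quad {ι : Type*} [Fintype ι] [DecidableEq ι] (M : Matrix ι ι ℝ)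
    {v : Ω → ι → ℝ} (hv : Measurable v) {c : ℝ} (hc : ∀ᵐ ω ∂μ, euclNorm (v ω) ≤ c) :
    Integrable (fun ω => quad M (v ω)) μ := by
  refine Integrable.of_bound (C := opNorm M * c ^ 2)
    (measurable_dotProduct hv (measurable_const_mulVec M hv)).aestronglyMeasurable ?_
  filter_upwards [hc] with ω hω
  refine (abs_quad_le M _).trans ?_
  have := pow_le_pow_left₀ (euclNorm_nonneg _) hω 2
  have := opNorm_nonneg M
  gcongr

theorem abs_apply_le_euclNorm {ι : Type*} [Fintype ι] (v : ι → ℝ) (i : ι) : |v i| ≤ euclNorm v := by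
  refine abs_le_of_sq_le_sq ?_ (euclNorm_nonneg _)
  rw [euclNorm_sq]
  unfold dotProduct
  simp only [← pow_two]
  exact Finset.single_le_sum (f := fun i => v i ^ 2) (fun i _ => sq_nonneg _) (Finset.mem_univ i)

/-- A centred vector is uncorrelated with every independent vector. -/
theorem integral_dotProduct_eq_zero {ι : Type*} [Fintype ι] {u v : Ω → ι → ℝ} (hu : Measurable u)
    (hv : Measurable v) {c₁ c₂ : ℝ} (h1 : ∀ᵐ ω ∂μ, euclNorm (u ω) ≤ c₁)
    (h2 : ∀ᵐ ω ∂μ, euclNorm (v ω) ≤ c₂) (hind : IndepFun u v μ)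
    (hmean : ∀ i, ∫ ω, v ω i ∂μ = 0) : ∫ ω, u ω ⬝ᵥ v ω ∂μ = 0 := by
  have hi : ∀ (f : Ω → ι → ℝ) (c : ℝ), Measurable f → (∀ᵐ ω ∂μ, euclNorm (f ω) ≤ c) → ∀ i,
      Integrable (fun ω => f ω i) μ := fun f c hf hc i =>
    Integrable.of_bound (C := c) (measurable_pi_iff.1 hf i).aestronglyMeasurable
      (by filter_upwards [hc] with ω hω using (abs_apply_le_euclNorm _ i).trans hω)
  have hind' : ∀ i, IndepFun (fun ω => u ω i) (fun ω => v ω i) μ := fun i =>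
    hind.comp (measurable_pi_apply i) (measurable_pi_apply i)
  unfold dotProduct
  have hint : ∀ i, Integrable (fun ω => u ω i * v ω i) μ := fun i =>
    IndepFun.integrable_mul (hind' i) (hi u c₁ hu h1 i) (hi v c₂ hv h2 i)
  rw [integral_finsetSum _ fun i _ => hint i]
  refine Finset.sum_eq_zero fun i _ => ?_
  rw [(hind' i).integral_fun_mul_eq_mul_integral (hi u c₁ hu h1 i).aestronglyMeasurable
    (hi v c₂ hv h2 i).aestronglyMeasurable, hmean i, mul_zero]

theorem sum_Icc_one_eq_sum_range {E : Type*} [AddCommMonoid E] (f : ℕ → E) (H : ℕ) :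
    ∑ i ∈ Finset.Icc 1 H, f i = ∑ j ∈ Finset.range H, f (1 + j) := by
  rw [← Finset.Ico_succ_right_eq_Icc, Finset.sum_Ico_eq_sum_range]
  simp

/-- The noise of one episode: bounded, centred, and independent of the earlier noise. -/
structure EpisodeNoise (μ : Measure Ω) (H : ℕ) (Cw : ℝ) (w : ℕ → Ω → Fin n → ℝ) : Prop where
  measurable : ∀ h, Measurable (w h)
  norm_le : ∀ᵐ ω ∂μ, ∀ h ∈ Finset.Icc 1 H, euclNorm (w h ω) ≤ Cw
  mean : ∀ h ∈ Finset.Icc 1 H, ∀ i, ∫ ω, w h ω i ∂μ = 0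
  indep : ∀ h ∈ Finset.Icc 1 H, Indep (MeasurableSpace.comap (w h) inferInstance)
    (⨆ h' ∈ Finset.Icc 1 (h - 1), MeasurableSpace.comap (w h') inferInstance) μ

/-- The quantity controlled by the estimation error: the sum over an episode of the squared
one-step prediction errors `|(Θs - Θt)ᵀ z_h|²` along the path of the policy of `Θt`. -/
noncomputable def predErr (Q : Matrix (Fin n) (Fin n) ℝ) (R : Matrix (Fin d) (Fin d) ℝ) (H : ℕ)
    (Θs Θt : Param n d) (w : ℕ → Fin n → ℝ) (x : Fin n → ℝ) : ℝ :=
  ∑ j ∈ Finset.range H,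
    ((Θs - Θt)ᵀ *ᵥ Sum.elim (rollout Θs (gainPolicy Q R H Θt) w 1 x j)
        (gainPolicy Q R H Θt (1 + j) (rollout Θs (gainPolicy Q R H Θt) w 1 x j)))
      ⬝ᵥ ((Θs - Θt)ᵀ *ᵥ Sum.elim (rollout Θs (gainPolicy Q R H Θt) w 1 x j)
        (gainPolicy Q R H Θt (1 + j) (rollout Θs (gainPolicy Q R H Θt) w 1 x j)))

variable {Q : Matrix (Fin n) (Fin n) ℝ} {R : Matrix (Fin d) (Fin d) ℝ} {H : ℕ}
  (Θs Θt : Param n d)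

theorem gainPolicy_one_add {j : ℕ} (hj : j < H) (y : Fin n → ℝ) :
    gainPolicy Q R H Θt (1 + j) y = gainToGo Q R Θt (H - 1 - j) *ᵥ y := by
  rw [gainPolicy, gain_eq_gainToGo Θt (by omega)]
  congr 2
  omega

theorem rollout_succ_eq {j : ℕ} (hj : j < H) (w : ℕ → Fin n → ℝ) (x : Fin n → ℝ) :
    rollout Θs (gainPolicy Q R H Θt) w 1 x (j + 1)
      = loopMat Q R Θs Θt (H - 1 - j) *ᵥ rollout Θs (gainPolicy Q R H Θt) w 1 x j
        + w (1 + j) := by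
  rw [loopMat, closedLoop_mulVec, ← gainPolicy_one_add Θt hj]
  rfl

theorem predErr_eq (w : ℕ → Fin n → ℝ) (x : Fin n → ℝ) :
    predErr Q R H Θs Θt w x = ∑ j ∈ Finset.range H,
      quad ((devMat Q R Θs Θt (H - 1 - j))ᵀ * devMat Q R Θs Θt (H - 1 - j))
        (rollout Θs (gainPolicy Q R H Θt) w 1 x j) := by
  refine Finset.sum_congr rfl fun j hj => ?_
  rw [transpose_mulVec_sumElim, gainPolicy_one_add Θt (Finset.mem_range.1 hj), quad_transpose_mul,
    devMat, closedLoop_mulVec]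

/-- States stay in the unit ball. -/
theorem euclNorm_rollout_le_one {Cw : ℝ}
    (hF : ∀ j < H, ∀ y, euclNorm y ≤ 1 → euclNorm (loopMat Q R Θs Θt j *ᵥ y) + Cw ≤ 1)
    {w : ℕ → Fin n → ℝ} (hw : ∀ h ∈ Finset.Icc 1 H, euclNorm (w h) ≤ Cw) {x : Fin n → ℝ}
    (hx : euclNorm x ≤ 1) {j : ℕ} (hj : j ≤ H) :
    euclNorm (rollout Θs (gainPolicy Q R H Θt) w 1 x j) ≤ 1 := by
  induction j with
  | zero => exact hx
  | succ j ih =>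
    rw [rollout_succ_eq Θs Θt (by omega)]
    have h1 := hF (H - 1 - j) (by omega) _ (ih (by omega))
    have h2 := hw (1 + j) (by simp; omega)
    exact (euclNorm_add_le _ _).trans (by linarith)

theorem measurable_rollout_of_fixed {Ω' : Type*} {m : MeasurableSpace Ω'}
    {w : ℕ → Ω' → Fin n → ℝ}
    (x : Fin n → ℝ) {j : ℕ} (hj : j ≤ H) (hw : ∀ h ∈ Finset.Icc 1 j, Measurable[m] (w h)) :
    Measurable[m] fun ω => rollout Θs (gainPolicy Q R H Θt) (fun i => w i ω) 1 x j := by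
  induction j with
  | zero => exact measurable_const
  | succ j ih =>
    simp only [rollout_succ_eq Θs Θt (show j < H by omega)]
    refine (measurable_const_mulVec _ (ih (by omega) fun h hh => hw h ?_)).add
      (hw (1 + j) (by simp; omega))
    simp only [Finset.mem_Icc] at hh ⊢
    omega

variable {Θs Θt}

/-- The expected sum of quadratic forms of the states along an episode: the cross terms between the
noise and the earlier states vanish. -/
theorem integral_sum_quad_rollout {Cw : ℝ} {w : ℕ → Ω → Fin n → ℝ} (hw : EpisodeNoise μ H Cw w)
    (hF : ∀ j < H, ∀ y, euclNorm y ≤ 1 → euclNorm (loopMat Q R Θs Θt j *ᵥ y) + Cw ≤ 1)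
    {x : Fin n → ℝ} (hx : euclNorm x ≤ 1) {M : ℕ → Matrix (Fin n) (Fin n) ℝ}
    (hM : ∀ j, (M j)ᵀ = M j) :
    ∫ ω, ∑ j ∈ Finset.range H, quad (M (H - 1 - j))
        (rollout Θs (gainPolicy Q R H Θt) (fun i => w i ω) 1 x j) ∂μ
      = quad (backward (loopMat Q R Θs Θt) M H) x
        + ∑ i ∈ Finset.Icc 1 H, ∫ ω, quad (backward (loopMat Q R Θs Θt) M (H - i)) (w i ω) ∂μ := by
  set F := loopMat Q R Θs Θt
  set y : ℕ → Ω → Fin n → ℝ := fun j ω =>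
    rollout Θs (gainPolicy Q R H Θt) (fun i => w i ω) 1 x j with hy
  have hym : ∀ j ≤ H, Measurable (y j) := fun j hj =>
    measurable_rollout_of_fixed Θs Θt x hj fun h _ => hw.measurable h
  have hyb : ∀ j ≤ H, ∀ᵐ ω ∂μ, euclNorm (y j ω) ≤ 1 := fun j hj => by
    filter_upwards [hw.norm_le] with ω hω using euclNorm_rollout_le_one Θs Θt hF hω hx hj
  have hint : ∀ (N : Matrix (Fin n) (Fin n) ℝ) j, j ≤ H →
      Integrable (fun ω => quad N (y j ω)) μ := fun N j hj =>
    integrable_quad N (hym j hj) (hyb j hj)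
  have hwb : ∀ h ∈ Finset.Icc 1 H, ∀ᵐ ω ∂μ, euclNorm (w h ω) ≤ Cw := fun h hh => by
    filter_upwards [hw.norm_le] with ω hω using hω h hh
  have hstep : ∀ j < H, ∫ ω, quad (M (H - 1 - j)) (y j ω) ∂μ
      = (∫ ω, quad (backward F M (H - j)) (y j ω) ∂μ
          - ∫ ω, quad (backward F M (H - (j + 1))) (y (j + 1) ω) ∂μ)
        + ∫ ω, quad (backward F M (H - (1 + j))) (w (1 + j) ω) ∂μ := by
    intro j hj
    have hmem : 1 + j ∈ Finset.Icc 1 H := by simp; omega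
    have e1 : H - j = (H - 1 - j) + 1 := by omega
    have e2 : H - (j + 1) = H - 1 - j := by omega
    have e3 : H - (1 + j) = H - 1 - j := by omega
    rw [e1, e2, e3]
    set i := H - 1 - j with hi
    have hW : (backward F M i)ᵀ = backward F M i := backward_transpose F hM i
    set W := backward F M i
    have hyF : Measurable fun ω => F i *ᵥ y j ω := measurable_const_mulVec _ (hym j hj.le)
    have hwW : Measurable fun ω => W *ᵥ w (1 + j) ω := measurable_const_mulVec _ (hw.measurable _)
    have hyFb : ∀ᵐ ω ∂μ, euclNorm (F i *ᵥ y j ω) ≤ opNorm (F i) := by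
      filter_upwards [hyb j hj.le] with ω hω
      exact (euclNorm_mulVec_le _ _).trans (mul_le_of_le_one_right (opNorm_nonneg _) hω)
    have hwWb : ∀ᵐ ω ∂μ, euclNorm (W *ᵥ w (1 + j) ω) ≤ opNorm W * Cw := by
      filter_upwards [hwb _ hmem] with ω hω
      exact (euclNorm_mulVec_le _ _).trans (mul_le_mul_of_nonneg_left hω (opNorm_nonneg _))
    have hind : IndepFun (fun ω => F i *ᵥ y j ω) (fun ω => W *ᵥ w (1 + j) ω) μ := by
      have h1 : IndepFun (y j) (w (1 + j)) μ := by
        rw [IndepFun_iff_Indep]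
        refine indep_of_indep_of_le_left (hw.indep (1 + j) hmem).symm ?_
        rw [add_tsub_cancel_left]
        refine Measurable.comap_le ?_
        refine measurable_rollout_of_fixed Θs Θt x hj.le fun h hh => ?_
        exact Measurable.of_comap_le (le_iSup₂_of_le h hh le_rfl)
      exact h1.comp (measurable_const_mulVec _ measurable_id) (measurable_const_mulVec _ measurable_id)
    have hcross : ∫ ω, (F i *ᵥ y j ω) ⬝ᵥ (W *ᵥ w (1 + j) ω) ∂μ = 0 := by
      refine integral_dotProduct_eq_zero hyF hwW hyFb hwWb hind fun a => ?_
      simp only [Matrix.mulVec, dotProduct]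
      rw [integral_finsetSum]
      · exact Finset.sum_eq_zero fun b _ => by
          rw [integral_const_mul, hw.mean _ hmem b, mul_zero]
      · intro b _
        refine Integrable.const_mul (Integrable.of_bound (C := Cw)
          (measurable_pi_iff.1 (hw.measurable _) b).aestronglyMeasurable ?_) _
        filter_upwards [hwb _ hmem] with ω hω using (abs_apply_le_euclNorm _ b).trans hω
    have hnext : ∀ ω, quad W (y (j + 1) ω) = quad W (F i *ᵥ y j ω)
        + 2 * ((F i *ᵥ y j ω) ⬝ᵥ (W *ᵥ w (1 + j) ω)) + quad W (w (1 + j) ω) := by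
      intro ω
      rw [← quad_add_right hW]
      simp only [hy]
      rw [rollout_succ_eq Θs Θt hj]
    have hc_int : Integrable (fun ω => (F i *ᵥ y j ω) ⬝ᵥ (W *ᵥ w (1 + j) ω)) μ := by
      refine Integrable.of_bound (C := opNorm (F i) * (opNorm W * Cw))
        (measurable_dotProduct hyF hwW).aestronglyMeasurable ?_
      filter_upwards [hyFb, hwWb] with ω h1 h2
      exact (abs_dotProduct_le _ _).trans
        (mul_le_mul h1 h2 (euclNorm_nonneg _) (opNorm_nonneg _))
    have hI1 : Integrable (fun ω => quad W (F i *ᵥ y j ω)) μ := integrable_quad W hyF hyFb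
    have hI2 : Integrable (fun ω => quad W (w (1 + j) ω)) μ :=
      integrable_quad W (hw.measurable _) (hwb _ hmem)
    have hs1 : ∫ ω, quad W (y (j + 1) ω) ∂μ
        = ∫ ω, quad W (F i *ᵥ y j ω) ∂μ + ∫ ω, quad W (w (1 + j) ω) ∂μ := by
      simp only [hnext]
      have hI12 := hI1.add (hc_int.const_mul 2)
      simp only [Pi.add_def] at hI12
      rw [integral_add hI12 hI2, integral_add hI1 (hc_int.const_mul 2), integral_const_mul, hcross]
      ring
    have hs2 : ∫ ω, quad (backward F M (i + 1)) (y j ω) ∂μ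
        = ∫ ω, quad (M i) (y j ω) ∂μ + ∫ ω, quad W (F i *ᵥ y j ω) ∂μ := by
      simp only [quad_backward_succ]
      exact integral_add (hint _ j hj.le) hI1
    rw [hs1, hs2]
    ring
  rw [integral_finsetSum _ fun j hj => hint _ j (Finset.mem_range.1 hj).le,
    Finset.sum_congr rfl fun j hj => hstep j (Finset.mem_range.1 hj), Finset.sum_add_distrib,
    Finset.sum_range_sub' (fun j => ∫ ω, quad (backward F M (H - j)) (y j ω) ∂μ)]
  congr 1
  · simp [hy, rollout]
  · exact (sum_Icc_one_eq_sum_range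
      (fun i => ∫ ω, quad (backward F M (H - i)) (w i ω) ∂μ) H).symm

end Episode

end PrivateLQ

namespace PrivateLQ

/-! ### The excess cost of an optimistic policy -/

section Excess

variable {n d : ℕ} {Ω : Type*} {S : Run n d Ω} {C CA CB : ℝ}

theorem Run.Boundedness.gainToGo_le (hS : S.Boundedness C CA CB) {Θ : Param n d}
    (hΘ : Θ ∈ paramSet n d) {j : ℕ} (hj : j < S.H) (y : Fin n → ℝ) :
    euclNorm (gainToGo S.Q S.R Θ j *ᵥ y) ≤ S.γ * euclNorm y := by
  have h := hS.norm_gain Θ hΘ (S.H - j) (by simp; omega)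
  rw [gain_eq_gainToGo Θ (by omega), Nat.sub_sub_self hj.le] at h
  exact (euclNorm_mulVec_le _ _).trans (mul_le_mul_of_nonneg_right h (euclNorm_nonneg _))

theorem Run.Boundedness.CA_nonneg (hS : S.Boundedness C CA CB) : 0 ≤ CA :=
  (opNorm_nonneg _).trans hS.norm_A

theorem Run.Boundedness.CB_nonneg (hS : S.Boundedness C CA CB) : 0 ≤ CB :=
  (opNorm_nonneg _).trans hS.norm_B

theorem Run.Boundedness.C_nonneg (hS : S.Boundedness C CA CB) : 0 ≤ C :=
  (opNorm_nonneg _).trans hS.norm_Q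

theorem Run.Boundedness.γ_nonneg (hS : S.Boundedness C CA CB) (hH : 1 ≤ S.H) : 0 ≤ S.γ :=
  (opNorm_nonneg _).trans (hS.norm_gain _ hS.mem_paramSet 1 (by simp [hH]))

theorem Run.Boundedness.loopMat_le (hS : S.Boundedness C CA CB) {Θ : Param n d}
    (hΘ : Θ ∈ paramSet n d) {j : ℕ} (hj : j < S.H) (y : Fin n → ℝ) :
    euclNorm (loopMat S.Q S.R S.Θs Θ j *ᵥ y) ≤ (CA + S.γ * CB) * euclNorm y := by
  rw [loopMat, closedLoop_mulVec]
  have h1 := (euclNorm_mulVec_le (Amat S.Θs) y).trans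
    (mul_le_mul_of_nonneg_right hS.norm_A (euclNorm_nonneg _))
  have h2 := (euclNorm_mulVec_le (Bmat S.Θs) (gainToGo S.Q S.R Θ j *ᵥ y)).trans
    (mul_le_mul hS.norm_B (hS.gainToGo_le hΘ hj y) (euclNorm_nonneg _) hS.CB_nonneg)
  exact (euclNorm_add_le _ _).trans (by linarith)

theorem Run.Boundedness.stepCost_gain_le (hS : S.Boundedness C CA CB) {Θ : Param n d}
    (hΘ : Θ ∈ paramSet n d) {j : ℕ} (hj : j < S.H) (y : Fin n → ℝ) :
    quad (costMat S.Q S.R Θ j) y ≤ C * (1 + S.γ ^ 2) * (y ⬝ᵥ y) := by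
  rw [quad_costMat]
  have h1 := (quad_le_opNorm S.Q y).trans
    (mul_le_mul_of_nonneg_right hS.norm_Q (dotProduct_self_nonneg_real _))
  have h2 := (quad_le_opNorm S.R (gainToGo S.Q S.R Θ j *ᵥ y)).trans
    (mul_le_mul_of_nonneg_right hS.norm_R (dotProduct_self_nonneg_real _))
  have h3 := pow_le_pow_left₀ (euclNorm_nonneg _) (hS.gainToGo_le hΘ hj y) 2
  rw [mul_pow, euclNorm_sq, euclNorm_sq] at h3
  have h4 := mul_le_mul_of_nonneg_left h3 hS.C_nonneg
  unfold stepCost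
  simp only [quad] at h1 h2
  linarith

variable [MeasurableSpace Ω] {μ : Measure Ω}

theorem policyCost_gainPolicy (Q : Matrix (Fin n) (Fin n) ℝ) (R : Matrix (Fin d) (Fin d) ℝ) (H : ℕ)
    (Θs Θt : Param n d) (w : ℕ → Ω → Fin n → ℝ) (x : Fin n → ℝ) :
    policyCost μ Q R H w Θs (gainPolicy Q R H Θt) 1 x
      = ∫ ω, ∑ j ∈ Finset.range H, quad (costMat Q R Θt (H - 1 - j))
        (rollout Θs (gainPolicy Q R H Θt) (fun i => w i ω) 1 x j) ∂μ := by
  unfold policyCost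
  congr 1 with ω
  refine Finset.sum_congr (by simp) fun j hj => ?_
  rw [quad_costMat, gainPolicy_one_add Θt (Finset.mem_range.1 hj)]

theorem optCost_one_eq (Q : Matrix (Fin n) (Fin n) ℝ) (R : Matrix (Fin d) (Fin d) ℝ) (H : ℕ)
    (Θ : Param n d) (w : ℕ → Ω → Fin n → ℝ) (x : Fin n → ℝ) :
    optCost μ Q R H w Θ 1 x = quad (riccati Q R Θ H) x
      + ∑ i ∈ Finset.Icc 1 H, ∫ ω, quad (riccati Q R Θ (H - i)) (w i ω) ∂μ := by
  unfold optCost Pmat quad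
  simp

/-- The excess of the expected cost of the policy of `Θt` over its predicted optimal cost is
controlled by the expected prediction errors. For a strictly contracting closed loop the true cost
forms are bounded uniformly in the horizon; otherwise the model forces the noise to vanish, and
optimism bounds the predicted cost of the initial state. -/
theorem exists_excess_le (C CA CB Cw γ : ℝ) (hC : 0 ≤ C) (hCA0 : 0 ≤ CA) (hCA : CA < 1)
    (hCB : 0 ≤ CB) (hCw : 0 ≤ Cw) (hγ : 0 ≤ γ) (hsum : CA + γ * CB + Cw ≤ 1) :
    ∃ c : ℝ, 0 ≤ c ∧ ∀ {n d : ℕ} {Ω : Type*} [MeasurableSpace Ω] (μ : Measure Ω)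
      [IsProbabilityMeasure μ] (S : Run n d Ω), S.γ = γ → 1 ≤ n → 1 ≤ S.H →
      S.Boundedness C CA CB →
      ∀ (w : ℕ → Ω → Fin n → ℝ), EpisodeNoise μ S.H Cw w →
      ∀ Θt ∈ paramSet n d, ∀ x : Fin n → ℝ, euclNorm x ≤ 1 →
      optCost μ S.Q S.R S.H w Θt 1 x ≤ optCost μ S.Q S.R S.H w S.Θs 1 x + 1 →
      ∀ θ : ℝ, 0 < θ →
      policyCost μ S.Q S.R S.H w S.Θs (gainPolicy S.Q S.R S.H Θt) 1 x
          - optCost μ S.Q S.R S.H w Θt 1 x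
        ≤ θ * ∫ ω, predErr S.Q S.R S.H S.Θs Θt (fun i => w i ω) x ∂μ
          + c * (S.H : ℝ) ^ 2 / θ := by
  set r := CA + γ * CB with hr
  set cc := C * (1 + γ ^ 2) with hcc
  have hcc0 : 0 ≤ cc := by positivity
  have hr0 : 0 ≤ r := by positivity
  have hCA2 : 0 < 1 - CA ^ 2 := by nlinarith
  -- facts common to both cases
  have common : ∀ {n d : ℕ} {Ω : Type _} [MeasurableSpace Ω] (μ : Measure Ω)
      [IsProbabilityMeasure μ] (S : Run n d Ω), S.γ = γ → S.Boundedness C CA CB →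
      ∀ (w : ℕ → Ω → Fin n → ℝ), EpisodeNoise μ S.H Cw w →
      ∀ Θt ∈ paramSet n d, ∀ x : Fin n → ℝ, euclNorm x ≤ 1 →
      (∀ j < S.H, ∀ y, euclNorm y ≤ 1 → euclNorm (loopMat S.Q S.R S.Θs Θt j *ᵥ y) + Cw ≤ 1) ∧
      policyCost μ S.Q S.R S.H w S.Θs (gainPolicy S.Q S.R S.H Θt) 1 x
        = quad (backward (loopMat S.Q S.R S.Θs Θt) (costMat S.Q S.R Θt) S.H) x
          + ∑ i ∈ Finset.Icc 1 S.H, ∫ ω, quad (backward (loopMat S.Q S.R S.Θs Θt)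
            (costMat S.Q S.R Θt) (S.H - i)) (w i ω) ∂μ ∧
      ∫ ω, predErr S.Q S.R S.H S.Θs Θt (fun i => w i ω) x ∂μ
        = quad (backward (loopMat S.Q S.R S.Θs Θt)
            (fun i => (devMat S.Q S.R S.Θs Θt i)ᵀ * devMat S.Q S.R S.Θs Θt i) S.H) x
          + ∑ i ∈ Finset.Icc 1 S.H, ∫ ω, quad (backward (loopMat S.Q S.R S.Θs Θt)
            (fun i => (devMat S.Q S.R S.Θs Θt i)ᵀ * devMat S.Q S.R S.Θs Θt i) (S.H - i)) (w i ω)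
              ∂μ := by
    intro n d Ω _ μ _ S hSγ hS w hw Θt hΘt x hx
    have hF : ∀ j < S.H, ∀ y, euclNorm y ≤ 1 →
        euclNorm (loopMat S.Q S.R S.Θs Θt j *ᵥ y) + Cw ≤ 1 := by
      intro j hj y hy
      have h1 := hS.loopMat_le hΘt hj y
      rw [hSγ] at h1
      have h2 := mul_le_of_le_one_right hr0 hy
      linarith
    refine ⟨hF, ?_, ?_⟩
    · rw [policyCost_gainPolicy]
      exact integral_sum_quad_rollout hw hF hx (costMat_transpose Θt hS.posDef_Q hS.posDef_R)
    · simp only [predErr_eq]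
      refine integral_sum_quad_rollout hw hF hx
        (M := fun i => (devMat S.Q S.R S.Θs Θt i)ᵀ * devMat S.Q S.R S.Θs Θt i) fun j => ?_
      rw [Matrix.transpose_mul, Matrix.transpose_transpose]
  by_cases hr1 : r < 1
  · have hr2 : 0 < 1 - r ^ 2 := by nlinarith
    refine ⟨C * (cc / (1 - r ^ 2)), by positivity, ?_⟩
    intro n d Ω _ μ _ S hSγ hn hH hS w hw Θt hΘt x hx _ θ hθ
    obtain ⟨hF, hJ, hE⟩ := common μ S hSγ hS w hw Θt hΘt x hx
    have hH0 : (0 : ℝ) ≤ S.H := Nat.cast_nonneg _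
    set F := loopMat S.Q S.R S.Θs Θt with hFdef
    set N := devMat S.Q S.R S.Θs Θt
    have hA := Amat_mulVec_le Θt hΘt.1
    have hP : ∀ j ≤ S.H, ∀ y, quad (riccati S.Q S.R Θt j) y ≤ C * S.H * (y ⬝ᵥ y) := by
      intro j hj y
      refine (riccati_quad_le_nat_mul hS.posDef_Q hS.posDef_R hC hS.norm_Q Θt hA j y).trans ?_
      have := dotProduct_self_nonneg_real y
      have : (j : ℝ) ≤ S.H := by exact_mod_cast hj
      gcongr
    have hW : ∀ j ≤ S.H, ∀ y, quad (backward F (costMat S.Q S.R Θt) j) y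
        ≤ cc / (1 - r ^ 2) * (y ⬝ᵥ y) := fun j hj y =>
      quad_backward_le_of_contraction hcc0 hr0 hr1
        (fun j hj y => by have := hS.stepCost_gain_le hΘt hj y; rwa [hSγ] at this)
        (fun j hj y => by have := hS.loopMat_le hΘt hj y; rwa [hSγ] at this) hj y
    have hpt : ∀ j ≤ S.H, ∀ y, quad (backward F (costMat S.Q S.R Θt) j) y
        - quad (riccati S.Q S.R Θt j) y ≤ θ * quad (backward F (fun i => (N i)ᵀ * N i) j) y
          + C * S.H * (cc / (1 - r ^ 2)) / θ * quad (backward F (fun i => (F i)ᵀ * F i) j) y :=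
      fun j hj y => excess_le_backward S.Θs Θt hS.posDef_Q hS.posDef_R (J := S.H) (by positivity)
        (by positivity) hθ hP hW hj y
    -- the states stay in the unit ball, so the second term of `hpt` contributes at most `H`
    have hG : ∫ ω, ∑ j ∈ Finset.range S.H, quad ((F (S.H - 1 - j))ᵀ * F (S.H - 1 - j))
        (rollout S.Θs (gainPolicy S.Q S.R S.H Θt) (fun i => w i ω) 1 x j) ∂μ ≤ S.H := by
      have hb : ∀ᵐ ω ∂μ, ∑ j ∈ Finset.range S.H, quad ((F (S.H - 1 - j))ᵀ * F (S.H - 1 - j))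
          (rollout S.Θs (gainPolicy S.Q S.R S.H Θt) (fun i => w i ω) 1 x j) ≤ S.H := by
        filter_upwards [hw.norm_le] with ω hω
        refine (Finset.sum_le_card_nsmul _ _ 1 fun j hj => ?_).trans (by simp)
        have hj' := Finset.mem_range.1 hj
        rw [quad_transpose_mul, ← euclNorm_sq]
        have h1 := hF (S.H - 1 - j) (by omega) _
          (euclNorm_rollout_le_one S.Θs Θt hF hω hx hj'.le)
        exact pow_le_one₀ (euclNorm_nonneg _) (by linarith)
      calc _ ≤ ∫ _, (S.H : ℝ) ∂μ := by
            refine integral_mono_of_nonneg (Filter.Eventually.of_forall fun ω => ?_)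
              (integrable_const _) hb
            refine Finset.sum_nonneg fun j _ => ?_
            rw [quad_transpose_mul]
            exact dotProduct_self_nonneg_real _
        _ = S.H := by simp
    rw [integral_sum_quad_rollout (M := fun i => (F i)ᵀ * F i) hw hF hx
      (fun j => by rw [Matrix.transpose_mul, Matrix.transpose_transpose])] at hG
    have hwb : ∀ h ∈ Finset.Icc 1 S.H, ∀ᵐ ω ∂μ, euclNorm (w h ω) ≤ Cw := fun h hh => by
      filter_upwards [hw.norm_le] with ω hω using hω h hh
    -- the noise terms of both value identities are compared by the same matrix inequality
    have hsumw : ∑ i ∈ Finset.Icc 1 S.H, ∫ ω, quad (backward F (costMat S.Q S.R Θt) (S.H - i))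
          (w i ω) ∂μ - ∑ i ∈ Finset.Icc 1 S.H, ∫ ω, quad (riccati S.Q S.R Θt (S.H - i)) (w i ω) ∂μ
        ≤ θ * ∑ i ∈ Finset.Icc 1 S.H, ∫ ω, quad (backward F (fun i => (N i)ᵀ * N i) (S.H - i))
            (w i ω) ∂μ
          + C * S.H * (cc / (1 - r ^ 2)) / θ * ∑ i ∈ Finset.Icc 1 S.H,
            ∫ ω, quad (backward F (fun i => (F i)ᵀ * F i) (S.H - i)) (w i ω) ∂μ := by
      rw [← Finset.sum_sub_distrib, Finset.mul_sum, Finset.mul_sum, ← Finset.sum_add_distrib]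
      refine Finset.sum_le_sum fun i hi => ?_
      have hI : ∀ M : Matrix (Fin n) (Fin n) ℝ, Integrable (fun ω => quad M (w i ω)) μ := fun M =>
        integrable_quad M (hw.measurable i) (hwb i hi)
      rw [← integral_sub (hI _) (hI _), ← integral_const_mul, ← integral_const_mul,
        ← integral_add ((hI _).const_mul _) ((hI _).const_mul _)]
      exact integral_mono ((hI _).sub (hI _)) (((hI _).const_mul _).add ((hI _).const_mul _))
        fun ω => hpt (S.H - i) (by omega) (w i ω)
    have hx1 := hpt S.H le_rfl x
    have hcoef : 0 ≤ C * S.H * (cc / (1 - r ^ 2)) / θ := by positivity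
    have hG' := mul_le_mul_of_nonneg_left hG hcoef
    have hlast : C * S.H * (cc / (1 - r ^ 2)) / θ * S.H = C * (cc / (1 - r ^ 2)) * (S.H : ℝ) ^ 2 / θ := by
      ring
    rw [hJ, hE, optCost_one_eq]
    linarith
  · -- the closed loop is only non-expansive, and the noise vanishes
    have hr1' : r = 1 := le_antisymm (by linarith) (not_lt.1 hr1)
    have hCw0 : Cw = 0 := le_antisymm (by linarith) hCw
    set c₀ := C / (1 - CA ^ 2) + 1 with hc₀
    have hc₀0 : 0 ≤ c₀ := by positivity
    refine ⟨8 * (2 * c₀ + 2 * C * (1 + γ ^ 2)) * cc + (6 * cc + 2 * C) * cc, by positivity, ?_⟩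
    intro n d Ω _ μ _ S hSγ hn hH hS w hw Θt hΘt x hx hopt θ hθ
    obtain ⟨hF, hJ, hE⟩ := common μ S hSγ hS w hw Θt hΘt x hx
    have : Nonempty (Fin n) := ⟨⟨0, hn⟩⟩
    have hw0 : ∀ (M : ℕ → Matrix (Fin n) (Fin n) ℝ),
        ∑ i ∈ Finset.Icc 1 S.H, ∫ ω, quad (M i) (w i ω) ∂μ = 0 := by
      refine fun M => Finset.sum_eq_zero fun i hi => integral_eq_zero_of_ae ?_
      filter_upwards [hw.norm_le] with ω hω
      have h1 := hω i hi
      rw [hCw0] at h1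
      have h2 : w i ω ⬝ᵥ w i ω = 0 := by
        rw [← euclNorm_sq, le_antisymm h1 (euclNorm_nonneg _)]; norm_num
      rw [dotProduct_self_eq_zero.1 h2, quad_zero_right]
      rfl
    rw [hw0 fun i => backward (loopMat S.Q S.R S.Θs Θt) (costMat S.Q S.R Θt) (S.H - i),
      add_zero] at hJ
    rw [hw0 fun i => backward (loopMat S.Q S.R S.Θs Θt)
      (fun i => (devMat S.Q S.R S.Θs Θt i)ᵀ * devMat S.Q S.R S.Θs Θt i) (S.H - i), add_zero] at hE
    have hopt_eq : ∀ Θ, optCost μ S.Q S.R S.H w Θ 1 x = quad (riccati S.Q S.R Θ S.H) x := fun Θ => by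
      rw [optCost_one_eq, hw0 fun i => riccati S.Q S.R Θ (S.H - i), add_zero]
    have hxx : x ⬝ᵥ x ≤ 1 := by
      rw [← euclNorm_sq]; exact pow_le_one₀ (euclNorm_nonneg _) hx
    -- optimism: the predicted cost is at most the optimal one plus `1`, bounded since `C_A < 1`
    have hx0 : quad (riccati S.Q S.R Θt S.H) x ≤ c₀ := by
      rw [hopt_eq, hopt_eq] at hopt
      have h1 := riccati_quad_le_of_contraction hS.posDef_Q hS.posDef_R hC hCA0 hCA hS.norm_Q S.Θs
        hS.norm_A S.H x
      have h2 : C / (1 - CA ^ 2) * (x ⬝ᵥ x) ≤ C / (1 - CA ^ 2) :=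
        mul_le_of_le_one_right (by positivity) hxx
      linarith
    rw [hJ, hE, hopt_eq]
    refine excess_le_of_nonexpansive hS.posDef_Q hS.posDef_R hC hcc0 hc₀0 (sq_nonneg γ) hθ
      hS.norm_Q S.Θs hΘt.1 hH (fun j hj y => ?_) (fun j hj y => ?_) (fun j hj y => ?_) hxx hx0
    · have := hS.loopMat_le hΘt hj y
      rwa [hSγ, ← hr, hr1', one_mul] at this
    · have := hS.stepCost_gain_le hΘt hj y
      rwa [hSγ] at this
    · have := pow_le_pow_left₀ (euclNorm_nonneg _) (hS.gainToGo_le hΘt hj y) 2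
      rwa [hSγ, mul_pow, euclNorm_sq, euclNorm_sq] at this

end Excess

end PrivateLQ

namespace PrivateLQ

/-! ### Determinants and inverses of positive definite matrices -/

section Determinants

variable {ι : Type*} [Fintype ι]

theorem quad_vecMulVec (z v : ι → ℝ) : quad (Matrix.vecMulVec z z) v = (z ⬝ᵥ v) ^ 2 := by
  unfold quad
  rw [Matrix.vecMulVec_mulVec]
  simp [dotProduct_comm v z, pow_two]

theorem trace_mul_vecMulVec (M : Matrix ι ι ℝ) (z : ι → ℝ) :
    (M * Matrix.vecMulVec z z).trace = quad M z := by
  rw [Matrix.mul_vecMulVec, Matrix.trace_vecMulVec, quad, dotProduct_comm]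

variable [DecidableEq ι]

theorem one_add_sum_le_prod_one_add {κ : Type*} (s : Finset κ) {a : κ → ℝ} (ha : ∀ i, 0 ≤ a i) :
    1 + ∑ i ∈ s, a i ≤ ∏ i ∈ s, (1 + a i) := by
  classical
  induction s using Finset.induction_on with
  | empty => simp
  | insert i s hi ih =>
    rw [Finset.sum_insert hi, Finset.prod_insert hi]
    have h0 : 0 ≤ ∑ i ∈ s, a i := Finset.sum_nonneg fun i _ => ha i
    nlinarith [ha i, mul_nonneg (ha i) h0]

theorem exists_det_one_add_eq_prod {M : Matrix ι ι ℝ} (hM : Mᵀ = M) (h0 : ∀ v, 0 ≤ quad M v) :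
    ∃ a : ι → ℝ, (∀ i, 0 ≤ a i) ∧ ∑ i, a i = M.trace ∧ (1 + M).det = ∏ i, (1 + a i) := by
  have hN : (1 + M).IsHermitian := by
    rw [Matrix.IsHermitian, Matrix.conjTranspose_eq_transpose_of_trivial, Matrix.transpose_add,
      Matrix.transpose_one, hM]
  refine ⟨fun i => hN.eigenvalues i - 1, fun i => ?_, ?_, ?_⟩
  · have h1 := hN.eigenvalues_eq i
    have h2 := hN.eigenvectorBasis.orthonormal.1 i
    set v := hN.eigenvectorBasis i
    have h3 : hN.eigenvalues i = quad (1 + M) (v : ι → ℝ) := by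
      rw [h1]; simp [quad]
    have h4 : (v : ι → ℝ) ⬝ᵥ (v : ι → ℝ) = 1 := by
      rw [← euclNorm_sq]
      have : euclNorm (v : ι → ℝ) = 1 := by simpa [euclNorm] using h2
      rw [this]; norm_num
    change 0 ≤ hN.eigenvalues i - 1
    rw [h3, quad_add_left, quad_one, h4]
    linarith [h0 v]
  · have h := hN.trace_eq_sum_eigenvalues
    rw [Matrix.trace_add, Matrix.trace_one] at h
    simp only [RCLike.ofReal_real_eq_id, id_eq] at h
    simp only [Finset.sum_sub_distrib, ← h]
    simp
  · rw [hN.det_eq_prod_eigenvalues]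
    simp

theorem one_add_trace_le_det {M : Matrix ι ι ℝ} (hM : Mᵀ = M) (h0 : ∀ v, 0 ≤ quad M v) :
    1 + M.trace ≤ (1 + M).det := by
  obtain ⟨a, ha, hs, hp⟩ := exists_det_one_add_eq_prod hM h0
  rw [hp, ← hs]
  exact one_add_sum_le_prod_one_add _ ha

theorem det_one_add_le {M : Matrix ι ι ℝ} (hM : Mᵀ = M) (h0 : ∀ v, 0 ≤ quad M v) :
    (1 + M).det ≤ (1 + M.trace) ^ Fintype.card ι := by
  obtain ⟨a, ha, hs, hp⟩ := exists_det_one_add_eq_prod hM h0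
  rw [hp, ← hs, ← Finset.card_univ, ← Finset.prod_const]
  refine Finset.prod_le_prod (fun i _ => by linarith [ha i]) fun i _ => ?_
  have := Finset.single_le_sum (f := a) (fun i _ => ha i) (Finset.mem_univ i)
  linarith

open scoped MatrixOrder Matrix.Norms.L2Operator in
theorem exists_eq_transpose_mul_self {G : Matrix ι ι ℝ} (hG : G.PosDef) :
    ∃ B : Matrix ι ι ℝ, G = Bᵀ * B ∧ IsUnit B.det := by
  obtain ⟨B, rfl⟩ := CStarAlgebra.nonneg_iff_eq_star_mul_self.mp hG.posSemidef.nonneg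
  refine ⟨B, by rw [Matrix.star_eq_conjTranspose, Matrix.conjTranspose_eq_transpose_of_trivial], ?_⟩
  have h := (Matrix.isUnit_iff_isUnit_det _).1 hG.isUnit
  rw [Matrix.det_mul] at h
  exact isUnit_of_mul_isUnit_right h

/-- The determinant grows at least like the trace of the relative increment. -/
theorem det_mul_one_add_trace_le {G S : Matrix ι ι ℝ} (hG : G.PosDef) (hS : Sᵀ = S)
    (h0 : ∀ v, 0 ≤ quad S v) : G.det * (1 + (G⁻¹ * S).trace) ≤ (G + S).det := by
  obtain ⟨B, rfl, hB⟩ := exists_eq_transpose_mul_self hG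
  have hB' : IsUnit Bᵀ.det := by rwa [Matrix.det_transpose]
  have h1 : Bᵀ * B + S = Bᵀ * (1 + (B⁻¹)ᵀ * S * B⁻¹) * B := by
    rw [Matrix.mul_add, Matrix.add_mul, Matrix.mul_one, Matrix.transpose_nonsing_inv]
    have : Bᵀ * ((Bᵀ)⁻¹ * S * B⁻¹) * B = (Bᵀ * (Bᵀ)⁻¹) * S * (B⁻¹ * B) := by
      simp only [Matrix.mul_assoc]
    rw [this, Matrix.mul_nonsing_inv _ hB', Matrix.nonsing_inv_mul _ hB, Matrix.one_mul,
      Matrix.mul_one]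
  have h2 : ((Bᵀ * B)⁻¹ * S).trace = ((B⁻¹)ᵀ * S * B⁻¹).trace := by
    rw [Matrix.mul_inv_rev, Matrix.transpose_nonsing_inv, Matrix.mul_assoc, Matrix.trace_mul_comm,
      Matrix.mul_assoc]
  have h3 := one_add_trace_le_det (transpose_conj hS B⁻¹) (fun v => by
    rw [quad_conj]; exact h0 _)
  have hdet : 0 ≤ Bᵀ.det * B.det := by
    rw [Matrix.det_transpose]; exact mul_self_nonneg _
  rw [h1, h2, Matrix.det_mul, Matrix.det_mul, Matrix.det_mul]
  nlinarith [mul_le_mul_of_nonneg_left h3 hdet]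

theorem inv_transpose_of_posDef {G : Matrix ι ι ℝ} (hG : G.PosDef) : (G⁻¹)ᵀ = G⁻¹ :=
  transpose_eq_of_posDef hG.inv

theorem mulVec_inv_mulVec {G : Matrix ι ι ℝ} (hG : G.PosDef) (v : ι → ℝ) : G *ᵥ (G⁻¹ *ᵥ v) = v := by
  rw [Matrix.mulVec_mulVec, Matrix.mul_nonsing_inv _ ((Matrix.isUnit_iff_isUnit_det _).1 hG.isUnit),
    Matrix.one_mulVec]

theorem quad_inv_mulVec {G : Matrix ι ι ℝ} (hG : G.PosDef) (v : ι → ℝ) :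
    quad G (G⁻¹ *ᵥ v) = quad G⁻¹ v := by
  unfold quad
  rw [mulVec_inv_mulVec hG, dotProduct_comm]

/-- Cauchy–Schwarz between a form and its inverse. -/
theorem abs_dotProduct_le_sqrt_quad_inv {G : Matrix ι ι ℝ} (hG : G.PosDef) (v z : ι → ℝ) :
    |v ⬝ᵥ z| ≤ √(quad G v) * √(quad G⁻¹ z) := by
  have h := abs_dotProduct_mulVec_le (transpose_eq_of_posDef hG) (quad_nonneg_of_posDef hG) v
    (G⁻¹ *ᵥ z)
  rwa [mulVec_inv_mulVec hG, quad_inv_mulVec hG] at h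

/-- The rank-one update of an inverse form, as an inequality. -/
theorem quad_inv_rank_one_le {G G' : Matrix ι ι ℝ} {z : ι → ℝ} (hG : G.PosDef)
    (hG' : G' = G + Matrix.vecMulVec z z) (hp : G'.PosDef) (v : ι → ℝ) (w : ℝ) :
    quad G'⁻¹ (v + w • z) ≤ quad G⁻¹ v
      + (2 * ((v ⬝ᵥ (G⁻¹ *ᵥ z)) * w) + quad G⁻¹ z * w ^ 2 - (v ⬝ᵥ (G⁻¹ *ᵥ z)) ^ 2)
        / (1 + quad G⁻¹ z) := by
  set a := quad G⁻¹ z with ha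
  set b := v ⬝ᵥ (G⁻¹ *ᵥ z) with hb
  have ha0 : 0 ≤ a := quad_nonneg_of_posDef hG.inv z
  set y := G'⁻¹ *ᵥ (v + w • z) with hy
  set τ := (w - b) / (1 + a) with hτ
  have hGt := transpose_eq_of_posDef hG
  have hGi := inv_transpose_of_posDef hG
  have e1 : quad G'⁻¹ (v + w • z) = y ⬝ᵥ (v + w • z) := by rw [quad, dotProduct_comm]
  have e2 : quad G' y = y ⬝ᵥ (v + w • z) := by rw [quad, hy, mulVec_inv_mulVec hp]
  have e3 : quad G' y = quad G y + (z ⬝ᵥ y) ^ 2 := by rw [hG', quad_add_left, quad_vecMulVec]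
  have e4 : y ⬝ᵥ (v + w • z) = y ⬝ᵥ v + w * (z ⬝ᵥ y) := by
    rw [dotProduct_add, dotProduct_smul, smul_eq_mul, dotProduct_comm y z]
  have h1 := quad_nonneg_of_posDef hG (y - G⁻¹ *ᵥ (v + τ • z))
  rw [quad_sub_right hGt, mulVec_inv_mulVec hG, quad_inv_mulVec hG, quad_add_right hGi,
    Matrix.mulVec_smul, dotProduct_smul, quad_smul_right, dotProduct_add, dotProduct_smul,
    dotProduct_comm y z] at h1
  simp only [smul_eq_mul, ← hb, ← ha] at h1
  set s := z ⬝ᵥ y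
  have h2 : quad G'⁻¹ (v + w • z) ≤ quad G⁻¹ v + 2 * τ * b + τ ^ 2 * a + (w - τ) ^ 2 := by
    nlinarith [sq_nonneg (s - (w - τ))]
  have h3 : 2 * τ * b + τ ^ 2 * a + (w - τ) ^ 2 = (2 * (b * w) + a * w ^ 2 - b ^ 2) / (1 + a) := by
    rw [hτ]; field_simp; ring
  linarith

end Determinants

/-! ### Weighted norms -/

section Weighted

variable {ι κ : Type*} [Fintype ι] [Fintype κ]

/-- `trace (Aᵀ M A)` as the sum of the form `M` over the columns of `A`. -/
def colQuad (M : Matrix ι ι ℝ) (A : Matrix ι κ ℝ) : ℝ := ∑ j, quad M (fun i => A i j)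

theorem trace_transpose_mul_mul (M : Matrix ι ι ℝ) (A : Matrix ι κ ℝ) :
    (Aᵀ * M * A).trace = colQuad M A := by
  unfold colQuad Matrix.trace
  refine Finset.sum_congr rfl fun j _ => ?_
  rw [Matrix.diag_apply, Matrix.mul_assoc, Matrix.mul_apply]
  rfl

theorem weightedNorm_eq (M : Matrix ι ι ℝ) (A : Matrix ι κ ℝ) :
    weightedNorm M A = √(colQuad M A) := by
  rw [weightedNorm, trace_transpose_mul_mul]

theorem colQuad_nonneg {M : Matrix ι ι ℝ} (h : ∀ v, 0 ≤ quad M v) (A : Matrix ι κ ℝ) :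
    0 ≤ colQuad M A := Finset.sum_nonneg fun _ _ => h _

theorem colQuad_mono {M N : Matrix ι ι ℝ} (h : ∀ v, quad M v ≤ quad N v) (A : Matrix ι κ ℝ) :
    colQuad M A ≤ colQuad N A := Finset.sum_le_sum fun _ _ => h _

theorem frobNorm_eq (A : Matrix ι κ ℝ) :
    frobNorm A = √(∑ j, (fun i => A i j) ⬝ᵥ (fun i => A i j)) := by
  rw [frobNorm, trace_transpose_mul_self_eq]

/-- The triangle inequality in the form used for estimators. -/
theorem weightedNorm_sub_le {M : Matrix ι ι ℝ} (hM : Mᵀ = M) (h0 : ∀ v, 0 ≤ quad M v)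
    (A B : Matrix ι κ ℝ) :
    colQuad M (A - B) ≤ 2 * colQuad M A + 2 * colQuad M B := by
  unfold colQuad
  rw [Finset.mul_sum, Finset.mul_sum, ← Finset.sum_add_distrib]
  refine Finset.sum_le_sum fun j _ => ?_
  have e : (fun i => (A - B) i j) = (fun i => A i j) - fun i => B i j := rfl
  have h1 := h0 ((fun i => A i j) + fun i => B i j)
  rw [quad_add_right hM] at h1
  rw [e, quad_sub_right hM]
  linarith

theorem transpose_mulVec_sq_le_colQuad [DecidableEq ι] {G : Matrix ι ι ℝ} (hG : G.PosDef)
    (A : Matrix ι κ ℝ) (z : ι → ℝ) :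
    (Aᵀ *ᵥ z) ⬝ᵥ (Aᵀ *ᵥ z) ≤ colQuad G A * quad G⁻¹ z := by
  rw [dotProduct_self_transpose_mulVec, colQuad, Finset.sum_mul]
  refine Finset.sum_le_sum fun j _ => ?_
  have h := pow_le_pow_left₀ (abs_nonneg _) (abs_dotProduct_le_sqrt_quad_inv hG (fun i => A i j) z) 2
  rwa [sq_abs, mul_pow, Real.sq_sqrt (quad_nonneg_of_posDef hG _),
    Real.sq_sqrt (quad_nonneg_of_posDef hG.inv _)] at h

/-- The error bound of the perturbed ridge estimator: the error `Δ` solves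
`V Δ = M Θ - W - L`, where `M` is the perturbed regularizer, `W` the noise of the data and `L` the
perturbation of the right-hand side. -/
theorem weightedNorm_le_of_mul_eq [DecidableEq ι] {V G M : Matrix ι ι ℝ} {Δ Θ W L : Matrix ι κ ℝ}
    {lmin lmax : ℝ} (hG : G.PosDef) (hM : Mᵀ = M) (hVG : ∀ v, quad G v ≤ quad V v)
    (hVM : ∀ v, quad M v ≤ quad V v) (hmin : 0 < lmin) (hM0 : ∀ v, lmin * (v ⬝ᵥ v) ≤ quad M v)
    (hM1 : ∀ v, quad M v ≤ lmax * (v ⬝ᵥ v)) (hmax : 0 ≤ lmax) (hΘ : frobNorm Θ ≤ 1)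
    (hE : V * Δ = M * Θ - W - L) :
    weightedNorm V Δ ≤ √(colQuad G⁻¹ W) + √lmax + frobNorm L / √lmin := by
  have hM00 : ∀ v, 0 ≤ quad M v := fun v =>
    (mul_nonneg hmin.le (dotProduct_self_nonneg_real v)).trans (hM0 v)
  have hV0 : ∀ v, 0 ≤ quad V v := fun v => (hM00 v).trans (hVM v)
  rw [weightedNorm_eq]
  set N := √(colQuad V Δ) with hN
  have hNN : N ^ 2 = colQuad V Δ := Real.sq_sqrt (colQuad_nonneg hV0 Δ)
  have hN0 : 0 ≤ N := Real.sqrt_nonneg _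
  -- Cauchy–Schwarz over the columns
  have hCS : ∀ (f : κ → ℝ), (∀ j, 0 ≤ f j) →
      ∑ j, √(quad V (fun i => Δ i j)) * √(f j) ≤ N * √(∑ j, f j) := by
    intro f hf
    have h := Real.sum_mul_le_sqrt_mul_sqrt Finset.univ (fun j => √(quad V (fun i => Δ i j)))
      (fun j => √(f j))
    simp only [Real.sq_sqrt (hf _), Real.sq_sqrt (hV0 _)] at h
    exact h
  have hcol : ∀ j, quad V (fun i => Δ i j) = (fun i => Δ i j) ⬝ᵥ (M *ᵥ fun i => Θ i j)
      - (fun i => Δ i j) ⬝ᵥ (fun i => W i j) - (fun i => Δ i j) ⬝ᵥ (fun i => L i j) := by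
    intro j
    have h1 : V *ᵥ (fun i => Δ i j) = M *ᵥ (fun i => Θ i j) - (fun i => W i j) - fun i => L i j := by
      ext i
      have := congrFun (congrFun hE i) j
      simp only [Matrix.sub_apply, Matrix.mul_apply] at this
      simp only [Pi.sub_apply, Matrix.mulVec, dotProduct]
      exact this
    rw [quad, h1, dotProduct_sub, dotProduct_sub]
  have hT1 : ∑ j, (fun i => Δ i j) ⬝ᵥ (M *ᵥ fun i => Θ i j) ≤ N * √lmax := by
    have h1 : ∀ j, (fun i => Δ i j) ⬝ᵥ (M *ᵥ fun i => Θ i j)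
        ≤ √(quad V (fun i => Δ i j)) * √(quad M (fun i => Θ i j)) := fun j =>
      ((le_abs_self _).trans (abs_dotProduct_mulVec_le hM hM00 _ _)).trans
        (mul_le_mul_of_nonneg_right (Real.sqrt_le_sqrt (hVM _)) (Real.sqrt_nonneg _))
    refine (Finset.sum_le_sum fun j _ => h1 j).trans ((hCS _ fun j => hM00 _).trans ?_)
    refine mul_le_mul_of_nonneg_left (Real.sqrt_le_sqrt ?_) hN0
    refine (Finset.sum_le_sum fun j _ => hM1 _).trans ?_
    rw [← Finset.mul_sum, ← trace_transpose_mul_self_eq, ← frobNorm_sq]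
    exact mul_le_of_le_one_right hmax (pow_le_one₀ (Real.sqrt_nonneg _) hΘ)
  have hT2 : ∑ j, -((fun i => Δ i j) ⬝ᵥ (fun i => W i j)) ≤ N * √(colQuad G⁻¹ W) := by
    have h1 : ∀ j, -((fun i => Δ i j) ⬝ᵥ (fun i => W i j))
        ≤ √(quad V (fun i => Δ i j)) * √(quad G⁻¹ (fun i => W i j)) := fun j =>
      ((neg_le_abs _).trans (abs_dotProduct_le_sqrt_quad_inv hG _ _)).trans
        (mul_le_mul_of_nonneg_right (Real.sqrt_le_sqrt (hVG _)) (Real.sqrt_nonneg _))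
    exact (Finset.sum_le_sum fun j _ => h1 j).trans
      (hCS _ fun j => quad_nonneg_of_posDef hG.inv _)
  have hT3 : ∑ j, -((fun i => Δ i j) ⬝ᵥ (fun i => L i j)) ≤ N * (frobNorm L / √lmin) := by
    have h1 : ∀ j, -((fun i => Δ i j) ⬝ᵥ (fun i => L i j))
        ≤ (√(quad V (fun i => Δ i j)) * √((fun i => L i j) ⬝ᵥ (fun i => L i j))) / √lmin := by
      intro j
      refine (neg_le_abs _).trans ((abs_dotProduct_le _ _).trans ?_)
      rw [le_div_iff₀ (Real.sqrt_pos.2 hmin), ← euclNorm_sq, Real.sqrt_sq (euclNorm_nonneg _)]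
      have h2 : euclNorm (fun i => Δ i j) * √lmin ≤ √(quad V (fun i => Δ i j)) := by
        apply Real.le_sqrt_of_sq_le
        rw [mul_pow, Real.sq_sqrt hmin.le, euclNorm_sq]
        linarith [hM0 (fun i => Δ i j), hVM (fun i => Δ i j)]
      nlinarith [mul_le_mul_of_nonneg_right h2 (euclNorm_nonneg fun i => L i j)]
    refine (Finset.sum_le_sum fun j _ => h1 j).trans ?_
    rw [← Finset.sum_div, ← mul_div_assoc, frobNorm_eq]
    exact div_le_div_of_nonneg_right (hCS _ fun j => dotProduct_self_nonneg_real _)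
      (Real.sqrt_nonneg _)
  have hsum : N ^ 2 ≤ N * (√(colQuad G⁻¹ W) + √lmax + frobNorm L / √lmin) := by
    have h1 : N ^ 2 = ∑ j, (fun i => Δ i j) ⬝ᵥ (M *ᵥ fun i => Θ i j)
        + ∑ j, -((fun i => Δ i j) ⬝ᵥ (fun i => W i j))
        + ∑ j, -((fun i => Δ i j) ⬝ᵥ (fun i => L i j)) := by
      rw [hNN, colQuad, ← Finset.sum_add_distrib, ← Finset.sum_add_distrib]
      exact Finset.sum_congr rfl fun j _ => by rw [hcol j]; ring
    rw [h1]
    linarith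
  rcases hN0.eq_or_lt with h | h
  · rw [← h]
    have : 0 ≤ frobNorm L / √lmin := div_nonneg (Real.sqrt_nonneg _) (Real.sqrt_nonneg _)
    positivity
  · rw [pow_two] at hsum
    exact le_of_mul_le_mul_left hsum h

end Weighted

end PrivateLQ

namespace PrivateLQ

/-! ### Exponential supermartingales -/

section Supermartingale

variable {Ω Ω' E : Type*} {mΩ : MeasurableSpace Ω} {mΩ' : MeasurableSpace Ω'}
  {mE : MeasurableSpace E} {μ : Measure Ω}

/-- Integrating out an independent factor. -/
theorem lintegral_mul_indep_le [IsProbabilityMeasure μ] {φ : Ω → Ω'} {W : Ω → E}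
    (hφ : Measurable φ) (hW : Measurable W) (hind : IndepFun φ W μ) {Y : Ω' → ℝ≥0∞}
    (hY : Measurable Y) {X : Ω' × E → ℝ≥0∞} (hX : Measurable X)
    (h : ∀ᵐ ω ∂μ, ∫⁻ e, X (φ ω, e) ∂(μ.map W) ≤ 1) :
    ∫⁻ ω, Y (φ ω) * X (φ ω, W ω) ∂μ ≤ ∫⁻ ω, Y (φ ω) ∂μ := by
  have hlaw := (indepFun_iff_map_prod_eq_prod_map_map hφ.aemeasurable hW.aemeasurable).1 hind
  have : IsProbabilityMeasure (μ.map W) := Measure.isProbabilityMeasure_map hW.aemeasurable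
  have : IsProbabilityMeasure (μ.map φ) := Measure.isProbabilityMeasure_map hφ.aemeasurable
  have hm : Measurable fun p : Ω' × E => Y p.1 * X p := (hY.comp measurable_fst).mul hX
  calc ∫⁻ ω, Y (φ ω) * X (φ ω, W ω) ∂μ
      = ∫⁻ p, Y p.1 * X p ∂(μ.map fun ω => (φ ω, W ω)) := (lintegral_map hm (hφ.prodMk hW)).symm
    _ = ∫⁻ ω', ∫⁻ e, Y ω' * X (ω', e) ∂(μ.map W) ∂(μ.map φ) := by
        rw [hlaw, lintegral_prod _ hm.aemeasurable]
    _ = ∫⁻ ω', Y ω' * ∫⁻ e, X (ω', e) ∂(μ.map W) ∂(μ.map φ) := by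
        congr 1 with ω'
        exact lintegral_const_mul _ (hX.comp measurable_prodMk_left)
    _ = ∫⁻ ω, Y (φ ω) * ∫⁻ e, X (φ ω, e) ∂(μ.map W) ∂μ :=
        lintegral_map (hY.mul hX.lintegral_prod_right') hφ
    _ ≤ ∫⁻ ω, Y (φ ω) ∂μ := by
        refine lintegral_mono_ae ?_
        filter_upwards [h] with ω hω
        exact mul_le_of_le_one_right' hω

/-- The process `∏_{s < t} X_s(ω, W_s(ω))`. -/
noncomputable def prodProcess (X : ℕ → Ω × E → ℝ≥0∞) (W : ℕ → Ω → E) (t : ℕ) (ω : Ω) : ℝ≥0∞ :=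
  ∏ s ∈ Finset.range t, X s (ω, W s ω)

theorem measurable_prodProcess {ℱ : ℕ → MeasurableSpace Ω} (hmono : Monotone ℱ)
    {X : ℕ → Ω × E → ℝ≥0∞} {W : ℕ → Ω → E}
    (hX : ∀ t, Measurable[(ℱ t).prod mE] (X t)) (hW : ∀ t, Measurable[ℱ (t + 1)] (W t)) (t : ℕ) :
    Measurable[ℱ t] (prodProcess X W t) := by
  refine Finset.measurable_fun_prod _ fun s hs => ?_
  have hs' := Finset.mem_range.1 hs
  have h1 : @Measurable Ω (Ω × E) (ℱ t) ((ℱ s).prod mE) fun ω => (ω, W s ω) :=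
    @Measurable.prodMk _ (ℱ t) _ _ (ℱ s) mE _ _
      (measurable_id'' (hmono hs'.le)) ((hW s).mono (hmono hs') le_rfl)
  exact (hX s).comp h1

/-- **Ville's inequality** for products of factors with conditional mean at most one. -/
theorem measure_exists_le_prodProcess [IsProbabilityMeasure μ] {ℱ : ℕ → MeasurableSpace Ω}
    (hmono : Monotone ℱ) (hle : ∀ t, ℱ t ≤ mΩ) {X : ℕ → Ω × E → ℝ≥0∞} {W : ℕ → Ω → E}
    (hX : ∀ t, Measurable[(ℱ t).prod mE] (X t)) (hW : ∀ t, Measurable[ℱ (t + 1)] (W t)) {N : ℕ}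
    (hind : ∀ t < N, Indep (MeasurableSpace.comap (W t) mE) (ℱ t) μ)
    (hint : ∀ t < N, ∀ᵐ ω ∂μ, ∫⁻ e, X t (ω, e) ∂(μ.map (W t)) ≤ 1) (a : ℝ≥0∞) :
    a * μ {ω | ∃ t ≤ N, a ≤ prodProcess X W t ω} ≤ 1 := by
  set P := prodProcess X W with hP
  have hPm : ∀ t, Measurable[ℱ t] (P t) := measurable_prodProcess hmono hX hW
  -- the event that the level has been reached by time `t`
  set A : ℕ → Set Ω := fun t => {ω | ∃ s ≤ t, a ≤ P s ω} with hA
  have hAm : ∀ t, MeasurableSet[ℱ t] (A t) := by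
    intro t
    have : A t = ⋃ s ∈ Finset.range (t + 1), {ω | a ≤ P s ω} := by
      ext ω; simp [hA]
    rw [this]
    refine Finset.measurableSet_biUnion _ fun s hs => ?_
    have hst : s ≤ t := Nat.lt_succ_iff.1 (Finset.mem_range.1 hs)
    exact hmono hst _ (hPm s measurableSet_Ici)
  have key : ∀ t ≤ N, a * μ (A t) + ∫⁻ ω in (A t)ᶜ, P t ω ∂μ ≤ 1 := by
    intro t
    induction t with
    | zero =>
      intro _
      have hP0 : ∀ ω, P 0 ω = 1 := fun ω => by simp [hP, prodProcess]
      have hA0 : MeasurableSet (A 0) := hle 0 _ (hAm 0)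
      have h1 : a * μ (A 0) ≤ μ (A 0) := by
        by_cases h : a ≤ 1
        · exact mul_le_of_le_one_left' h
        · have : A 0 = ∅ := by
            ext ω; simp [hA, hP0, h]
          simp [this]
      simp only [hP0, lintegral_one, Measure.restrict_apply_univ]
      refine (add_le_add_left h1 _).trans ?_
      rw [measure_add_measure_compl hA0, measure_univ]
    | succ t ih =>
      intro ht
      have hAt : MeasurableSet (A t) := hle t _ (hAm t)
      have hAt1 : MeasurableSet (A (t + 1)) := hle _ _ (hAm (t + 1))
      have hsub : A t ⊆ A (t + 1) := fun ω ⟨s, hs, h⟩ => ⟨s, hs.trans (Nat.le_succ _), h⟩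
      -- one step of the supermartingale off the event `A t`
      have hstep : ∫⁻ ω in (A t)ᶜ, P (t + 1) ω ∂μ ≤ ∫⁻ ω in (A t)ᶜ, P t ω ∂μ := by
        have hY : Measurable[ℱ t] ((A t)ᶜ.indicator (P t)) := (hPm t).indicator (hAm t).compl
        have hi : @IndepFun Ω Ω E mΩ (ℱ t) mE id (W t) μ := by
          refine (@IndepFun_iff_Indep Ω Ω E mΩ (ℱ t) mE id (W t) μ).2 ?_
          rw [MeasurableSpace.comap_id]
          exact (hind t (by omega)).symm
        have h := @lintegral_mul_indep_le Ω Ω E mΩ (ℱ t) mE μ _ id (W t)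
          (measurable_id'' (hle t)) ((hW t).mono (hle _) le_rfl) hi _ hY (X t) (hX t)
          (hint t (by omega))
        simp only [id] at h
        rw [← lintegral_indicator hAt.compl, ← lintegral_indicator hAt.compl]
        refine le_trans (le_of_eq (lintegral_congr fun ω => ?_)) h
        by_cases hω : ω ∈ (A t)ᶜ
        · rw [Set.indicator_of_mem hω, Set.indicator_of_mem hω]
          exact Finset.prod_range_succ _ _
        · rw [Set.indicator_of_notMem hω, Set.indicator_of_notMem hω, zero_mul]
      have hnew : a * μ (A (t + 1) \ A t) ≤ ∫⁻ ω in A (t + 1) \ A t, P (t + 1) ω ∂μ := by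
        rw [← setLIntegral_const]
        refine setLIntegral_mono' (hAt1.diff hAt) fun ω hω => ?_
        obtain ⟨s, hs, h⟩ := hω.1
        rcases Nat.le_succ_iff.1 hs with h' | h'
        · exact absurd ⟨s, h', h⟩ hω.2
        · rwa [h'] at h
      have hsplit : ∫⁻ ω in (A t)ᶜ, P (t + 1) ω ∂μ
          = ∫⁻ ω in A (t + 1) \ A t, P (t + 1) ω ∂μ + ∫⁻ ω in (A (t + 1))ᶜ, P (t + 1) ω ∂μ := by
        rw [← lintegral_union hAt1.compl]
        · congr 2
          ext ω
          simp only [Set.mem_compl_iff, Set.mem_union, Set.mem_sdiff]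
          constructor
          · intro h; by_cases h' : ω ∈ A (t + 1) <;> tauto
          · rintro (h | h)
            · exact h.2
            · exact fun h' => h (hsub h')
        · exact Set.disjoint_left.2 fun ω h h' => h' h.1
      have hmeas : μ (A (t + 1)) = μ (A t) + μ (A (t + 1) \ A t) := by
        rw [measure_sdiff hsub hAt.nullMeasurableSet (measure_ne_top _ _),
          add_tsub_cancel_of_le (measure_mono hsub)]
      calc a * μ (A (t + 1)) + ∫⁻ ω in (A (t + 1))ᶜ, P (t + 1) ω ∂μ
          = a * μ (A t) + (a * μ (A (t + 1) \ A t) + ∫⁻ ω in (A (t + 1))ᶜ, P (t + 1) ω ∂μ) := by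
            rw [hmeas, mul_add, add_assoc]
        _ ≤ a * μ (A t) + ∫⁻ ω in (A t)ᶜ, P (t + 1) ω ∂μ := by
            rw [hsplit]
            gcongr
        _ ≤ a * μ (A t) + ∫⁻ ω in (A t)ᶜ, P t ω ∂μ := by gcongr
        _ ≤ 1 := ih (by omega)
  exact (le_add_right le_rfl).trans (key N le_rfl)

/-- The exponential form of `measure_exists_le_prodProcess`. -/
theorem measure_exists_le_sum_exp [IsProbabilityMeasure μ] {ℱ : ℕ → MeasurableSpace Ω}
    (hmono : Monotone ℱ) (hle : ∀ t, ℱ t ≤ mΩ) {X : ℕ → Ω × E → ℝ} {W : ℕ → Ω → E}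
    (hX : ∀ t, Measurable[(ℱ t).prod mE] (X t)) (hW : ∀ t, Measurable[ℱ (t + 1)] (W t)) {N : ℕ}
    (hind : ∀ t < N, Indep (MeasurableSpace.comap (W t) mE) (ℱ t) μ)
    (hint : ∀ t < N, ∀ᵐ ω ∂μ, ∫⁻ e, ENNReal.ofReal (Real.exp (X t (ω, e))) ∂(μ.map (W t)) ≤ 1)
    {p : ℝ} (hp : 0 < p) :
    μ {ω | ∃ t ≤ N, Real.log (1 / p) ≤ ∑ s ∈ Finset.range t, X s (ω, W s ω)}
      ≤ ENNReal.ofReal p := by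
  have hX' : ∀ t, Measurable[(ℱ t).prod mE] fun q => ENNReal.ofReal (Real.exp (X t q)) :=
    fun t => (Real.measurable_exp.comp (hX t)).ennreal_ofReal
  have h := measure_exists_le_prodProcess hmono hle hX' hW hind hint (ENNReal.ofReal (1 / p))
  have hset : {ω | ∃ t ≤ N, Real.log (1 / p) ≤ ∑ s ∈ Finset.range t, X s (ω, W s ω)}
      ⊆ {ω | ∃ t ≤ N, ENNReal.ofReal (1 / p)
        ≤ prodProcess (fun t q => ENNReal.ofReal (Real.exp (X t q))) W t ω} := by
    rintro ω ⟨t, ht, h⟩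
    refine ⟨t, ht, ?_⟩
    rw [prodProcess, ← ENNReal.ofReal_prod_of_nonneg fun _ _ => (Real.exp_pos _).le,
      ← Real.exp_sum]
    apply ENNReal.ofReal_le_ofReal
    rwa [← Real.log_le_iff_le_exp (by positivity)]
  refine (measure_mono hset).trans ?_
  rw [one_div, ENNReal.ofReal_inv_of_pos hp] at h
  rw [one_div, ENNReal.ofReal_inv_of_pos hp]
  have hp0 : ENNReal.ofReal p ≠ 0 := by simpa using hp
  calc _ = ENNReal.ofReal p * ((ENNReal.ofReal p)⁻¹ * _) := by
        rw [← mul_assoc, ENNReal.mul_inv_cancel hp0 ENNReal.ofReal_ne_top, one_mul]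
    _ ≤ ENNReal.ofReal p * 1 := by gcongr
    _ = _ := mul_one _

/-- Independence of a pair from independence of its components given in sequence. -/
theorem indep_sup_left_of_sequential {m₁ m₂ m₃ : MeasurableSpace Ω} [IsProbabilityMeasure μ]
    (h1 : m₁ ≤ mΩ) (h2 : m₂ ≤ mΩ) (h3 : m₃ ≤ mΩ) (h12 : Indep m₁ m₂ μ)
    (h3' : Indep m₃ (m₂ ⊔ m₁) μ) : Indep (m₁ ⊔ m₃) m₂ μ := by
  set p : Set (Set Ω) := {s | ∃ A C, MeasurableSet[m₁] A ∧ MeasurableSet[m₃] C ∧ s = A ∩ C}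
  have hp : IsPiSystem p := by
    rintro _ ⟨A, C, hA, hC, rfl⟩ _ ⟨A', C', hA', hC', rfl⟩ _
    exact ⟨A ∩ A', C ∩ C', hA.inter hA', hC.inter hC', Set.inter_inter_inter_comm _ _ _ _⟩
  have hgen : m₁ ⊔ m₃ = MeasurableSpace.generateFrom p := by
    apply le_antisymm
    · refine sup_le (fun A hA => ?_) fun C hC => ?_
      · exact MeasurableSpace.measurableSet_generateFrom
          ⟨A, Set.univ, hA, MeasurableSet.univ, (Set.inter_univ A).symm⟩
      · exact MeasurableSpace.measurableSet_generateFrom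
          ⟨Set.univ, C, MeasurableSet.univ, hC, (Set.univ_inter C).symm⟩
    · refine MeasurableSpace.generateFrom_le ?_
      rintro _ ⟨A, C, hA, hC, rfl⟩
      exact MeasurableSet.inter ((le_sup_left : m₁ ≤ m₁ ⊔ m₃) _ hA)
        ((le_sup_right : m₃ ≤ m₁ ⊔ m₃) _ hC)
  refine IndepSets.indep (sup_le h1 h3) h2 hp (@MeasurableSpace.isPiSystem_measurableSet Ω m₂)
    hgen (@MeasurableSpace.generateFrom_measurableSet Ω m₂).symm ?_
  rw [IndepSets_iff]
  rintro _ B ⟨A, C, hA, hC, rfl⟩ hB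
  rw [Indep_iff] at h12 h3'
  have hA' : MeasurableSet[m₂ ⊔ m₁] A := (le_sup_right : m₁ ≤ m₂ ⊔ m₁) _ hA
  have hB' : MeasurableSet[m₂ ⊔ m₁] B := (le_sup_left : m₂ ≤ m₂ ⊔ m₁) _ hB
  have e1 : A ∩ C ∩ B = C ∩ (A ∩ B) := by ext; simp; tauto
  rw [e1, h3' C (A ∩ B) hC (hA'.inter hB'), h12 A B hA hB, Set.inter_comm A C, h3' C A hC hA',
    mul_assoc]

end Supermartingale

end PrivateLQ

namespace PrivateLQ

/-! ### Norms of random matrices -/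

section RandomMatrices

variable {ι : Type*} [Fintype ι]

open Metric Module in
/-- A volume comparison of balls of radius `1/8` with a ball of radius `9/8`. -/
theorem card_le_of_quarter_separated {E : Type*} [NormedAddCommGroup E] [NormedSpace ℝ E]
    [FiniteDimensional ℝ E] (s : Finset E) (hs : ∀ c ∈ s, ‖c‖ ≤ 1)
    (h : ∀ c ∈ s, ∀ e ∈ s, c ≠ e → 1 / 4 ≤ ‖c - e‖) : s.card ≤ 9 ^ finrank ℝ E := by
  borelize E
  let μ : Measure E := Measure.addHaar
  have D : Set.Pairwise (s : Set E) (Function.onFun Disjoint fun c => ball (c : E) (1 / 8)) := by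
    intro c hc e he hce
    apply ball_disjoint_ball
    rw [dist_eq_norm]
    linarith [h c hc e he hce]
  have hsub : (⋃ c ∈ s, ball (c : E) (1 / 8)) ⊆ ball (0 : E) (9 / 8) := by
    refine Set.iUnion₂_subset fun x hx => ball_subset_ball' ?_
    rw [dist_zero_right]
    linarith [hs x hx]
  have I : (s.card : ℝ≥0∞) * ENNReal.ofReal ((1 / 8 : ℝ) ^ finrank ℝ E) * μ (ball 0 1)
      ≤ ENNReal.ofReal ((9 / 8 : ℝ) ^ finrank ℝ E) * μ (ball 0 1) :=
    calc
      _ = μ (⋃ c ∈ s, ball (c : E) (1 / 8)) := by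
        rw [measure_biUnion_finset D fun c _ => measurableSet_ball]
        simp only [μ.addHaar_ball_of_pos _ (by norm_num : (0 : ℝ) < 1 / 8)]
        simp only [Finset.sum_const, nsmul_eq_mul, mul_assoc]
      _ ≤ μ (ball (0 : E) (9 / 8)) := measure_mono hsub
      _ = _ := by simp only [μ.addHaar_ball_of_pos _ (by norm_num : (0 : ℝ) < 9 / 8)]
  have J := (ENNReal.mul_le_mul_iff_left (measure_ball_pos _ _ zero_lt_one).ne'
    measure_ball_lt_top.ne).1 I
  have K : (s.card : ℝ) * (1 / 8 : ℝ) ^ finrank ℝ E ≤ (9 / 8 : ℝ) ^ finrank ℝ E := by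
    have := ENNReal.toReal_le_of_le_ofReal (by positivity) J
    rw [ENNReal.toReal_mul, ENNReal.toReal_ofReal (by positivity)] at this
    simpa using this
  rw [div_pow, div_pow, one_pow, mul_one_div, div_le_div_iff_of_pos_right (by positivity)] at K
  exact_mod_cast K

/-- A `1/4`-net of the Euclidean unit sphere. -/
theorem exists_net_sphere (ι : Type*) [Fintype ι] :
    ∃ t : Finset (ι → ℝ), t.card ≤ 9 ^ Fintype.card ι ∧ (∀ v ∈ t, v ⬝ᵥ v = 1) ∧
      ∀ e : ι → ℝ, e ⬝ᵥ e = 1 → ∃ v ∈ t, (v - e) ⬝ᵥ (v - e) ≤ 1 / 16 := by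
  classical
  set p : Finset (EuclideanSpace ℝ ι) → Prop := fun s =>
    (∀ c ∈ s, ‖c‖ = 1) ∧ ∀ c ∈ s, ∀ e ∈ s, c ≠ e → 1 / 4 ≤ ‖c - e‖ with hp
  have hcard : ∀ s, p s → s.card ≤ 9 ^ Fintype.card ι := fun s hs => by
    have := card_le_of_quarter_separated s (fun c hc => (hs.1 c hc).le) hs.2
    rwa [finrank_euclideanSpace] at this
  -- a separated set of maximal cardinality
  obtain ⟨s, hs, hmax⟩ : ∃ s, p s ∧ ∀ s', p s' → s'.card ≤ s.card := by
    have hex : ∃ k, ∃ s, p s ∧ s.card = k := ⟨0, ∅, by simp [hp], rfl⟩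
    obtain ⟨s, hs, hk⟩ := Nat.findGreatest_spec (P := fun k => ∃ s, p s ∧ s.card = k)
      (Nat.zero_le (9 ^ Fintype.card ι)) ⟨∅, by simp [hp], rfl⟩
    refine ⟨s, hs, fun s' hs' => ?_⟩
    rw [hk]
    exact Nat.le_findGreatest (hcard s' hs') ⟨s', hs', rfl⟩
  refine ⟨s.image WithLp.ofLp, card_image_le.trans (hcard s hs), ?_, ?_⟩
  · intro v hv
    obtain ⟨c, hc, rfl⟩ := Finset.mem_image.1 hv
    rw [← euclNorm_sq]
    have : euclNorm (c : ι → ℝ) = 1 := hs.1 c hc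
    rw [this, one_pow]
  · intro e he
    have he1 : ‖WithLp.toLp 2 e‖ = 1 := by
      have h1 : euclNorm e ^ 2 = 1 := (euclNorm_sq e).trans he
      have h2 := euclNorm_nonneg e
      change euclNorm e = 1
      nlinarith
    by_contra! hcon
    have hlt : ∀ c ∈ s, 1 / 4 < ‖c - WithLp.toLp 2 e‖ := fun c hc => by
      have h1 := hcon _ (Finset.mem_image_of_mem _ hc)
      have h2 : euclNorm ((c : ι → ℝ) - e) ^ 2 = _ := euclNorm_sq _
      have h3 : ‖c - WithLp.toLp 2 e‖ = euclNorm ((c : ι → ℝ) - e) := rfl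
      rw [h3]
      nlinarith [euclNorm_nonneg ((c : ι → ℝ) - e)]
    have hnot : WithLp.toLp 2 e ∉ s := fun h => by
      have := hlt _ h
      simp at this
      linarith
    have := hmax (insert (WithLp.toLp 2 e) s) ⟨?_, ?_⟩
    · rw [card_insert_of_notMem hnot] at this
      omega
    · intro c hc
      rcases Finset.mem_insert.1 hc with rfl | hc
      exacts [he1, hs.1 c hc]
    · intro c hc b hb hne
      rcases Finset.mem_insert.1 hc with rfl | hc <;> rcases Finset.mem_insert.1 hb with rfl | hb
      · exact absurd rfl hne
      · rw [norm_sub_rev]; exact (hlt b hb).le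
      · exact (hlt c hc).le
      · exact hs.2 c hc b hb hne

/-- If `e` is an eigenvector of `N` whose eigenvalue dominates `|quad N|`, then `quad N` is nearly as
large at every unit vector close to `e`. -/
theorem quad_ge_of_close [DecidableEq ι] {N : Matrix ι ι ℝ} (hN : Nᵀ = N) {s : ℝ} {e v : ι → ℝ}
    (he : N *ᵥ e = s • e) (hlow : ∀ y, -(s * (y ⬝ᵥ y)) ≤ quad N y)
    (hv : v ⬝ᵥ v = 1) (hs : 0 ≤ s) (hclose : (v - e) ⬝ᵥ (v - e) ≤ 1 / 16) :
    7 / 8 * s ≤ quad N v := by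
  set M := s • (1 : Matrix ι ι ℝ) - N with hM
  have hMt : Mᵀ = M := by simp [hM, hN]
  have hMe : M *ᵥ e = 0 := by
    rw [hM, Matrix.sub_mulVec, Matrix.smul_mulVec, Matrix.one_mulVec, he, sub_self]
  have hq : ∀ y, quad M y = s * (y ⬝ᵥ y) - quad N y := fun y => by
    rw [hM, quad_sub_left, quad_smul_left, quad_one]
  have h1 : quad M (v - e) = quad M v := by
    rw [quad_sub_right hMt, hMe]
    have : quad M e = 0 := by rw [quad, hMe, dotProduct_zero]
    rw [this, dotProduct_zero]; ring
  have h2 : quad M (v - e) ≤ 2 * s * (1 / 16) := by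
    rw [hq]
    have := hlow (v - e)
    nlinarith
  rw [h1, hq, hv] at h2
  linarith

/-- A symmetric matrix whose quadratic form is small on a net is small. -/
theorem exists_net_abs_quad_ge [DecidableEq ι] {N : Matrix ι ι ℝ} (hN : Nᵀ = N)
    {t : Finset (ι → ℝ)} (ht : ∀ v ∈ t, v ⬝ᵥ v = 1)
    (hnet : ∀ e : ι → ℝ, e ⬝ᵥ e = 1 → ∃ v ∈ t, (v - e) ⬝ᵥ (v - e) ≤ 1 / 16)
    {Λ : ℝ} (hΛ : 0 ≤ Λ) {y : ι → ℝ} (hy : Λ * (y ⬝ᵥ y) < |quad N y|) :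
    ∃ v ∈ t, 7 / 8 * Λ ≤ |quad N v| := by
  have hy0 : 0 < y ⬝ᵥ y := by
    rcases (dotProduct_self_nonneg_real y).lt_or_eq with h | h
    · exact h
    · have : y = 0 := dotProduct_self_eq_zero.1 h.symm
      rw [this] at hy
      simp at hy
  have : Nonempty ι := by
    by_contra hι
    rw [not_nonempty_iff] at hι
    simp at hy0
  obtain ⟨e₁, he₁, hm₁, hv₁⟩ := exists_max_quad hN
  obtain ⟨e₂, he₂, hm₂, hv₂⟩ := exists_max_quad (M := -N) (by rw [Matrix.transpose_neg, hN])
  have hneg : ∀ v, quad (-N) v = -quad N v := fun v => by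
    simp [quad, Matrix.neg_mulVec]
  simp only [hneg] at hm₂ hv₂
  rcases le_total (-quad N e₂) (quad N e₁) with h | h
  · have hs : Λ ≤ quad N e₁ := by
      by_contra! hc
      have h3 := hm₁ y
      have h4 := hm₂ y
      rcases abs_cases (quad N y) with ⟨h5, _⟩ | ⟨h5, _⟩ <;> rw [h5] at hy <;> nlinarith
    obtain ⟨v, hv, hcl⟩ := hnet e₁ he₁
    refine ⟨v, hv, ?_⟩
    have h6 := quad_ge_of_close hN hv₁ (fun x => by
      have := hm₂ x
      nlinarith [dotProduct_self_nonneg_real x]) (ht v hv) (hΛ.trans hs) hcl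
    linarith [le_abs_self (quad N v)]
  · have hs : Λ ≤ -quad N e₂ := by
      by_contra! hc
      have h3 := hm₁ y
      have h4 := hm₂ y
      rcases abs_cases (quad N y) with ⟨h5, _⟩ | ⟨h5, _⟩ <;> rw [h5] at hy <;> nlinarith
    obtain ⟨v, hv, hcl⟩ := hnet e₂ he₂
    refine ⟨v, hv, ?_⟩
    have h6 := quad_ge_of_close (N := -N) (by rw [Matrix.transpose_neg, hN]) hv₂ (fun x => by
      rw [hneg]
      have := hm₁ x
      nlinarith [dotProduct_self_nonneg_real x]) (ht v hv) (hΛ.trans hs) hcl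
    rw [hneg] at h6
    linarith [neg_abs_le (quad N v)]

variable {Ω : Type*} [MeasurableSpace Ω] {μ : Measure Ω} [IsProbabilityMeasure μ]

/-- A random symmetric matrix with sub-Gaussian quadratic form. -/
theorem measure_exists_lt_abs_quad_le [DecidableEq ι] {N : Ω → Matrix ι ι ℝ}
    (hN : ∀ ω, (N ω)ᵀ = N ω) {c : ℝ≥0}
    (hsub : ∀ v : ι → ℝ, v ⬝ᵥ v = 1 → HasSubgaussianMGF (fun ω => quad (N ω) v) c μ)
    {Λ : ℝ} (hΛ : 0 ≤ Λ) :
    μ {ω | ∃ y, Λ * (y ⬝ᵥ y) < |quad (N ω) y|}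
      ≤ ENNReal.ofReal (2 * 9 ^ Fintype.card ι * Real.exp (-(7 / 8 * Λ) ^ 2 / (2 * c))) := by
  obtain ⟨t, hcard, ht, hnet⟩ := exists_net_sphere ι
  set ρ := Real.exp (-(7 / 8 * Λ) ^ 2 / (2 * c))
  have hone : ∀ v ∈ t, μ {ω | 7 / 8 * Λ ≤ |quad (N ω) v|} ≤ ENNReal.ofReal (2 * ρ) := by
    intro v hv
    have h1 := (hsub v (ht v hv)).measure_ge_le (ε := 7 / 8 * Λ) (by positivity)
    have h2 := (hsub v (ht v hv)).neg.measure_ge_le (ε := 7 / 8 * Λ) (by positivity)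
    have h3 : {ω | 7 / 8 * Λ ≤ |quad (N ω) v|}
        ⊆ {ω | 7 / 8 * Λ ≤ quad (N ω) v} ∪ {ω | 7 / 8 * Λ ≤ (-fun ω => quad (N ω) v) ω} := by
      intro ω hω
      rcases le_abs.1 (show 7 / 8 * Λ ≤ |quad (N ω) v| from hω) with h | h
      exacts [Or.inl h, Or.inr h]
    refine (measure_mono h3).trans ((measure_union_le _ _).trans ?_)
    rw [two_mul, ENNReal.ofReal_add (Real.exp_pos _).le (Real.exp_pos _).le]
    refine add_le_add ?_ ?_
    · rw [← ofReal_measureReal]; exact ENNReal.ofReal_le_ofReal h1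
    · rw [← ofReal_measureReal]; exact ENNReal.ofReal_le_ofReal h2
  have hsubset : {ω | ∃ y, Λ * (y ⬝ᵥ y) < |quad (N ω) y|}
      ⊆ ⋃ v ∈ t, {ω | 7 / 8 * Λ ≤ |quad (N ω) v|} := by
    rintro ω ⟨y, hy⟩
    obtain ⟨v, hv, h⟩ := exists_net_abs_quad_ge (hN ω) ht hnet hΛ hy
    exact Set.mem_biUnion hv h
  calc _ ≤ μ (⋃ v ∈ t, {ω | 7 / 8 * Λ ≤ |quad (N ω) v|}) := measure_mono hsubset
    _ ≤ ∑ v ∈ t, μ {ω | 7 / 8 * Λ ≤ |quad (N ω) v|} := measure_biUnion_finset_le _ _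
    _ ≤ ∑ v ∈ t, ENNReal.ofReal (2 * ρ) := Finset.sum_le_sum hone
    _ = ENNReal.ofReal (t.card * (2 * ρ)) := by
      rw [Finset.sum_const, nsmul_eq_mul, ENNReal.ofReal_mul (p := (t.card : ℝ)) (by positivity),
        ENNReal.ofReal_natCast]
    _ ≤ _ := by
      apply ENNReal.ofReal_le_ofReal
      have : (t.card : ℝ) ≤ 9 ^ Fintype.card ι := by exact_mod_cast hcard
      have h0 : 0 < ρ := Real.exp_pos _
      nlinarith

theorem lintegral_exp_sq_div_four_gaussianReal :
    ∫⁻ y, ENNReal.ofReal (Real.exp (y ^ 2 / 4)) ∂(gaussianReal 0 1) = ENNReal.ofReal √2 := by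
  rw [gaussianReal_of_var_ne_zero _ one_ne_zero,
    lintegral_withDensity_eq_lintegral_mul _ (measurable_gaussianPDF _ _) (by fun_prop)]
  have h : ∀ y : ℝ, (gaussianPDF 0 1 * fun y => ENNReal.ofReal (Real.exp (y ^ 2 / 4))) y
      = ENNReal.ofReal √2 * gaussianPDF 0 2 y := by
    intro y
    rw [Pi.mul_apply, gaussianPDF, gaussianPDF, ← ENNReal.ofReal_mul (gaussianPDFReal_nonneg _ _ _),
      ← ENNReal.ofReal_mul (Real.sqrt_nonneg 2)]
    congr 1
    rw [gaussianPDFReal, gaussianPDFReal, mul_assoc, ← Real.exp_add]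
    have h1 : √(2 * Real.pi * ((2 : ℝ≥0) : ℝ)) = √2 * √(2 * Real.pi * ((1 : ℝ≥0) : ℝ)) := by
      rw [← Real.sqrt_mul (by norm_num)]
      congr 1
      push_cast; ring
    rw [h1, mul_inv, ← mul_assoc, ← mul_assoc, mul_inv_cancel₀ (by positivity), one_mul]
    congr 2
    push_cast; ring
  rw [lintegral_congr h, lintegral_const_mul _ (measurable_gaussianPDF _ _),
    lintegral_gaussianPDF_eq_one _ two_ne_zero, mul_one]

/-- A random vector with sub-Gaussian linear forms has a sub-exponential squared length; the square
is linearized by a Gaussian integral. -/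
theorem lintegral_exp_sum_sq_le {L : ι → Ω → ℝ} (hL : ∀ e, Measurable (L e)) {s : ℝ≥0} (hs : s ≠ 0)
    (hsub : ∀ y : ι → ℝ, ∫⁻ ω, ENNReal.ofReal (Real.exp (∑ e, y e * L e ω)) ∂μ
      ≤ ENNReal.ofReal (Real.exp (s * (y ⬝ᵥ y) / 2))) :
    ∫⁻ ω, ENNReal.ofReal (Real.exp ((∑ e, L e ω ^ 2) / (4 * s))) ∂μ
      ≤ ENNReal.ofReal (√2 ^ Fintype.card ι) := by
  have hs0 : (0 : ℝ) < s := by positivity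
  set a : ℝ := √(1 / (2 * s)) with ha
  have ha2 : a ^ 2 = 1 / (2 * s) := Real.sq_sqrt (by positivity)
  set ν : Measure (ι → ℝ) := Measure.pi fun _ => gaussianReal 0 1
  -- product integrals under `ν`
  have hprod : ∀ f : ι → ℝ → ℝ≥0∞, (∀ e, Measurable (f e)) →
      ∫⁻ y, ∏ e, f e (y e) ∂ν = ∏ e, ∫⁻ r, f e r ∂(gaussianReal 0 1) := by
    intro f hf
    have hi : iIndepFun (fun e (y : ι → ℝ) => f e (y e)) ν :=
      iIndepFun_pi fun e => (hf e).aemeasurable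
    have := lintegral_prod_eq_prod_lintegral_of_indepFun univ (fun e (y : ι → ℝ) => f e (y e)) hi
      fun e => (hf e).comp (measurable_pi_apply e)
    rw [this]
    refine Finset.prod_congr rfl fun e _ => ?_
    rw [← lintegral_map (hf e) (measurable_pi_apply e)]
    congr 1
    exact (measurePreserving_eval (fun _ : ι => gaussianReal 0 1) e).map_eq
  have hg : ∀ r : ℝ, ∫⁻ t, ENNReal.ofReal (Real.exp (r * t)) ∂(gaussianReal 0 1)
      = ENNReal.ofReal (Real.exp (r ^ 2 / 2)) := by
    intro r
    rw [← ofReal_integral_eq_lintegral_ofReal (integrable_exp_mul_gaussianReal r)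
      (ae_of_all _ fun _ => (Real.exp_pos _).le)]
    have := mgf_gaussianReal (p := gaussianReal 0 1) (X := id) Measure.map_id r
    rw [mgf] at this
    simp only [id] at this
    rw [this]
    simp
  -- `exp (x² / 2)` is the Gaussian average of `exp (x y)`; with `a² = 1 / (2 s)` the square becomes
  -- linear in `L`, and the sub-Gaussian bound applies after interchanging the integrals
  have h1 : ∀ ω, ENNReal.ofReal (Real.exp ((∑ e, L e ω ^ 2) / (4 * s)))
      = ∫⁻ y, ENNReal.ofReal (Real.exp (∑ e, a * y e * L e ω)) ∂ν := by
    intro ω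
    have e1 : ∀ y : ι → ℝ, ENNReal.ofReal (Real.exp (∑ e, a * y e * L e ω))
        = ∏ e, ENNReal.ofReal (Real.exp ((a * L e ω) * y e)) := fun y => by
      rw [← ENNReal.ofReal_prod_of_nonneg fun _ _ => (Real.exp_pos _).le, ← Real.exp_sum]
      congr 3 with e
      ring
    rw [lintegral_congr e1, hprod (fun e t => ENNReal.ofReal (Real.exp ((a * L e ω) * t)))
      fun e => by fun_prop]
    simp only [hg]
    rw [← ENNReal.ofReal_prod_of_nonneg fun _ _ => (Real.exp_pos _).le, ← Real.exp_sum]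
    congr 2
    rw [Finset.sum_div]
    refine Finset.sum_congr rfl fun e _ => ?_
    rw [mul_pow, ha2]; field_simp; ring
  rw [lintegral_congr h1, lintegral_lintegral_swap]
  · calc ∫⁻ y, ∫⁻ ω, ENNReal.ofReal (Real.exp (∑ e, a * y e * L e ω)) ∂μ ∂ν
        ≤ ∫⁻ y, ∏ e, ENNReal.ofReal (Real.exp (y e ^ 2 / 4)) ∂ν := by
          refine lintegral_mono fun y => (hsub fun e => a * y e).trans (le_of_eq ?_)
          rw [← ENNReal.ofReal_prod_of_nonneg fun _ _ => (Real.exp_pos _).le, ← Real.exp_sum]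
          congr 2
          rw [dotProduct, Finset.mul_sum, Finset.sum_div]
          refine Finset.sum_congr rfl fun e _ => ?_
          have : a * y e * (a * y e) = 1 / (2 * s) * y e ^ 2 := by rw [← ha2]; ring
          rw [this]; field_simp; ring
      _ = _ := by
          rw [hprod (fun e t => ENNReal.ofReal (Real.exp (t ^ 2 / 4))) fun e => by fun_prop]
          simp only [lintegral_exp_sq_div_four_gaussianReal]
          rw [Finset.prod_const, Finset.card_univ, ENNReal.ofReal_pow (Real.sqrt_nonneg _)]
  · refine Measurable.aemeasurable ?_
    refine ENNReal.measurable_ofReal.comp (Real.measurable_exp.comp ?_)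
    refine Finset.measurable_sum _ fun e _ => ?_
    have h1 : Measurable fun p : Ω × (ι → ℝ) => p.2 e := (measurable_pi_apply e).comp measurable_snd
    have h2 : Measurable fun p : Ω × (ι → ℝ) => L e p.1 := (hL e).comp measurable_fst
    exact (h1.const_mul a).mul h2

/-- Tail bound from `lintegral_exp_sum_sq_le`. -/
theorem measure_lt_sum_sq_le {L : ι → Ω → ℝ} (hL : ∀ e, Measurable (L e)) {s : ℝ≥0} (hs : s ≠ 0)
    (hsub : ∀ y : ι → ℝ, ∫⁻ ω, ENNReal.ofReal (Real.exp (∑ e, y e * L e ω)) ∂μ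
      ≤ ENNReal.ofReal (Real.exp (s * (y ⬝ᵥ y) / 2))) (r : ℝ) :
    μ {ω | 4 * s * r ≤ ∑ e, L e ω ^ 2}
      ≤ ENNReal.ofReal (√2 ^ Fintype.card ι * Real.exp (-r)) := by
  have h := lintegral_exp_sum_sq_le hL hs hsub
  have hs0 : (0 : ℝ) < s := by positivity
  have hmeas : Measurable fun ω => ENNReal.ofReal (Real.exp ((∑ e, L e ω ^ 2) / (4 * s))) := by
    fun_prop
  have h2 := mul_meas_ge_le_lintegral₀ (μ := μ) hmeas.aemeasurable (ENNReal.ofReal (Real.exp r))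
  have hset : {ω | 4 * s * r ≤ ∑ e, L e ω ^ 2}
      ⊆ {ω | ENNReal.ofReal (Real.exp r)
        ≤ ENNReal.ofReal (Real.exp ((∑ e, L e ω ^ 2) / (4 * s)))} := by
    intro ω hω
    refine ENNReal.ofReal_le_ofReal (Real.exp_le_exp.2 ?_)
    rw [le_div_iff₀ (by positivity)]
    have : 4 * s * r ≤ ∑ e, L e ω ^ 2 := hω
    linarith
  have h3 := (mul_le_mul_right (measure_mono hset) _).trans (h2.trans h)
  have hr : ENNReal.ofReal (Real.exp r) * ENNReal.ofReal (Real.exp (-r)) = 1 := by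
    rw [← ENNReal.ofReal_mul (Real.exp_pos _).le, ← Real.exp_add]; simp
  calc μ {ω | 4 * s * r ≤ ∑ e, L e ω ^ 2}
      = ENNReal.ofReal (Real.exp (-r)) * (ENNReal.ofReal (Real.exp r)
          * μ {ω | 4 * s * r ≤ ∑ e, L e ω ^ 2}) := by
        rw [← mul_assoc, mul_comm (ENNReal.ofReal (Real.exp (-r))), hr, one_mul]
    _ ≤ ENNReal.ofReal (Real.exp (-r)) * ENNReal.ofReal (√2 ^ Fintype.card ι) := by gcongr
    _ = _ := by
        rw [mul_comm, ENNReal.ofReal_mul (by positivity)]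

/-- Linear combinations of independent centred Gaussian variables. -/
theorem hasSubgaussianMGF_sum_gaussian {τ : Type*} {g : τ → Ω → ℝ} (hind : iIndepFun g μ)
    (hg : ∀ i, Measurable (g i)) {v : ℝ≥0} (s : Finset τ)
    (hlaw : ∀ i ∈ s, μ.map (g i) = gaussianReal 0 v) (c : τ → ℝ) {b : ℝ≥0}
    (hb : v * ∑ i ∈ s, c i ^ 2 ≤ (b : ℝ)) :
    HasSubgaussianMGF (fun ω => ∑ i ∈ s, c i * g i ω) b μ := by
  have hind' : iIndepFun (fun i ω => c i * g i ω) μ :=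
    hind.comp (fun i x => c i * x) fun i => measurable_const_mul (c i)
  have hone : ∀ i ∈ s, HasSubgaussianMGF (fun ω => c i * g i ω)
      (Real.toNNReal (c i ^ 2) * v) μ := by
    intro i hi
    have : HasSubgaussianMGF (g i) v μ := by
      refine ⟨fun t => ?_, fun t => ?_⟩
      · have h := integrable_exp_mul_gaussianReal (μ := 0) (v := v) t
        rw [← hlaw i hi] at h
        exact (integrable_map_measure (by fun_prop) (hg i).aemeasurable).1 h
      · rw [mgf_gaussianReal (hlaw i hi) t]
        simp
    have h := this.const_mul (c i)
    rwa [show (⟨c i ^ 2, sq_nonneg _⟩ : ℝ≥0) = Real.toNNReal (c i ^ 2) from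
      (Real.toNNReal_of_nonneg (sq_nonneg _)).symm] at h
  have hsum := HasSubgaussianMGF.sum_of_iIndepFun hind' hone
  refine ⟨hsum.integrable_exp_mul, fun t => (hsum.mgf_le t).trans (Real.exp_le_exp.2 ?_)⟩
  have : ((∑ i ∈ s, (Real.toNNReal (c i ^ 2) * v : ℝ≥0) : ℝ≥0) : ℝ) ≤ b := by
    push_cast
    refine le_trans (le_of_eq ?_) hb
    rw [Finset.mul_sum]
    exact Finset.sum_congr rfl fun i _ => by
      rw [Real.coe_toNNReal _ (sq_nonneg _), mul_comm]
  gcongr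

end RandomMatrices

end PrivateLQ

namespace PrivateLQ

/-! ### The binary interval tree -/

section Tree

/-- The nodes of `cover t` partition the episodes `1, …, t`. -/
theorem sum_cover {M : Type*} [AddCommMonoid M] (f : ℕ → M) (t : ℕ) :
    ∑ v ∈ cover t, ∑ k ∈ Icc (nodeLo v) (nodeHi v), f k = ∑ k ∈ Icc 1 t, f k := by
  rw [cover, sum_image (fun a _ b _ h => (Prod.ext_iff.1 h).1), sum_filter]
  have hIoc : ∀ a b : ℕ, Icc (a + 1) b = Ioc a b := fun a b => by ext; simp
  -- removing the last `L` binary digits of `t` removes the nodes below level `L`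
  have key : ∀ L, (∑ l ∈ range L, if t.testBit l then
      ∑ k ∈ Icc (nodeLo (l, 2 * (t / 2 ^ (l + 1)))) (nodeHi (l, 2 * (t / 2 ^ (l + 1)))), f k else 0)
      + ∑ k ∈ Ioc 0 (t / 2 ^ L * 2 ^ L), f k = ∑ k ∈ Ioc 0 t, f k := by
    intro L
    induction L with
    | zero => simp
    | succ L ih =>
      rw [← ih, sum_range_succ, add_assoc]
      congr 1
      have hdiv : t / 2 ^ (L + 1) = t / 2 ^ L / 2 := by rw [pow_succ, Nat.div_div_eq_div_mul]
      have hbit : t.testBit L = decide (t / 2 ^ L % 2 = 1) := Nat.testBit_eq_decide_div_mod_eq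
      simp only [nodeLo, nodeHi, hdiv, hbit, hIoc, decide_eq_true_eq]
      set s := t / 2 ^ L
      have hp : s / 2 * 2 ^ (L + 1) = 2 * (s / 2) * 2 ^ L := by rw [pow_succ]; ring
      rw [hp]
      split_ifs with h
      · have hs : 2 * (s / 2) + 1 = s := by omega
        rw [hs, add_comm, sum_Ioc_consecutive _ (Nat.zero_le _)]
        exact Nat.mul_le_mul_right _ (by omega)
      · have hs : 2 * (s / 2) = s := by omega
        rw [hs, zero_add]
  have h := key t.size
  rw [Nat.div_eq_of_lt (Nat.lt_size_self t)] at h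
  simpa [hIoc, show Icc 1 t = Ioc 0 t from hIoc 0 t] using h

theorem card_cover_le {k K : ℕ} (h1 : 1 ≤ k) (hk : k ≤ K) :
    (cover (k - 1)).card ≤ Nat.clog 2 K := by
  refine card_image_le.trans ((card_filter_le _ _).trans ?_)
  rw [card_range, Nat.size_le]
  have := Nat.le_pow_clog (one_lt_two) K
  omega

end Tree

/-! ### The privacy noise -/

section PrivacyNoise

theorem card_fiber_sym2_le {ι : Type*} [Fintype ι] [DecidableEq ι] (s : Sym2 ι) :
    (univ.filter fun p : ι × ι => s(p.1, p.2) = s).card ≤ 2 := by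
  induction s using Sym2.ind with
  | _ a b =>
    refine (card_le_card (t := {(a, b), (b, a)}) ?_).trans card_le_two
    rintro ⟨p, q⟩ h
    simp only [mem_filter, mem_univ, true_and, Sym2.eq_iff] at h
    simp only [mem_insert, mem_singleton, Prod.mk.injEq]
    exact h

namespace Run

variable {n d : ℕ} {Ω : Type*} (S : Run n d Ω)

/-- The total noise in the first counter before episode `k`. -/
def noise₁ (k : ℕ) (ω : Ω) : Matrix (Fin n ⊕ Fin d) (Fin n ⊕ Fin d) ℝ :=
  ∑ v ∈ cover (k - 1), Matrix.of fun p q => S.g (v, Sum.inl s(p, q)) ω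

/-- The total noise in the second counter before episode `k`. -/
def noise₂ (k : ℕ) (ω : Ω) : Param n d :=
  ∑ v ∈ cover (k - 1), Matrix.of fun p q => S.g (v, Sum.inr (p, q)) ω

theorem T₁_eq (k : ℕ) (ω : Ω) : S.T₁ k ω = S.gram k ω + S.noise₁ k ω := by
  unfold T₁ noisyPsum₁ noise₁ gram psum₁
  rw [sum_add_distrib, sum_cover]

theorem T₂_eq (k : ℕ) (ω : Ω) : S.T₂ k ω = S.psum₂ 1 (k - 1) ω + S.noise₂ k ω := by
  unfold T₂ noisyPsum₂ noise₂ psum₂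
  rw [sum_add_distrib, sum_cover]

theorem noise₁_transpose (k : ℕ) (ω : Ω) : (S.noise₁ k ω)ᵀ = S.noise₁ k ω := by
  ext p q
  simp only [noise₁, Matrix.transpose_apply, Matrix.sum_apply, Matrix.of_apply]
  exact sum_congr rfl fun v _ => by rw [Sym2.eq_swap]

theorem quad_noise₁ (k : ℕ) (ω : Ω) (y : Fin n ⊕ Fin d → ℝ) :
    quad (S.noise₁ k ω) y = ∑ j ∈ cover (k - 1) ×ˢ (univ : Finset (Sym2 (Fin n ⊕ Fin d))),
      (∑ p : (Fin n ⊕ Fin d) × (Fin n ⊕ Fin d) with s(p.1, p.2) = j.2, y p.1 * y p.2)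
        * S.g (j.1, Sum.inl j.2) ω := by
  have h1 : quad (S.noise₁ k ω) y = ∑ v ∈ cover (k - 1),
      ∑ p : (Fin n ⊕ Fin d) × (Fin n ⊕ Fin d), y p.1 * y p.2 * S.g (v, Sum.inl s(p.1, p.2)) ω := by
    rw [noise₁, quad, Matrix.sum_mulVec, dotProduct_sum]
    refine sum_congr rfl fun v _ => ?_
    rw [Fintype.sum_prod_type]
    simp only [dotProduct, Matrix.mulVec, Matrix.of_apply, mul_sum]
    exact sum_congr rfl fun p _ => sum_congr rfl fun q _ => by ring
  rw [h1, sum_product]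
  refine sum_congr rfl fun v _ => ?_
  rw [← sum_fiberwise (g := fun p : (Fin n ⊕ Fin d) × (Fin n ⊕ Fin d) => s(p.1, p.2))]
  refine sum_congr rfl fun s _ => ?_
  rw [sum_mul]
  exact sum_congr rfl fun p hp => by rw [(mem_filter.1 hp).2]

theorem sum_sq_noise₂_mul (k : ℕ) (ω : Ω) (y : (Fin n ⊕ Fin d) × Fin n → ℝ) :
    ∑ e, y e * S.noise₂ k ω e.1 e.2
      = ∑ j ∈ cover (k - 1) ×ˢ (univ : Finset ((Fin n ⊕ Fin d) × Fin n)),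
        y j.2 * S.g (j.1, Sum.inr j.2) ω := by
  rw [sum_product_right]
  refine sum_congr rfl fun e _ => ?_
  rw [noise₂, Matrix.sum_apply, mul_sum]
  rfl

theorem var₁_pos (hK : 2 ≤ S.K) (hH : 1 ≤ S.H) (hκ : 0 < S.κ) (hγ : 0 ≤ S.γ) (hε : 0 < S.ε)
    (hδ : 0 < S.δ) (hδ1 : S.δ ≤ 1) : 0 < S.var₁ := by
  have hm : (0 : ℝ) < S.m := by exact_mod_cast Nat.clog_pos one_lt_two hK
  have hH' : (0 : ℝ) < S.H := by exact_mod_cast hH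
  have hl : 0 < Real.log (2 / S.δ) := Real.log_pos (by rw [lt_div_iff₀ hδ]; linarith)
  unfold var₁
  positivity

theorem var₂_pos (hK : 2 ≤ S.K) (hH : 1 ≤ S.H) (hκ : 0 < S.κ) (hγ : 0 ≤ S.γ) (hε : 0 < S.ε)
    (hδ : 0 < S.δ) (hδ1 : S.δ ≤ 1) : 0 < S.var₂ := by
  have hm : (0 : ℝ) < S.m := by exact_mod_cast Nat.clog_pos one_lt_two hK
  have hH' : (0 : ℝ) < S.H := by exact_mod_cast hH
  have hl : 0 < Real.log (2 / S.δ) := Real.log_pos (by rw [lt_div_iff₀ hδ]; linarith)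
  unfold var₂
  positivity

variable [MeasurableSpace Ω] {μ : Measure Ω} [IsProbabilityMeasure μ]

theorem hasSubgaussianMGF_quad_noise₁ {S : Run n d Ω} (hS : S.StochasticModel μ) {k : ℕ}
    (h1 : 1 ≤ k) (hk : k ≤ S.K) {y : Fin n ⊕ Fin d → ℝ} (hy : y ⬝ᵥ y = 1) :
    HasSubgaussianMGF (fun ω => quad (S.noise₁ k ω) y) (2 * S.m * S.var₁.toNNReal) μ := by
  simp only [quad_noise₁]
  refine hasSubgaussianMGF_sum_gaussian
    (g := fun j : (ℕ × ℕ) × Sym2 (Fin n ⊕ Fin d) => S.g (j.1, Sum.inl j.2))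
    (hS.indep_g.precomp (g := fun j : (ℕ × ℕ) × Sym2 (Fin n ⊕ Fin d) =>
      ((j.1, Sum.inl j.2) : NoiseIdx n d)) fun a b h => by
        simp only [Prod.mk.injEq, Sum.inl.injEq] at h
        exact Prod.ext h.1 h.2)
    (fun j => hS.measurable_g _) _ (fun j _ => hS.law_g₁ _ _)
    (fun j => ∑ p : (Fin n ⊕ Fin d) × (Fin n ⊕ Fin d) with s(p.1, p.2) = j.2, y p.1 * y p.2) ?_
  rw [sum_product]
  simp only [sum_const, nsmul_eq_mul]
  have hsq : ∑ s : Sym2 (Fin n ⊕ Fin d),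
      (∑ p : (Fin n ⊕ Fin d) × (Fin n ⊕ Fin d) with s(p.1, p.2) = s, y p.1 * y p.2) ^ 2 ≤ 2 := by
    calc _ ≤ ∑ s : Sym2 (Fin n ⊕ Fin d), ∑ p : (Fin n ⊕ Fin d) × (Fin n ⊕ Fin d)
          with s(p.1, p.2) = s, 2 * (y p.1 * y p.2) ^ 2 := by
          refine sum_le_sum fun s _ => ?_
          refine sq_sum_le_card_mul_sum_sq.trans ?_
          rw [← mul_sum]
          refine mul_le_mul_of_nonneg_right ?_ (sum_nonneg fun _ _ => sq_nonneg _)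
          exact_mod_cast card_fiber_sym2_le s
      _ = ∑ p : (Fin n ⊕ Fin d) × (Fin n ⊕ Fin d), 2 * (y p.1 * y p.2) ^ 2 := sum_fiberwise _ _ _
      _ = 2 * ((y ⬝ᵥ y) * (y ⬝ᵥ y)) := by
          rw [dotProduct, sum_mul_sum, ← mul_sum, Fintype.sum_prod_type]
          congr 1
          exact sum_congr rfl fun p _ => sum_congr rfl fun q _ => by ring
      _ = 2 := by rw [hy]; norm_num
  have hc : ((cover (k - 1)).card : ℝ) ≤ S.m := by exact_mod_cast card_cover_le h1 hk
  push_cast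
  have h0 : (0 : ℝ) ≤ S.var₁.toNNReal := NNReal.coe_nonneg _
  calc _ ≤ (S.var₁.toNNReal : ℝ) * ((S.m : ℝ) * 2) := by gcongr
    _ = _ := by ring

/-- The noise of the first counter has norm at most `Λ`, up to probability `α / (8K)`. -/
theorem measure_exists_lt_abs_quad_noise₁_le {S : Run n d Ω} (hS : S.StochasticModel μ) {k : ℕ}
    (hn : 1 ≤ n) (hK : 2 ≤ S.K) (h1 : 1 ≤ k) (hk : k ≤ S.K) (hv : 0 < S.var₁)
    (hα : 0 < S.α) (hα1 : S.α ≤ 1) :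
    μ {ω | ∃ y, S.lam * (y ⬝ᵥ y) < |quad (S.noise₁ k ω) y|}
      ≤ ENNReal.ofReal (S.α / (8 * S.K)) := by
  have hKr : (2 : ℝ) ≤ S.K := by exact_mod_cast hK
  have hm : (1 : ℝ) ≤ S.m := by exact_mod_cast Nat.clog_pos one_lt_two hK
  set L := Real.log (4 * S.K / S.α) with hL
  have harg : 8 ≤ 4 * S.K / S.α := by rw [le_div_iff₀ hα]; nlinarith
  have hL2 : 2 ≤ L := by
    rw [hL, Real.le_log_iff_exp_le (by linarith)]
    refine le_trans ?_ harg
    have := Real.exp_one_lt_d9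
    have h2 : Real.exp 2 = Real.exp 1 * Real.exp 1 := by rw [← Real.exp_add]; norm_num
    rw [h2]; nlinarith [Real.exp_pos 1]
  set D : ℝ := (n : ℝ) + d with hD
  have hD1 : 1 ≤ D := by
    have : (1 : ℝ) ≤ n := by exact_mod_cast hn
    have : (0 : ℝ) ≤ d := Nat.cast_nonneg d
    linarith
  have hlam0 : 0 ≤ S.lam := by unfold lam; positivity
  have hlam : S.var₁ * S.m * (16 * D + 8 * L) ≤ S.lam ^ 2 := by
    have e1 : (4 * √D + √(8 * L)) ^ 2 = 16 * D + 8 * L + 8 * √D * √(8 * L) := by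
      have a1 := Real.sq_sqrt (show 0 ≤ D by linarith)
      have a2 := Real.sq_sqrt (show 0 ≤ 8 * L by linarith)
      linear_combination 16 * a1 + a2
    have e2 : S.lam ^ 2 = S.var₁ * S.m * (4 * √D + √(8 * L)) ^ 2 := by
      unfold lam
      rw [mul_pow, mul_pow, Real.sq_sqrt hv.le, Real.sq_sqrt (by linarith)]
    rw [e2, e1]
    have : 0 ≤ 8 * √D * √(8 * L) := by positivity
    have h0 : 0 ≤ S.var₁ * S.m := by positivity
    nlinarith
  refine (measure_exists_lt_abs_quad_le (fun ω => S.noise₁_transpose k ω)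
    (fun v hv => hasSubgaussianMGF_quad_noise₁ hS h1 hk hv) hlam0).trans
    (ENNReal.ofReal_le_ofReal ?_)
  have hcard : Fintype.card (Fin n ⊕ Fin d) = n + d := by simp
  rw [hcard]
  have hexp : -(7 / 8 * S.lam) ^ 2 / (2 * ((2 * S.m * S.var₁.toNNReal : ℝ≥0) : ℝ))
      ≤ -(3 * D + 3 / 2 * L) := by
    have hc : ((2 * S.m * S.var₁.toNNReal : ℝ≥0) : ℝ) = 2 * S.m * S.var₁ := by
      push_cast; rw [Real.coe_toNNReal _ hv.le]
    rw [hc, neg_div, neg_le_neg_iff, le_div_iff₀ (by positivity)]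
    have h0 : 0 ≤ S.var₁ * S.m := by positivity
    have h1 : 0 ≤ S.var₁ * S.m * D := by positivity
    have h2 : 0 ≤ S.var₁ * S.m * L := by positivity
    nlinarith
  have h9 : (9 : ℝ) ^ (n + d) ≤ Real.exp (5 / 2 * D) := by
    have h1 : (9 : ℝ) ≤ Real.exp (5 / 2) := by
      have := Real.exp_one_gt_d9
      have h2 : Real.exp (5 / 2) ^ 2 = Real.exp 1 ^ 5 := by
        rw [← Real.exp_nat_mul, ← Real.exp_nat_mul]; norm_num
      have h3 : (9 : ℝ) ^ 2 < Real.exp 1 ^ 5 := lt_of_lt_of_le (by norm_num)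
        (pow_le_pow_left₀ (by norm_num) (show (2.7 : ℝ) ≤ Real.exp 1 by linarith) 5)
      rw [← h2] at h3
      exact (lt_of_pow_lt_pow_left₀ 2 (Real.exp_pos _).le h3).le
    calc (9 : ℝ) ^ (n + d) ≤ Real.exp (5 / 2) ^ (n + d) := by gcongr
      _ = Real.exp (5 / 2 * D) := by
        rw [← Real.exp_nat_mul]; congr 1; rw [hD]; push_cast; ring
  have h4 : (4 : ℝ) ≤ Real.exp (1 / 2 * D + 1 / 2 * L) := by
    have h1 : Real.exp (3 / 2) ≤ Real.exp (1 / 2 * D + 1 / 2 * L) :=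
      Real.exp_le_exp.2 (by linarith)
    refine le_trans ?_ h1
    have := Real.exp_one_gt_d9
    have h2 : Real.exp (3 / 2) ^ 2 = Real.exp 1 ^ 3 := by
      rw [← Real.exp_nat_mul, ← Real.exp_nat_mul]; norm_num
    have h3 : (4 : ℝ) ^ 2 < Real.exp 1 ^ 3 := lt_of_lt_of_le (by norm_num)
      (pow_le_pow_left₀ (by norm_num) (show (2.7 : ℝ) ≤ Real.exp 1 by linarith) 3)
    rw [← h2] at h3
    exact (lt_of_pow_lt_pow_left₀ 2 (Real.exp_pos _).le h3).le
  have hLexp : Real.exp (-L) = S.α / (4 * S.K) := by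
    rw [hL, Real.exp_neg, Real.exp_log (by linarith), inv_div]
  have hprod : 9 ^ (n + d) * (4 * Real.exp (-(3 * D + 3 / 2 * L))) ≤ Real.exp (-L) := by
    calc _ ≤ Real.exp (5 / 2 * D) * (Real.exp (1 / 2 * D + 1 / 2 * L)
          * Real.exp (-(3 * D + 3 / 2 * L))) := by gcongr
      _ = _ := by
        rw [← Real.exp_add, ← Real.exp_add]; congr 1; ring
  have := Real.exp_le_exp.2 hexp
  calc _ ≤ 2 * 9 ^ (n + d) * Real.exp (-(3 * D + 3 / 2 * L)) := by gcongr
    _ ≤ 1 / 2 * Real.exp (-L) := by linarith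
    _ = _ := by rw [hLexp]; field_simp; norm_num

/-- The noise of the second counter, up to probability `α / (4K)`. -/
theorem measure_lt_frobNorm_noise₂_le {S : Run n d Ω} (hS : S.StochasticModel μ) {k : ℕ}
    (hn : 1 ≤ n) (hK : 2 ≤ S.K) (h1 : 1 ≤ k) (hk : k ≤ S.K) (hv : 0 < S.var₂)
    (hα : 0 < S.α) (hα1 : S.α ≤ 1) (hlam : 0 < S.lam) :
    μ {ω | S.nu < frobNorm (S.noise₂ k ω) / √S.lam} ≤ ENNReal.ofReal (S.α / (4 * S.K)) := by
  have hKr : (2 : ℝ) ≤ S.K := by exact_mod_cast hK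
  have hm : (1 : ℝ) ≤ S.m := by exact_mod_cast Nat.clog_pos one_lt_two hK
  set L := Real.log (2 * S.K / S.α) with hL
  have harg : 4 ≤ 2 * S.K / S.α := by rw [le_div_iff₀ hα]; nlinarith
  have hL1 : 1 ≤ L := by
    rw [hL, Real.le_log_iff_exp_le (by linarith)]
    linarith [Real.exp_one_lt_d9]
  set N : ℝ := (n : ℝ) * ((n : ℝ) + d) with hN
  have hN1 : 1 ≤ N := by
    have : (1 : ℝ) ≤ n := by exact_mod_cast hn
    have : (0 : ℝ) ≤ d := Nat.cast_nonneg d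
    nlinarith
  set s : ℝ≥0 := S.m * S.var₂.toNNReal with hs
  have hsr : (s : ℝ) = S.m * S.var₂ := by
    rw [hs]; push_cast; rw [Real.coe_toNNReal _ hv.le]
  have hs0 : (0 : ℝ) < s := by rw [hsr]; positivity
  have hmeas : ∀ e : (Fin n ⊕ Fin d) × Fin n, Measurable fun ω => S.noise₂ k ω e.1 e.2 := by
    intro e
    simp only [noise₂, Matrix.sum_apply, Matrix.of_apply]
    exact Finset.measurable_sum _ fun v _ => hS.measurable_g _
  have hsub : ∀ y : (Fin n ⊕ Fin d) × Fin n → ℝ,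
      ∫⁻ ω, ENNReal.ofReal (Real.exp (∑ e, y e * S.noise₂ k ω e.1 e.2)) ∂μ
        ≤ ENNReal.ofReal (Real.exp (s * (y ⬝ᵥ y) / 2)) := by
    intro y
    have hg := hasSubgaussianMGF_sum_gaussian
      (g := fun j : (ℕ × ℕ) × ((Fin n ⊕ Fin d) × Fin n) => S.g (j.1, Sum.inr j.2))
      (hS.indep_g.precomp (g := fun j : (ℕ × ℕ) × ((Fin n ⊕ Fin d) × Fin n) =>
        ((j.1, Sum.inr j.2) : NoiseIdx n d)) fun a b h => by
          simp only [Prod.mk.injEq, Sum.inr.injEq] at h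
          exact Prod.ext h.1 h.2)
      (fun j => hS.measurable_g _) (v := S.var₂.toNNReal)
      (cover (k - 1) ×ˢ (univ : Finset ((Fin n ⊕ Fin d) × Fin n)))
      (fun j _ => hS.law_g₂ _ _) (fun j => y j.2) (b := s * Real.toNNReal (y ⬝ᵥ y)) (by
        rw [sum_product]
        simp only [sum_const, nsmul_eq_mul]
        have hc : ((cover (k - 1)).card : ℝ) ≤ S.m := by exact_mod_cast card_cover_le h1 hk
        have hyy : ∑ e, y e ^ 2 = y ⬝ᵥ y := by
          rw [dotProduct]; exact sum_congr rfl fun e _ => by ring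
        have := dotProduct_self_nonneg_real y
        push_cast
        rw [hyy, hsr, Real.coe_toNNReal _ this, Real.coe_toNNReal _ hv.le]
        calc S.var₂ * ((cover (k - 1)).card * (y ⬝ᵥ y)) ≤ S.var₂ * (S.m * (y ⬝ᵥ y)) := by gcongr
          _ = _ := by ring)
    have h1 := hg.mgf_le 1
    rw [mgf] at h1
    simp only [one_mul] at h1
    have h2 := hg.integrable_exp_mul 1
    simp only [one_mul] at h2
    simp only [sum_sq_noise₂_mul]
    rw [← ofReal_integral_eq_lintegral_ofReal h2 (ae_of_all _ fun _ => (Real.exp_pos _).le)]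
    refine ENNReal.ofReal_le_ofReal (h1.trans (le_of_eq ?_))
    push_cast
    rw [Real.coe_toNNReal _ (dotProduct_self_nonneg_real y)]
    norm_num
  have htail := measure_lt_sum_sq_le hmeas (by exact_mod_cast hs0.ne') hsub (N / 2 + L + 1)
  have hset : {ω | S.nu < frobNorm (S.noise₂ k ω) / √S.lam}
      ⊆ {ω | 4 * s * (N / 2 + L + 1)
        ≤ ∑ e : (Fin n ⊕ Fin d) × Fin n, S.noise₂ k ω e.1 e.2 ^ 2} := by
    intro ω hω
    have hω' : S.nu < frobNorm (S.noise₂ k ω) / √S.lam := hω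
    rw [lt_div_iff₀ (Real.sqrt_pos.2 hlam)] at hω'
    have hnu : S.nu * √S.lam = √(s : ℝ) * (√(2 * N) + √(4 * L)) := by
      unfold nu
      have : √S.lam ≠ 0 := (Real.sqrt_pos.2 hlam).ne'
      rw [hsr, Real.sqrt_div' _ hlam.le, Real.sqrt_mul (by positivity : (0 : ℝ) ≤ S.m), hN,
        ← mul_assoc 2, ← hL]
      generalize √(2 * (n : ℝ) * ((n : ℝ) + d)) = a
      field_simp
    rw [hnu] at hω'
    have h0 : 0 ≤ √(s : ℝ) * (√(2 * N) + √(4 * L)) := by positivity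
    have h2 := pow_le_pow_left₀ h0 hω'.le 2
    rw [mul_pow, Real.sq_sqrt hs0.le, frobNorm_sq, trace_transpose_mul_self_eq] at h2
    have hcross : 4 ≤ 2 * (√(2 * N) * √(4 * L)) := by
      rw [← Real.sqrt_mul (by positivity)]
      have : 2 ≤ √(2 * N * (4 * L)) := Real.le_sqrt_of_sq_le (by nlinarith)
      linarith
    have a1 := Real.sq_sqrt (show 0 ≤ 2 * N by linarith)
    have a2 := Real.sq_sqrt (show 0 ≤ 4 * L by linarith)
    have e1 : 4 * (N / 2 + L + 1) ≤ (√(2 * N) + √(4 * L)) ^ 2 := by nlinarith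
    change 4 * s * (N / 2 + L + 1) ≤ _
    have e2 : ∑ e : (Fin n ⊕ Fin d) × Fin n, S.noise₂ k ω e.1 e.2 ^ 2
        = ∑ j, (fun i => S.noise₂ k ω i j) ⬝ᵥ (fun i => S.noise₂ k ω i j) := by
      rw [Fintype.sum_prod_type_right]
      refine sum_congr rfl fun j _ => ?_
      rw [dotProduct]
      exact sum_congr rfl fun i _ => by ring
    rw [e2]
    refine le_trans ?_ h2
    nlinarith
  refine (measure_mono hset).trans (htail.trans (ENNReal.ofReal_le_ofReal ?_))
  have hcard : (Fintype.card ((Fin n ⊕ Fin d) × Fin n) : ℝ) = N := by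
    simp [hN, mul_comm]
  have h2 : √2 ≤ Real.exp (1 / 2) := by
    have h3 : Real.exp (1 / 2) = √(Real.exp 1) := by rw [← Real.exp_half]
    rw [h3]
    exact Real.sqrt_le_sqrt (by linarith [Real.exp_one_gt_d9])
  have h3 : √2 ^ Fintype.card ((Fin n ⊕ Fin d) × Fin n) ≤ Real.exp (N / 2) := by
    calc _ ≤ Real.exp (1 / 2) ^ Fintype.card ((Fin n ⊕ Fin d) × Fin n) := by gcongr
      _ = _ := by rw [← Real.exp_nat_mul, hcard]; congr 1; ring
  have hLexp : Real.exp (-L) = S.α / (2 * S.K) := by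
    rw [hL, Real.exp_neg, Real.exp_log (by linarith), inv_div]
  have he : Real.exp (-1) ≤ 1 / 2 := by
    rw [Real.exp_neg, one_div]
    exact inv_anti₀ (by norm_num) (by linarith [Real.exp_one_gt_d9])
  calc _ ≤ Real.exp (N / 2) * Real.exp (-(N / 2 + L + 1)) := by gcongr
    _ = Real.exp (-L) * Real.exp (-1) := by
      rw [← Real.exp_add, ← Real.exp_add]; congr 1; ring
    _ ≤ Real.exp (-L) * (1 / 2) := by gcongr
    _ = _ := by rw [hLexp]; field_simp; norm_num

end Run

end PrivacyNoise

end PrivateLQ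

namespace PrivateLQ

/-! ### Measurability of matrix operations -/

section MatrixMeasurability

variable {α ι κ τ : Type*} {mα : MeasurableSpace α} [Fintype ι] [Fintype κ] [Fintype τ]

theorem measurable_matrix_mul {A : α → Matrix ι κ ℝ} {B : α → Matrix κ τ ℝ}
    (hA : ∀ i j, Measurable fun ω => A ω i j) (hB : ∀ i j, Measurable fun ω => B ω i j) (i : ι)
    (j : τ) : Measurable fun ω => (A ω * B ω) i j := by
  simp only [Matrix.mul_apply]
  exact Finset.measurable_sum _ fun l _ => (hA i l).mul (hB l j)

theorem measurable_det [DecidableEq ι] {A : α → Matrix ι ι ℝ}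
    (hA : ∀ i j, Measurable fun ω => A ω i j) : Measurable fun ω => (A ω).det := by
  simp only [Matrix.det_apply]
  refine Finset.measurable_sum _ fun σ _ => ?_
  exact (Finset.measurable_prod _ fun i _ => hA _ _).const_smul _

theorem measurable_matrix_inv [DecidableEq ι] {A : α → Matrix ι ι ℝ}
    (hA : ∀ i j, Measurable fun ω => A ω i j) (i j : ι) : Measurable fun ω => (A ω)⁻¹ i j := by
  simp only [Matrix.inv_def, Matrix.smul_apply, Ring.inverse_eq_inv', smul_eq_mul,
    Matrix.adjugate_apply]
  refine (measurable_det hA).inv.mul (measurable_det fun p q => ?_)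
  by_cases h : p = j
  · subst h; simp
  · simpa [Matrix.updateRow_ne h] using hA p q

theorem measurable_quad {A : α → Matrix ι ι ℝ} {v : α → ι → ℝ}
    (hA : ∀ i j, Measurable fun ω => A ω i j) (hv : Measurable v) :
    Measurable fun ω => quad (A ω) (v ω) := measurable_dotProduct hv (measurable_mulVec hA hv)

end MatrixMeasurability

/-! ### From sums to their conditional expectations -/

section Multiplicative

variable {Ω E : Type*} {mΩ : MeasurableSpace Ω} {mE : MeasurableSpace E} {μ : Measure Ω}

theorem exp_neg_le_one_sub_half {x : ℝ} (h0 : 0 ≤ x) (h1 : x ≤ 1) :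
    Real.exp (-x) ≤ 1 - x / 2 := by
  have h := Real.add_one_le_exp x
  rw [Real.exp_neg, inv_le_comm₀ (Real.exp_pos _) (by linarith)]
  refine le_trans ?_ h
  rw [inv_le_iff_one_le_mul₀ (by linarith)]
  nlinarith

theorem lintegral_exp_integral_sub_le {ν : Measure E} [IsProbabilityMeasure ν] {f : E → ℝ} {b : ℝ}
    (hb : 0 < b) (hf : Measurable f) (hfb : ∀ᵐ e ∂ν, f e ∈ Set.Icc 0 b) :
    ∫⁻ e, ENNReal.ofReal (Real.exp ((∫ e', f e' ∂ν) / (2 * b) - f e / b)) ∂ν ≤ 1 := by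
  set y := (∫ e', f e' ∂ν) / (2 * b) with hy
  have hint : Integrable f ν := Integrable.of_bound (C := b) hf.aestronglyMeasurable (by
    filter_upwards [hfb] with e he
    rw [Real.norm_eq_abs, abs_of_nonneg he.1]; exact he.2)
  have h1 : ∀ᵐ e ∂ν, Real.exp (y - f e / b) ≤ Real.exp y * (1 - f e / (2 * b)) := by
    filter_upwards [hfb] with e he
    have h2 := exp_neg_le_one_sub_half (x := f e / b) (div_nonneg he.1 hb.le)
      ((div_le_one hb).2 he.2)
    rw [sub_eq_add_neg, Real.exp_add]
    refine mul_le_mul_of_nonneg_left (h2.trans (le_of_eq ?_)) (Real.exp_pos _).le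
    field_simp
  have hi2 : Integrable (fun e => Real.exp y * (1 - f e / (2 * b))) ν :=
    ((integrable_const 1).sub (hint.div_const _)).const_mul _
  calc _ ≤ ∫⁻ e, ENNReal.ofReal (Real.exp y * (1 - f e / (2 * b))) ∂ν :=
        lintegral_mono_ae (by filter_upwards [h1] with e he using ENNReal.ofReal_le_ofReal he)
    _ = ENNReal.ofReal (∫ e, Real.exp y * (1 - f e / (2 * b)) ∂ν) := by
        rw [ofReal_integral_eq_lintegral_ofReal hi2]
        filter_upwards [h1] with e he using (Real.exp_pos _).le.trans he
    _ = ENNReal.ofReal (Real.exp y * (1 - y)) := by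
        rw [integral_const_mul, integral_sub (integrable_const _) (hint.div_const _),
          integral_div]
        simp [hy]
    _ ≤ 1 := by
        rw [← ENNReal.ofReal_one]
        apply ENNReal.ofReal_le_ofReal
        have h3 := Real.add_one_le_exp (-y)
        calc Real.exp y * (1 - y) ≤ Real.exp y * Real.exp (-y) := by
              gcongr; linarith
          _ = 1 := by rw [← Real.exp_add]; simp

/-- The sum of the conditional expectations of nonnegative bounded variables is at most twice the sum
of the variables, up to a logarithmic term. -/
theorem measure_two_mul_sum_lt_sum_integral_le [IsProbabilityMeasure μ] {ℱ : ℕ → MeasurableSpace Ω}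
    (hmono : Monotone ℱ) (hle : ∀ t, ℱ t ≤ mΩ) {X : ℕ → Ω × E → ℝ} {W : ℕ → Ω → E}
    (hX : ∀ t, Measurable[(ℱ t).prod mE] (X t)) (hW : ∀ t, Measurable[ℱ (t + 1)] (W t)) {N : ℕ}
    (hind : ∀ t < N, Indep (MeasurableSpace.comap (W t) mE) (ℱ t) μ) {b : ℝ} (hb : 0 < b)
    (hXb : ∀ t < N, ∀ᵐ ω ∂μ, ∀ᵐ e ∂(μ.map (W t)), X t (ω, e) ∈ Set.Icc 0 b) {p : ℝ} (hp : 0 < p) :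
    μ {ω | 2 * ∑ t ∈ range N, X t (ω, W t ω) + 2 * b * Real.log (1 / p)
        < ∑ t ∈ range N, ∫ e, X t (ω, e) ∂(μ.map (W t))} ≤ ENNReal.ofReal p := by
  have hWm : ∀ t, Measurable (W t) := fun t => (hW t).mono (hle _) le_rfl
  have hprob : ∀ t, IsProbabilityMeasure (μ.map (W t)) := fun t =>
    Measure.isProbabilityMeasure_map (hWm t).aemeasurable
  set Y : ℕ → Ω × E → ℝ := fun t q =>
    (∫ e, X t (q.1, e) ∂(μ.map (W t))) / (2 * b) - X t q / b with hY
  have hYm : ∀ t, Measurable[(ℱ t).prod mE] (Y t) := by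
    intro t
    have hXt := hX t
    simp only [hY]
    have := hprob t
    generalize μ.map (W t) = ν at this ⊢
    let _ : MeasurableSpace Ω := ℱ t
    have h1 : Measurable fun ω => ∫ e, X t (ω, e) ∂ν :=
      (hXt.stronglyMeasurable.integral_prod_right' (ν := ν)).measurable
    exact ((h1.comp measurable_fst).div_const _).sub (hXt.div_const _)
  have h := measure_exists_le_sum_exp hmono hle hYm hW hind (fun t ht => ?_) hp
  · refine (measure_mono ?_).trans h
    intro ω hω
    refine ⟨N, le_rfl, ?_⟩
    have hω' : 2 * ∑ t ∈ range N, X t (ω, W t ω) + 2 * b * Real.log (1 / p)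
        < ∑ t ∈ range N, ∫ e, X t (ω, e) ∂(μ.map (W t)) := hω
    simp only [hY]
    rw [sum_sub_distrib, ← sum_div, ← sum_div, le_sub_iff_add_le, le_div_iff₀ (by positivity),
      add_mul]
    have : (∑ t ∈ range N, X t (ω, W t ω)) / b * (2 * b) = 2 * ∑ t ∈ range N, X t (ω, W t ω) := by
      field_simp
    linarith
  · filter_upwards [hXb t ht] with ω hω
    have hm : Measurable fun e => X t (ω, e) :=
      (hX t).comp (@measurable_prodMk_left Ω E (ℱ t) mE ω)
    exact lintegral_exp_integral_sub_le hb hm hω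

end Multiplicative

/-! ### A self-normalized bound for bounded noise -/

section SelfNormalized

variable {ι κ : Type*} [Fintype ι] [Fintype κ] [DecidableEq ι]

/-- The regularized Gram matrix `Λ I + ∑_{s < t} z_s z_sᵀ`. -/
noncomputable def regGram (Λ : ℝ) (z : ℕ → ι → ℝ) (t : ℕ) : Matrix ι ι ℝ :=
  Λ • (1 : Matrix ι ι ℝ) + ∑ s ∈ range t, Matrix.vecMulVec (z s) (z s)

/-- The noise term `∑_{s < t} z_s w_sᵀ`. -/
noncomputable def crossSum (z : ℕ → ι → ℝ) (w : ℕ → κ → ℝ) (t : ℕ) : Matrix ι κ ℝ :=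
  ∑ s ∈ range t, Matrix.vecMulVec (z s) (w s)

theorem quad_sum_vecMulVec {τ : Type*} (T : Finset τ) (z : τ → ι → ℝ) (v : ι → ℝ) :
    quad (∑ s ∈ T, Matrix.vecMulVec (z s) (z s)) v = ∑ s ∈ T, (z s ⬝ᵥ v) ^ 2 := by
  rw [quad, Matrix.sum_mulVec, dotProduct_sum]
  exact sum_congr rfl fun s _ => quad_vecMulVec (z s) v

theorem transpose_sum_vecMulVec {τ : Type*} (T : Finset τ) (z : τ → ι → ℝ) :
    (∑ s ∈ T, Matrix.vecMulVec (z s) (z s))ᵀ = ∑ s ∈ T, Matrix.vecMulVec (z s) (z s) := by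
  rw [Matrix.transpose_sum]
  exact sum_congr rfl fun s _ => Matrix.transpose_vecMulVec _ _

theorem posDef_smul_one_add {Λ : ℝ} (hΛ : 0 < Λ) {S : Matrix ι ι ℝ} (hS : Sᵀ = S)
    (h0 : ∀ v, 0 ≤ quad S v) : (Λ • (1 : Matrix ι ι ℝ) + S).PosDef := by
  refine posDef_of_quad (by simp [hS]) fun v hv => ?_
  rw [quad_add_left, quad_smul_left, quad_one]
  have h1 : 0 < v ⬝ᵥ v := lt_of_le_of_ne (dotProduct_self_nonneg_real v) fun h =>
    hv (dotProduct_self_eq_zero.1 h.symm)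
  have := mul_pos hΛ h1
  linarith [h0 v]

theorem posDef_regGram {Λ : ℝ} (hΛ : 0 < Λ) (z : ℕ → ι → ℝ) (t : ℕ) : (regGram Λ z t).PosDef :=
  posDef_smul_one_add hΛ (transpose_sum_vecMulVec _ _) fun v => by
    rw [quad_sum_vecMulVec]; exact sum_nonneg fun _ _ => sq_nonneg _

theorem regGram_succ (Λ : ℝ) (z : ℕ → ι → ℝ) (t : ℕ) :
    regGram Λ z (t + 1) = regGram Λ z t + Matrix.vecMulVec (z t) (z t) := by
  rw [regGram, regGram, sum_range_succ, add_assoc]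

theorem det_smul_one_add {Λ : ℝ} (hΛ : 0 < Λ) (S : Matrix ι ι ℝ) :
    (Λ • (1 : Matrix ι ι ℝ) + S).det = Λ ^ Fintype.card ι * (1 + Λ⁻¹ • S).det := by
  rw [← Matrix.det_smul, smul_add, smul_smul, mul_inv_cancel₀ hΛ.ne', one_smul]

/-- The logarithmic determinant dominates the sum of the logarithms of `1 + ‖z_s‖²`, measured in the
inverse of the Gram matrix before `z_s`. -/
theorem sum_log_one_add_le {Λ : ℝ} (hΛ : 0 < Λ) (z : ℕ → ι → ℝ) (t : ℕ) :
    ∑ s ∈ range t, Real.log (1 + quad (regGram Λ z s)⁻¹ (z s))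
      ≤ Real.log (1 + Λ⁻¹ • ∑ s ∈ range t, Matrix.vecMulVec (z s) (z s)).det := by
  have hpos : ∀ t, 0 < (1 + Λ⁻¹ • ∑ s ∈ range t, Matrix.vecMulVec (z s) (z s)).det := fun t => by
    have h := (posDef_regGram hΛ z t).det_pos
    rw [regGram, det_smul_one_add hΛ] at h
    exact pos_of_mul_pos_right h (by positivity)
  induction t with
  | zero => simp
  | succ t ih =>
    rw [sum_range_succ]
    have ha : 0 ≤ quad (regGram Λ z t)⁻¹ (z t) :=
      quad_nonneg_of_posDef (posDef_regGram hΛ z t).inv _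
    have h := det_mul_one_add_trace_le (posDef_regGram hΛ z t) (S := Matrix.vecMulVec (z t) (z t))
      (Matrix.transpose_vecMulVec _ _) fun v => by rw [quad_vecMulVec]; positivity
    rw [trace_mul_vecMulVec, ← regGram_succ] at h
    nth_rewrite 1 [regGram] at h
    nth_rewrite 2 [regGram] at h
    rw [det_smul_one_add hΛ, det_smul_one_add hΛ, mul_assoc] at h
    have h2 := le_of_mul_le_mul_left h (by positivity)
    have h3 := Real.log_le_log (mul_pos (hpos t) (by linarith)) h2
    rw [Real.log_mul (hpos t).ne' (by linarith)] at h3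
    linarith

/-- Pathwise expansion of the self-normalized sum. -/
theorem colQuad_inv_regGram_crossSum_le {Λ : ℝ} (hΛ : 0 < Λ) (z : ℕ → ι → ℝ) (w : ℕ → κ → ℝ)
    (t : ℕ) :
    colQuad (regGram Λ z t)⁻¹ (crossSum z w t)
      ≤ ∑ s ∈ range t, (2 * (((crossSum z w s)ᵀ *ᵥ ((regGram Λ z s)⁻¹ *ᵥ z s)) ⬝ᵥ w s)
          + quad (regGram Λ z s)⁻¹ (z s) * (w s ⬝ᵥ w s)
          - ((crossSum z w s)ᵀ *ᵥ ((regGram Λ z s)⁻¹ *ᵥ z s))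
            ⬝ᵥ ((crossSum z w s)ᵀ *ᵥ ((regGram Λ z s)⁻¹ *ᵥ z s)))
        / (1 + quad (regGram Λ z s)⁻¹ (z s)) := by
  induction t with
  | zero => simp [crossSum, colQuad, show (fun _ : ι => (0 : ℝ)) = 0 from rfl]
  | succ t ih =>
    rw [sum_range_succ]
    refine le_trans ?_ (add_le_add_left ih _)
    have hcol : ∀ j, (fun i => crossSum z w (t + 1) i j)
        = (fun i => crossSum z w t i j) + w t j • z t := fun j => by
      ext i
      rw [crossSum, sum_range_succ, ← crossSum]
      simp [Matrix.vecMulVec_apply, mul_comm]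
    unfold colQuad
    simp only [hcol]
    refine (sum_le_sum fun j _ => quad_inv_rank_one_le (posDef_regGram hΛ z t)
      (regGram_succ Λ z t) (posDef_regGram hΛ z (t + 1)) _ _).trans (le_of_eq ?_)
    rw [sum_add_distrib, ← sum_div, sum_sub_distrib, sum_add_distrib, ← mul_sum, ← mul_sum]
    simp only [dotProduct, Matrix.mulVec, Matrix.transpose_apply, pow_two]

/-- One step of the exponential supermartingale: the quadratic part of the exponent is absorbed by
`log (1 + a) ≥ a / (1 + a)`, the linear part by Hoeffding's lemma. -/
theorem lintegral_exp_self_normalized_le {ν : Measure (κ → ℝ)} [IsProbabilityMeasure ν] {c : ℝ}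
    (hc : 0 < c) (hnorm : ∀ᵐ e ∂ν, euclNorm e ≤ c) (hmean : ∀ i, ∫ e, e i ∂ν = 0) {a : ℝ}
    (ha : 0 ≤ a) (b : κ → ℝ) :
    ∫⁻ e, ENNReal.ofReal (Real.exp ((2 * (b ⬝ᵥ e) + a * (e ⬝ᵥ e) - b ⬝ᵥ b) / (1 + a) / (2 * c ^ 2)
      - 1 / 2 * Real.log (1 + a))) ∂ν ≤ 1 := by
  have hi : ∀ i, Integrable (fun e : κ → ℝ => e i) ν := fun i =>
    Integrable.of_bound (C := c) (measurable_pi_apply i).aestronglyMeasurable (by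
      filter_upwards [hnorm] with e he
      exact (abs_apply_le_euclNorm e i).trans he)
  have hbm : Measurable fun e : κ → ℝ => b ⬝ᵥ e := measurable_dotProduct measurable_const measurable_id
  have hbe : ∀ᵐ e ∂ν, b ⬝ᵥ e ∈ Set.Icc (-(euclNorm b * c)) (euclNorm b * c) := by
    filter_upwards [hnorm] with e he
    rw [Set.mem_Icc, ← abs_le]
    exact (abs_dotProduct_le b e).trans (mul_le_mul_of_nonneg_left he (euclNorm_nonneg b))
  have hb0 : ∫ e, b ⬝ᵥ e ∂ν = 0 := by
    unfold dotProduct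
    rw [integral_finsetSum _ fun i _ => (hi i).const_mul (b i)]
    exact sum_eq_zero fun i _ => by rw [integral_const_mul, hmean, mul_zero]
  have hsub := hasSubgaussianMGF_of_mem_Icc_of_integral_eq_zero hbm.aemeasurable hbe hb0
  set r : ℝ := 1 / (c ^ 2 * (1 + a)) with hr
  have h1 : ∀ᵐ e ∂ν, Real.exp ((2 * (b ⬝ᵥ e) + a * (e ⬝ᵥ e) - b ⬝ᵥ b) / (1 + a) / (2 * c ^ 2)
      - 1 / 2 * Real.log (1 + a))
      ≤ Real.exp (-(b ⬝ᵥ b) * r / 2) * Real.exp (r * (b ⬝ᵥ e)) := by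
    filter_upwards [hnorm] with e he
    rw [← Real.exp_add]
    apply Real.exp_le_exp.2
    have h2 : e ⬝ᵥ e ≤ c ^ 2 := by
      rw [← euclNorm_sq]; exact pow_le_pow_left₀ (euclNorm_nonneg _) he 2
    have h3 : a / (1 + a) ≤ Real.log (1 + a) := by
      have := Real.one_sub_inv_le_log_of_pos (show 0 < 1 + a by linarith)
      refine le_trans (le_of_eq ?_) this
      field_simp; ring
    have h4 : a * (e ⬝ᵥ e) * (r / 2) ≤ 1 / 2 * (a / (1 + a)) := by
      calc a * (e ⬝ᵥ e) * (r / 2) ≤ a * c ^ 2 * (r / 2) := by gcongr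
        _ = _ := by rw [hr]; field_simp
    have h5 : (2 * (b ⬝ᵥ e) + a * (e ⬝ᵥ e) - b ⬝ᵥ b) / (1 + a) / (2 * c ^ 2)
        = r * (b ⬝ᵥ e) + a * (e ⬝ᵥ e) * (r / 2) - (b ⬝ᵥ b) * r / 2 := by
      rw [hr]; field_simp
    rw [h5]
    linarith
  calc _ ≤ ∫⁻ e, ENNReal.ofReal (Real.exp (-(b ⬝ᵥ b) * r / 2) * Real.exp (r * (b ⬝ᵥ e))) ∂ν :=
        lintegral_mono_ae (by filter_upwards [h1] with e he using ENNReal.ofReal_le_ofReal he)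
    _ = ENNReal.ofReal (∫ e, Real.exp (-(b ⬝ᵥ b) * r / 2) * Real.exp (r * (b ⬝ᵥ e)) ∂ν) := by
        rw [ofReal_integral_eq_lintegral_ofReal ((hsub.integrable_exp_mul r).const_mul _)]
        exact ae_of_all _ fun e => by positivity
    _ ≤ 1 := by
        rw [integral_const_mul, ← ENNReal.ofReal_one]
        apply ENNReal.ofReal_le_ofReal
        have h2 := hsub.mgf_le r
        rw [mgf] at h2
        calc _ ≤ Real.exp (-(b ⬝ᵥ b) * r / 2) * _ := mul_le_mul_of_nonneg_left h2 (Real.exp_pos _).le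
          _ ≤ 1 := by
            rw [← Real.exp_add, Real.exp_le_one_iff]
            have h6 : euclNorm b * c - -(euclNorm b * c) = 2 * (euclNorm b * c) := by ring
            have h7 : 0 ≤ euclNorm b * c := mul_nonneg (euclNorm_nonneg b) hc.le
            push_cast
            rw [h6, Real.norm_eq_abs, abs_of_nonneg (by linarith),
              mul_div_cancel_left₀ _ (two_ne_zero), mul_pow, euclNorm_sq]
            have h8 : c ^ 2 * r ≤ 1 := by
              rw [hr, mul_one_div, div_le_one (by positivity)]
              nlinarith [sq_nonneg c]
            have h9 : 0 ≤ (b ⬝ᵥ b) * r := mul_nonneg (dotProduct_self_nonneg_real b) (by positivity)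
            nlinarith

variable {Ω : Type*} {mΩ : MeasurableSpace Ω} {μ : Measure Ω}

theorem measurable_regGram {m : MeasurableSpace Ω} (Λ : ℝ) {z : ℕ → Ω → ι → ℝ} {t : ℕ}
    (hz : ∀ s < t, Measurable[m] (z s)) (i j : ι) :
    Measurable[m] fun ω => regGram Λ (fun s => z s ω) t i j := by
  simp only [regGram, Matrix.add_apply, Matrix.sum_apply, Matrix.vecMulVec_apply]
  refine measurable_const.add (Finset.measurable_sum _ fun s hs => ?_)
  have h := hz s (Finset.mem_range.1 hs)
  exact (measurable_pi_iff.1 h i).mul (measurable_pi_iff.1 h j)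

theorem measurable_crossSum {m : MeasurableSpace Ω} {z : ℕ → Ω → ι → ℝ} {w : ℕ → Ω → κ → ℝ} {t : ℕ}
    (hz : ∀ s < t, Measurable[m] (z s)) (hw : ∀ s < t, Measurable[m] (w s)) (i : ι) (j : κ) :
    Measurable[m] fun ω => crossSum (fun s => z s ω) (fun s => w s ω) t i j := by
  simp only [crossSum, Matrix.sum_apply, Matrix.vecMulVec_apply]
  refine Finset.measurable_sum _ fun s hs => ?_
  exact (measurable_pi_iff.1 (hz s (Finset.mem_range.1 hs)) i).mul
    (measurable_pi_iff.1 (hw s (Finset.mem_range.1 hs)) j)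

/-- The self-normalized bound, uniformly in time. -/
theorem measure_exists_lt_colQuad_le [IsProbabilityMeasure μ] {ℱ : ℕ → MeasurableSpace Ω}
    (hmono : Monotone ℱ) (hle : ∀ t, ℱ t ≤ mΩ) {z : ℕ → Ω → ι → ℝ} {w : ℕ → Ω → κ → ℝ}
    (hz : ∀ t, Measurable[ℱ t] (z t)) (hw : ∀ t, Measurable[ℱ (t + 1)] (w t)) {N : ℕ}
    (hind : ∀ t < N, Indep (MeasurableSpace.comap (w t) inferInstance) (ℱ t) μ) {c : ℝ}
    (hc : 0 ≤ c) (hnorm : ∀ t < N, ∀ᵐ ω ∂μ, euclNorm (w t ω) ≤ c)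
    (hmean : ∀ t < N, ∀ i, ∫ ω, w t ω i ∂μ = 0) {Λ : ℝ} (hΛ : 0 < Λ) {p : ℝ} (hp : 0 < p) :
    μ {ω | ∃ t ≤ N, c ^ 2 * (2 * Real.log (1 / p) + Real.log (1 + Λ⁻¹ •
          ∑ s ∈ range t, Matrix.vecMulVec (z s ω) (z s ω)).det)
        < colQuad (regGram Λ (fun s => z s ω) t)⁻¹ (crossSum (fun s => z s ω) (fun s => w s ω) t)}
      ≤ ENNReal.ofReal p := by
  rcases hc.eq_or_lt with rfl | hc
  -- for `c = 0` the noise vanishes almost surely, and so does the self-normalized sum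
  · have hae : ∀ᵐ ω ∂μ, ∀ t < N, w t ω = 0 := by
      rw [ae_all_iff]; intro t
      by_cases ht : t < N
      · filter_upwards [hnorm t ht] with ω hω _
        have h1 := le_antisymm hω (euclNorm_nonneg _)
        have h2 := euclNorm_sq (w t ω)
        rw [h1] at h2
        exact dotProduct_self_eq_zero.1 (by linarith)
      · exact ae_of_all _ fun ω h => absurd h ht
    refine le_of_eq_of_le ?_ (zero_le (a := ENNReal.ofReal p))
    refine measure_mono_null ?_ (ae_iff.1 hae)
    rintro ω ⟨t, ht, h⟩ h0
    have h2 : crossSum (fun s => z s ω) (fun s => w s ω) t = 0 :=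
      sum_eq_zero fun s hs => by
        have hs0 : w s ω = 0 := h0 s (by have := mem_range.1 hs; omega)
        ext i j
        simp [Matrix.vecMulVec_apply, hs0]
    rw [h2] at h
    simp [colQuad, show (fun _ : ι => (0 : ℝ)) = 0 from rfl] at h
  · have hwm : ∀ t, Measurable (w t) := fun t => (hw t).mono (hle _) le_rfl
    set G : ℕ → Ω → Matrix ι ι ℝ := fun t ω => regGram Λ (fun s => z s ω) t with hG
    set a : ℕ → Ω → ℝ := fun t ω => quad (G t ω)⁻¹ (z t ω) with ha
    set b : ℕ → Ω → κ → ℝ := fun t ω =>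
      (crossSum (fun s => z s ω) (fun s => w s ω) t)ᵀ *ᵥ ((G t ω)⁻¹ *ᵥ z t ω) with hb
    have hGm : ∀ t i j, Measurable[ℱ t] fun ω => G t ω i j := fun t i j =>
      measurable_regGram (m := ℱ t) Λ (fun s hs => (hz s).mono (hmono hs.le) le_rfl) i j
    have ham : ∀ t, Measurable[ℱ t] (a t) := fun t =>
      measurable_quad (mα := ℱ t) (measurable_matrix_inv (mα := ℱ t) (hGm t)) (hz t)
    have hbm : ∀ t, Measurable[ℱ t] (b t) := fun t =>
      measurable_mulVec (mΩ := ℱ t) (fun i j => measurable_crossSum (m := ℱ t)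
          (fun s hs => (hz s).mono (hmono hs.le) le_rfl)
          (fun s hs => (hw s).mono (hmono hs) le_rfl) j i)
        (measurable_mulVec (mΩ := ℱ t) (measurable_matrix_inv (mα := ℱ t) (hGm t)) (hz t))
    have ha0 : ∀ t ω, 0 ≤ a t ω := fun t ω =>
      quad_nonneg_of_posDef (posDef_regGram hΛ _ t).inv _
    -- the exponent of step `t`: the increment of the self-normalized sum minus that of the determinant
    set X : ℕ → Ω × (κ → ℝ) → ℝ := fun t q =>
      (2 * (b t q.1 ⬝ᵥ q.2) + a t q.1 * (q.2 ⬝ᵥ q.2) - b t q.1 ⬝ᵥ b t q.1) / (1 + a t q.1)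
        / (2 * c ^ 2) - 1 / 2 * Real.log (1 + a t q.1) with hX
    have hXm : ∀ t, Measurable[(ℱ t).prod inferInstance] (X t) := by
      intro t
      let _ : MeasurableSpace Ω := ℱ t
      have h1 : Measurable fun q : Ω × (κ → ℝ) => a t q.1 := (ham t).comp measurable_fst
      have h2 : Measurable fun q : Ω × (κ → ℝ) => b t q.1 := (hbm t).comp measurable_fst
      have h0 : Measurable fun q : Ω × (κ → ℝ) => q.2 := measurable_snd
      have h3 := measurable_dotProduct h2 h0
      have h4 := measurable_dotProduct h0 h0
      have h5 := measurable_dotProduct h2 h2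
      exact (((((h3.const_mul 2).add (h1.mul h4)).sub h5).div (h1.const_add 1)).div_const _).sub
        ((Real.measurable_log.comp (h1.const_add 1)).const_mul _)
    have h := measure_exists_le_sum_exp hmono hle hXm hw hind (fun t ht => ?_) hp
    · refine (measure_mono ?_).trans h
      rintro ω ⟨t, ht, hlt⟩
      refine ⟨t, ht, ?_⟩
      have h1 := colQuad_inv_regGram_crossSum_le hΛ (fun s => z s ω) (fun s => w s ω) t
      have h2 := sum_log_one_add_le hΛ (fun s => z s ω) t
      have h3 := hlt.trans_le h1
      simp only [hX, sum_sub_distrib, ← sum_div, ← mul_sum]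
      rw [le_sub_iff_add_le, le_div_iff₀ (by positivity)]
      refine le_trans ?_ h3.le
      have h4 : 0 ≤ c ^ 2 := sq_nonneg c
      simp only [ha, hG]
      nlinarith
    · refine ae_of_all _ fun ω => ?_
      have : IsProbabilityMeasure (μ.map (w t)) :=
        Measure.isProbabilityMeasure_map (hwm t).aemeasurable
      refine lintegral_exp_self_normalized_le hc ?_ (fun i => ?_) (ha0 t ω) (b t ω)
      · rw [ae_map_iff (hwm t).aemeasurable
          (measurableSet_le (f := fun e : κ → ℝ => euclNorm e) (measurable_euclNorm measurable_id)
            measurable_const)]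
        exact hnorm t ht
      · rw [integral_map (hwm t).aemeasurable (measurable_pi_apply i).aestronglyMeasurable]
        exact hmean t ht i

end SelfNormalized

end PrivateLQ

namespace PrivateLQ

/-! ### Measurability along a run -/

section RunMeasurability

variable {n d : ℕ}

section Policy

variable {α : Type*} {mα : MeasurableSpace α} {Θ : α → Param n d}

theorem measurable_Amat (hΘ : ∀ p q, Measurable fun a => Θ a p q) (i j : Fin n) :
    Measurable fun a => Amat (Θ a) i j := hΘ (Sum.inl j) i

theorem measurable_Bmat (hΘ : ∀ p q, Measurable fun a => Θ a p q) (i : Fin n) (j : Fin d) :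
    Measurable fun a => Bmat (Θ a) i j := hΘ (Sum.inr j) i

variable (Q : Matrix (Fin n) (Fin n) ℝ) (R : Matrix (Fin d) (Fin d) ℝ)

theorem measurable_riccati (hΘ : ∀ p q, Measurable fun a => Θ a p q) (t : ℕ) (i j : Fin n) :
    Measurable fun a => riccati Q R (Θ a) t i j := by
  induction t generalizing i j with
  | zero => exact measurable_const
  | succ t ih =>
    have hA := measurable_Amat hΘ
    have hB := measurable_Bmat hΘ
    have hAt : ∀ i j, Measurable fun a => (Amat (Θ a))ᵀ i j := fun i j => hA j i
    have hBt : ∀ i j, Measurable fun a => (Bmat (Θ a))ᵀ i j := fun i j => hB j i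
    have hI : ∀ i j, Measurable fun a =>
        (R + (Bmat (Θ a))ᵀ * riccati Q R (Θ a) t * Bmat (Θ a))⁻¹ i j :=
      measurable_matrix_inv fun i j => measurable_const.add
        (measurable_matrix_mul (measurable_matrix_mul hBt ih) hB i j)
    simp only [riccati_succ_eq, Matrix.sub_apply, Matrix.add_apply]
    exact (measurable_const.add (measurable_matrix_mul (measurable_matrix_mul hAt ih) hA i j)).sub
      (measurable_matrix_mul (measurable_matrix_mul (measurable_matrix_mul (measurable_matrix_mul
        (measurable_matrix_mul (measurable_matrix_mul hAt ih) hB) hI) hBt) ih) hA i j)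

theorem measurable_gain (hΘ : ∀ p q, Measurable fun a => Θ a p q) (H h : ℕ) (i : Fin d)
    (j : Fin n) : Measurable fun a => gain Q R H (Θ a) h i j := by
  have hA := measurable_Amat hΘ
  have hB := measurable_Bmat hΘ
  have hP := measurable_riccati Q R hΘ (H + 1 - (h + 1))
  have hBt : ∀ i j, Measurable fun a => (Bmat (Θ a))ᵀ i j := fun i j => hB j i
  have hI : ∀ i j, Measurable fun a =>
      (R + (Bmat (Θ a))ᵀ * riccati Q R (Θ a) (H + 1 - (h + 1)) * Bmat (Θ a))⁻¹ i j :=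
    measurable_matrix_inv fun i j => measurable_const.add
      (measurable_matrix_mul (measurable_matrix_mul hBt hP) hB i j)
  simp only [gain, Pmat, Matrix.smul_apply]
  exact (measurable_matrix_mul (measurable_matrix_mul (measurable_matrix_mul hI hBt) hP) hA
    i j).const_smul (-1 : ℝ)

theorem measurable_rollout (Θs : Param n d) (hΘ : ∀ p q, Measurable fun a => Θ a p q) (H : ℕ)
    {w : ℕ → α → Fin n → ℝ} {x : α → Fin n → ℝ} (hx : Measurable x) {j : ℕ}
    (hw : ∀ i ∈ Icc 1 j, Measurable (w i)) :
    Measurable fun a => rollout Θs (gainPolicy Q R H (Θ a)) (fun i => w i a) 1 (x a) j := by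
  induction j with
  | zero => exact hx
  | succ j ih =>
    have h := ih fun i hi => hw i (by simp only [mem_Icc] at hi ⊢; omega)
    have h2 := hw (1 + j) (by simp only [mem_Icc]; omega)
    exact ((measurable_const_mulVec _ h).add (measurable_const_mulVec _
      (measurable_mulVec (measurable_gain Q R hΘ H (1 + j)) h))).add h2

theorem measurable_predErr (Θs : Param n d) (hΘ : ∀ p q, Measurable fun a => Θ a p q) (H : ℕ)
    {w : ℕ → α → Fin n → ℝ} {x : α → Fin n → ℝ} (hx : Measurable x)
    (hw : ∀ i ∈ Icc 1 H, Measurable (w i)) :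
    Measurable fun a => predErr Q R H Θs (Θ a) (fun i => w i a) (x a) := by
  unfold predErr
  refine Finset.measurable_sum _ fun j hj => ?_
  have hj' := Finset.mem_range.1 hj
  have h := measurable_rollout Q R Θs hΘ H hx (j := j) fun i hi =>
    hw i (by simp only [mem_Icc] at hi ⊢; omega)
  have hu := measurable_mulVec (measurable_gain Q R hΘ H (1 + j)) h
  have hz : Measurable fun a => Sum.elim
      (rollout Θs (gainPolicy Q R H (Θ a)) (fun i => w i a) 1 (x a) j)
      (gainPolicy Q R H (Θ a) (1 + j)
        (rollout Θs (gainPolicy Q R H (Θ a)) (fun i => w i a) 1 (x a) j)) := by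
    refine measurable_pi_iff.2 fun i => ?_
    cases i with
    | inl i => exact measurable_pi_iff.1 h i
    | inr i => exact measurable_pi_iff.1 hu i
  have hD : ∀ p q, Measurable fun a => (Θs - Θ a)ᵀ p q := fun p q => measurable_const.sub (hΘ q p)
  exact measurable_dotProduct (measurable_mulVec hD hz) (measurable_mulVec hD hz)

end Policy

/-- Prediction errors depend only on the noise of the steps of the episode. -/
theorem predErr_congr (Q : Matrix (Fin n) (Fin n) ℝ) (R : Matrix (Fin d) (Fin d) ℝ) (H : ℕ)
    (Θs Θt : Param n d) {w w' : ℕ → Fin n → ℝ} (h : ∀ i ∈ Icc 1 H, w i = w' i) (x : Fin n → ℝ) :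
    predErr Q R H Θs Θt w x = predErr Q R H Θs Θt w' x := by
  have hr : ∀ j ≤ H, rollout Θs (gainPolicy Q R H Θt) w 1 x j
      = rollout Θs (gainPolicy Q R H Θt) w' 1 x j := by
    intro j
    induction j with
    | zero => intro _; rfl
    | succ j ih =>
      intro hj
      simp only [rollout]
      rw [ih (by omega), h (1 + j) (by simp only [mem_Icc]; omega)]
  unfold predErr
  exact sum_congr rfl fun j hj => by rw [hr j (mem_range.1 hj).le]

namespace Run

variable {Ω : Type*} [mΩ : MeasurableSpace Ω] {μ : Measure Ω} {S : Run n d Ω}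

section Past

variable (S)

theorem measurable_Θt_past {k k' : ℕ} (h : ℕ) (h1 : 1 ≤ k') (hk : k' ≤ k) (p : Fin n ⊕ Fin d)
    (q : Fin n) : Measurable[S.past k h] fun ω => S.Θt k' ω p q := by
  refine Measurable.mono (comap_measurable _) ?_ le_rfl
  refine le_trans ?_ (le_sup_left.trans (le_sup_left (a := _)))
  refine le_trans ?_ le_sup_right
  exact le_iSup₂_of_le k' (mem_Icc.2 ⟨h1, hk⟩) (le_iSup₂_of_le p q le_rfl)

theorem measurable_x₁_past {k k' : ℕ} (h : ℕ) (h1 : 1 ≤ k') (hk : k' ≤ k) :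
    Measurable[S.past k h] (S.x₁ k') := by
  refine Measurable.mono (comap_measurable _) ?_ le_rfl
  refine le_trans ?_ (le_sup_left.trans (le_sup_left.trans le_sup_left))
  refine le_trans ?_ le_sup_right
  exact le_iSup₂_of_le k' (mem_Icc.2 ⟨h1, hk⟩) le_rfl

theorem measurable_w_past_of_lt {k k' : ℕ} (h : ℕ) {h' : ℕ} (h1 : 1 ≤ k') (hk : k' < k)
    (hh : h' ∈ Icc 1 S.H) : Measurable[S.past k h] (S.w k' h') := by
  refine Measurable.mono (comap_measurable _) ?_ le_rfl
  refine le_trans ?_ le_sup_left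
  refine le_trans ?_ le_sup_right
  exact le_iSup₂_of_le k' (mem_Icc.2 ⟨h1, by omega⟩) (le_iSup₂_of_le h' hh le_rfl)

theorem measurable_w_past {k h h' : ℕ} (h1 : 1 ≤ h') (hh : h' < h) :
    Measurable[S.past k h] (S.w k h') := by
  refine Measurable.mono (comap_measurable _) ?_ le_rfl
  refine le_trans ?_ le_sup_right
  exact le_iSup₂_of_le h' (mem_Icc.2 ⟨h1, by omega⟩) le_rfl

theorem measurable_g_past (k h : ℕ) (i : NoiseIdx n d) : Measurable[S.past k h] (S.g i) := by
  refine Measurable.mono (comap_measurable _) ?_ le_rfl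
  refine le_trans ?_ (le_sup_left.trans (le_sup_left.trans (le_sup_left.trans le_sup_left)))
  exact le_iSup_of_le i le_rfl

/-- A σ-algebra contains the past as soon as all the variables of the past are measurable. -/
theorem past_le_of_measurable {m : MeasurableSpace Ω} {k h : ℕ} (hg : ∀ i, Measurable[m] (S.g i))
    (hx : ∀ k' ∈ Icc 1 k, Measurable[m] (S.x₁ k'))
    (hΘ : ∀ k' ∈ Icc 1 k, ∀ p q, Measurable[m] fun ω => S.Θt k' ω p q)
    (hw : ∀ k' ∈ Icc 1 (k - 1), ∀ h' ∈ Icc 1 S.H, Measurable[m] (S.w k' h'))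
    (hw' : ∀ h' ∈ Icc 1 (h - 1), Measurable[m] (S.w k h')) : S.past k h ≤ m := by
  refine sup_le (sup_le (sup_le (sup_le ?_ ?_) ?_) ?_) ?_
  · exact iSup_le fun i => (hg i).comap_le
  · exact iSup₂_le fun k' hk => (hx k' hk).comap_le
  · exact iSup₂_le fun k' hk => iSup₂_le fun p q => (hΘ k' hk p q).comap_le
  · exact iSup₂_le fun k' hk => iSup₂_le fun h' hh => (hw k' hk h' hh).comap_le
  · exact iSup₂_le fun h' hh => (hw' h' hh).comap_le

theorem past_mono_right (k : ℕ) {h h' : ℕ} (hh : h ≤ h') : S.past k h ≤ S.past k h' :=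
  S.past_le_of_measurable (fun i => S.measurable_g_past k h' i)
    (fun k' hk => S.measurable_x₁_past h' (mem_Icc.1 hk).1 (mem_Icc.1 hk).2)
    (fun k' hk => S.measurable_Θt_past h' (mem_Icc.1 hk).1 (mem_Icc.1 hk).2)
    (fun k' hk i hi => S.measurable_w_past_of_lt h' (mem_Icc.1 hk).1
      (by have := mem_Icc.1 hk; omega) hi)
    (fun i hi => S.measurable_w_past (mem_Icc.1 hi).1 (by have := mem_Icc.1 hi; omega))

theorem past_le_past_succ {k h : ℕ} (hk : 1 ≤ k) (hh : h ≤ S.H + 1) :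
    S.past k h ≤ S.past (k + 1) 1 :=
  S.past_le_of_measurable (fun i => S.measurable_g_past _ _ i)
    (fun k' hk => S.measurable_x₁_past _ (mem_Icc.1 hk).1 (by have := mem_Icc.1 hk; omega))
    (fun k' hk => S.measurable_Θt_past _ (mem_Icc.1 hk).1 (by have := mem_Icc.1 hk; omega))
    (fun k' hk i hi => S.measurable_w_past_of_lt _ (mem_Icc.1 hk).1
      (by have := mem_Icc.1 hk; omega) hi)
    (fun i hi => S.measurable_w_past_of_lt _ hk (by omega)
      (by simp only [mem_Icc] at hi ⊢; omega))

theorem monotone_past_linear (hH : 1 ≤ S.H) :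
    Monotone fun t => S.past (t / S.H + 1) (t % S.H + 1) := by
  refine monotone_nat_of_le_succ fun t => ?_
  have hlt := Nat.mod_lt t (show S.H > 0 by omega)
  rcases Nat.lt_or_ge (t % S.H + 1) S.H with h | h
  · have h1 : (t + 1) / S.H = t / S.H := by
      rw [Nat.succ_div_of_not_dvd]
      rw [Nat.dvd_iff_mod_eq_zero, Nat.add_mod, Nat.mod_eq_of_lt (show 1 < S.H by omega),
        Nat.mod_eq_of_lt h]
      omega
    have h2 : (t + 1) % S.H = t % S.H + 1 := by
      rw [Nat.add_mod, Nat.mod_eq_of_lt (show 1 < S.H by omega), Nat.mod_eq_of_lt h]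
    simp only [h1, h2]
    exact S.past_mono_right _ (by omega)
  · have hd : S.H ∣ t + 1 := by
      have h3 : t % S.H + 1 = S.H := by omega
      refine ⟨t / S.H + 1, ?_⟩
      have := Nat.div_add_mod t S.H
      rw [Nat.mul_add, mul_one]
      omega
    have h1 : (t + 1) / S.H = t / S.H + 1 := Nat.succ_div_of_dvd hd
    have h2 : (t + 1) % S.H = 0 := Nat.mod_eq_zero_of_dvd hd
    simp only [h1, h2]
    exact S.past_le_past_succ (Nat.le_add_left 1 _) (by omega)

theorem measurable_w_linear (hH : 1 ≤ S.H) (t : ℕ) :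
    Measurable[S.past ((t + 1) / S.H + 1) ((t + 1) % S.H + 1)]
      (S.w (t / S.H + 1) (t % S.H + 1)) := by
  have hlt := Nat.mod_lt t (show S.H > 0 by omega)
  by_cases hd : S.H ∣ t + 1
  · rw [Nat.succ_div_of_dvd hd]
    exact S.measurable_w_past_of_lt _ (Nat.le_add_left 1 _) (Nat.lt_succ_self _)
      (by simp only [mem_Icc]; omega)
  · have h2 : (t + 1) % S.H = t % S.H + 1 := by
      have h3 : t % S.H + 1 ≠ S.H := fun h => hd ⟨t / S.H + 1, by
        have := Nat.div_add_mod t S.H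
        rw [Nat.mul_add, mul_one]
        omega⟩
      have h4 := Nat.mod_eq_of_lt (show t % S.H + 1 < S.H by omega)
      rwa [Nat.mod_add_mod] at h4
    rw [Nat.succ_div_of_not_dvd hd, h2]
    exact S.measurable_w_past (by omega) (by omega)

theorem measurable_z_past {k h : ℕ} (hk : 1 ≤ k) (hh : 1 ≤ h) :
    Measurable[S.past k h] (S.z k h) := by
  have hΘ := S.measurable_Θt_past h hk le_rfl
  have hx : Measurable[S.past k h] (S.x k h) :=
    measurable_rollout (mα := S.past k h) S.Q S.R S.Θs hΘ S.H
      (S.measurable_x₁_past h hk le_rfl) fun i hi =>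
        S.measurable_w_past (mem_Icc.1 hi).1 (by have := mem_Icc.1 hi; omega)
  have hu : Measurable[S.past k h] (S.u k h) :=
    measurable_mulVec (mΩ := S.past k h) (measurable_gain (mα := S.past k h) S.Q S.R hΘ S.H h) hx
  refine (@measurable_pi_iff _ _ _ (S.past k h) _ _).2 fun i => ?_
  cases i with
  | inl i => exact (@measurable_pi_iff _ _ _ (S.past k h) _ _).1 hx i
  | inr i => exact (@measurable_pi_iff _ _ _ (S.past k h) _ _).1 hu i

end Past

theorem StochasticModel.past_le (hS : S.StochasticModel μ) (k h : ℕ) : S.past k h ≤ mΩ :=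
  S.past_le_of_measurable hS.measurable_g (fun _ _ => hS.measurable_x₁ _)
    (fun _ _ => hS.measurable_Θt _) (fun _ _ _ _ => hS.measurable_w _ _)
    (fun _ _ => hS.measurable_w _ _)

/-- The noise of an episode is jointly independent of everything before the episode. -/
theorem StochasticModel.indep_episode [IsProbabilityMeasure μ] (hS : S.StochasticModel μ) {k : ℕ}
    (hk : k ∈ Icc 1 S.K) {j : ℕ} (hj : j ≤ S.H) :
    Indep (⨆ h ∈ Icc 1 j, MeasurableSpace.comap (S.w k h) inferInstance) (S.past k 1) μ := by
  induction j with
  | zero =>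
    have : (⨆ h ∈ Icc 1 0, MeasurableSpace.comap (S.w k h) inferInstance) = (⊥ : MeasurableSpace Ω) := by
      simp
    rw [this]
    exact indep_bot_left _
  | succ j ih =>
    have h1 : (⨆ h ∈ Icc 1 j, MeasurableSpace.comap (S.w k h) inferInstance) ≤ mΩ :=
      iSup₂_le fun h _ => (hS.measurable_w k h).comap_le
    have h3 := hS.indep_w k hk (j + 1) (by simp only [mem_Icc]; omega)
    have h4 := indep_sup_left_of_sequential h1 (hS.past_le k 1) (hS.measurable_w k (j + 1)).comap_le
      (ih (by omega)) (indep_of_indep_of_le_right h3 (sup_le (S.past_mono_right k (by omega))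
        (iSup₂_le fun i hi => (S.measurable_w_past (mem_Icc.1 hi).1
          (by have := mem_Icc.1 hi; omega)).comap_le)))
    refine indep_of_indep_of_le_left h4 (iSup₂_le fun i hi => ?_)
    rcases Nat.lt_or_ge j i with h | h
    · have : i = j + 1 := by have := mem_Icc.1 hi; omega
      rw [this]
      exact le_sup_right
    · exact le_trans (le_iSup₂_of_le i (mem_Icc.2 ⟨(mem_Icc.1 hi).1, h⟩) le_rfl) le_sup_left

theorem StochasticModel.episodeNoise (hS : S.StochasticModel μ) {k : ℕ} (hk : k ∈ Icc 1 S.K) :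
    EpisodeNoise μ S.H S.Cw (S.w k) where
  measurable := hS.measurable_w k
  norm_le := by filter_upwards [hS.norm_w] with ω hω using hω k hk
  mean := hS.mean_w k hk
  indep h hh := indep_of_indep_of_le_right (hS.indep_w k hk h hh)
    (iSup₂_le fun i hi => (S.measurable_w_past (mem_Icc.1 hi).1
      (by have := mem_Icc.1 hi; omega)).comap_le)

end Run

end RunMeasurability

end PrivateLQ

namespace PrivateLQ

/-! ### Good events of a run -/

section GoodEvents

variable {n d : ℕ}

theorem sum_range_mul_div_mod {M : Type*} [AddCommMonoid M] {H : ℕ} (hH : 1 ≤ H) (f : ℕ → ℕ → M)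
    (j : ℕ) : ∑ s ∈ range (j * H), f (s / H + 1) (s % H + 1)
      = ∑ k ∈ Icc 1 j, ∑ h ∈ Icc 1 H, f k h := by
  induction j with
  | zero => simp
  | succ j ih =>
    rw [Nat.succ_mul, sum_range_add, ih, sum_Icc_succ_top (by omega)]
    congr 1
    rw [sum_Icc_one_eq_sum_range]
    refine sum_congr rfl fun r hr => ?_
    have hr' := mem_range.1 hr
    rw [Nat.mul_comm, Nat.mul_add_div (by omega), Nat.mul_add_mod, Nat.div_eq_of_lt hr',
      Nat.mod_eq_of_lt hr', add_zero, add_comm 1 r]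

namespace Run

variable {Ω : Type*} {S : Run n d Ω} {C CA CB : ℝ}

/-- States stay in the unit ball and state-control pairs in the ball of radius `1 + γ`. -/
theorem Boundedness.sumElim_rollout_le (hB : S.Boundedness C CA CB)
    (hsum : CA + S.γ * CB + S.Cw ≤ 1) (hH : 1 ≤ S.H) {Θt : Param n d} (hΘ : Θt ∈ paramSet n d)
    {w : ℕ → Fin n → ℝ} (hw : ∀ h ∈ Icc 1 S.H, euclNorm (w h) ≤ S.Cw) {x : Fin n → ℝ}
    (hx : euclNorm x ≤ 1) {j : ℕ} (hj : j < S.H) :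
    Sum.elim (rollout S.Θs (gainPolicy S.Q S.R S.H Θt) w 1 x j)
        (gainPolicy S.Q S.R S.H Θt (1 + j) (rollout S.Θs (gainPolicy S.Q S.R S.H Θt) w 1 x j))
      ⬝ᵥ Sum.elim (rollout S.Θs (gainPolicy S.Q S.R S.H Θt) w 1 x j)
        (gainPolicy S.Q S.R S.H Θt (1 + j) (rollout S.Θs (gainPolicy S.Q S.R S.H Θt) w 1 x j))
      ≤ (1 + S.γ) ^ 2 := by
  have hγ := hB.γ_nonneg hH
  have hr : 0 ≤ CA + S.γ * CB := add_nonneg hB.CA_nonneg (mul_nonneg hγ hB.CB_nonneg)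
  have hF : ∀ j < S.H, ∀ y, euclNorm y ≤ 1 →
      euclNorm (loopMat S.Q S.R S.Θs Θt j *ᵥ y) + S.Cw ≤ 1 := fun j hj y hy => by
    have := hB.loopMat_le hΘ hj y
    nlinarith [euclNorm_nonneg y]
  have h1 := euclNorm_rollout_le_one S.Θs Θt hF hw hx hj.le
  set y := rollout S.Θs (gainPolicy S.Q S.R S.H Θt) w 1 x j
  have h2 : euclNorm (gainPolicy S.Q S.R S.H Θt (1 + j) y) ≤ S.γ * euclNorm y := by
    rw [gainPolicy_one_add Θt hj]
    exact hB.gainToGo_le hΘ (by omega) y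
  rw [sumElim_dotProduct_self, ← euclNorm_sq, ← euclNorm_sq]
  have h3 := euclNorm_nonneg y
  have h4 := euclNorm_nonneg (gainPolicy S.Q S.R S.H Θt (1 + j) y)
  have h5 : euclNorm (gainPolicy S.Q S.R S.H Θt (1 + j) y) ≤ S.γ := by nlinarith
  nlinarith

theorem transpose_sub_mulVec_sq_le {Θ Θ' : Param n d} (h : frobNorm Θ ≤ 1) (h' : frobNorm Θ' ≤ 1)
    (z : Fin n ⊕ Fin d → ℝ) :
    ((Θ - Θ')ᵀ *ᵥ z) ⬝ᵥ ((Θ - Θ')ᵀ *ᵥ z) ≤ 4 * (z ⬝ᵥ z) := by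
  have h0 := dotProduct_self_nonneg_real z
  have h1 := transpose_mulVec_le_frobNorm Θ z
  have h2 := transpose_mulVec_le_frobNorm Θ' z
  have h3 : frobNorm Θ ^ 2 ≤ 1 := pow_le_one₀ (Real.sqrt_nonneg _) h
  have h4 : frobNorm Θ' ^ 2 ≤ 1 := pow_le_one₀ (Real.sqrt_nonneg _) h'
  have h5 : ((Θ - Θ')ᵀ *ᵥ z) ⬝ᵥ ((Θ - Θ')ᵀ *ᵥ z)
      ≤ 2 * ((Θᵀ *ᵥ z) ⬝ᵥ (Θᵀ *ᵥ z)) + 2 * ((Θ'ᵀ *ᵥ z) ⬝ᵥ (Θ'ᵀ *ᵥ z)) := by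
    rw [Matrix.transpose_sub, Matrix.sub_mulVec, sub_dotProduct, dotProduct_sub, dotProduct_sub,
      dotProduct_comm (Θ'ᵀ *ᵥ z)]
    have := dotProduct_self_nonneg_real (Θᵀ *ᵥ z + Θ'ᵀ *ᵥ z)
    rw [add_dotProduct, dotProduct_add, dotProduct_add, dotProduct_comm (Θ'ᵀ *ᵥ z)] at this
    linarith
  nlinarith

theorem Boundedness.predErr_mem (hB : S.Boundedness C CA CB)
    (hsum : CA + S.γ * CB + S.Cw ≤ 1) (hH : 1 ≤ S.H) {Θt : Param n d} (hΘ : Θt ∈ paramSet n d)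
    {w : ℕ → Fin n → ℝ} (hw : ∀ h ∈ Icc 1 S.H, euclNorm (w h) ≤ S.Cw) {x : Fin n → ℝ}
    (hx : euclNorm x ≤ 1) :
    predErr S.Q S.R S.H S.Θs Θt w x ∈ Set.Icc 0 (4 * (1 + S.γ) ^ 2 * S.H) := by
  constructor
  · exact sum_nonneg fun j _ => dotProduct_self_nonneg_real _
  · calc predErr S.Q S.R S.H S.Θs Θt w x ≤ ∑ j ∈ range S.H, 4 * (1 + S.γ) ^ 2 :=
        sum_le_sum fun j hj => (transpose_sub_mulVec_sq_le hB.mem_paramSet.1 hΘ.1 _).trans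
          (by linarith [hB.sumElim_rollout_le hsum hH hΘ hw hx (mem_range.1 hj)])
      _ = _ := by rw [sum_const, card_range, nsmul_eq_mul]; ring

theorem predErr_eq_sum_z (k : ℕ) (ω : Ω) :
    predErr S.Q S.R S.H S.Θs (S.Θt k ω) (fun i => S.w k i ω) (S.x₁ k ω)
      = ∑ h ∈ Icc 1 S.H, ((S.Θs - S.Θt k ω)ᵀ *ᵥ S.z k h ω)
        ⬝ᵥ ((S.Θs - S.Θt k ω)ᵀ *ᵥ S.z k h ω) := by
  rw [sum_Icc_one_eq_sum_range, predErr]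
  refine sum_congr rfl fun j _ => ?_
  simp only [z, u, x, policy, Nat.add_sub_cancel_left]

theorem x_succ {k h : ℕ} (hh : 1 ≤ h) (ω : Ω) :
    S.x k (h + 1) ω = S.Θsᵀ *ᵥ S.z k h ω + S.w k h ω := by
  obtain ⟨j, rfl⟩ : ∃ j, h = 1 + j := ⟨h - 1, by omega⟩
  rw [z, transpose_mulVec_sumElim]
  have h1 : 1 + j + 1 - 1 = j + 1 := by omega
  have h2 : 1 + j - 1 = j := by omega
  simp only [x, u, h1, h2, rollout]

/-- The regularized Gram matrix `Z_kᵀ Z_k + Λ I`. -/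
noncomputable def reg (S : Run n d Ω) (k : ℕ) (ω : Ω) : Matrix (Fin n ⊕ Fin d) (Fin n ⊕ Fin d) ℝ :=
  S.lam • (1 : Matrix (Fin n ⊕ Fin d) (Fin n ⊕ Fin d) ℝ) + S.gram k ω

/-- The noise term `∑_{k' < k} ∑_h z_{k',h} w_{k',h}ᵀ`. -/
noncomputable def cross (S : Run n d Ω) (k : ℕ) (ω : Ω) : Param n d :=
  ∑ k' ∈ Icc 1 (k - 1), ∑ h ∈ Icc 1 S.H, Matrix.vecMulVec (S.z k' h ω) (S.w k' h ω)

theorem psum₂_eq (k : ℕ) (ω : Ω) :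
    S.psum₂ 1 (k - 1) ω = S.gram k ω * S.Θs + S.cross k ω := by
  unfold psum₂ gram psum₁ cross
  rw [Matrix.sum_mul, ← sum_add_distrib]
  refine sum_congr rfl fun k' _ => ?_
  rw [Matrix.sum_mul, ← sum_add_distrib]
  refine sum_congr rfl fun h hh => ?_
  rw [x_succ (mem_Icc.1 hh).1, Matrix.vecMulVec_add, Matrix.vecMulVec_mul,
    Matrix.mulVec_transpose]

theorem quad_psum₁ (i j : ℕ) (ω : Ω) (v : Fin n ⊕ Fin d → ℝ) :
    quad (S.psum₁ i j ω) v = ∑ k ∈ Icc i j, ∑ h ∈ Icc 1 S.H, (S.z k h ω ⬝ᵥ v) ^ 2 := by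
  rw [psum₁, quad, Matrix.sum_mulVec, dotProduct_sum]
  exact sum_congr rfl fun k _ => quad_sum_vecMulVec _ _ _

theorem quad_psum₁_nonneg (i j : ℕ) (ω : Ω) (v : Fin n ⊕ Fin d → ℝ) :
    0 ≤ quad (S.psum₁ i j ω) v := by
  rw [quad_psum₁]
  exact sum_nonneg fun _ _ => sum_nonneg fun _ _ => sq_nonneg _

theorem psum₁_transpose (i j : ℕ) (ω : Ω) : (S.psum₁ i j ω)ᵀ = S.psum₁ i j ω := by
  rw [psum₁, Matrix.transpose_sum]
  exact sum_congr rfl fun k _ => transpose_sum_vecMulVec _ _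

theorem posDef_reg (hlam : 0 < S.lam) (k : ℕ) (ω : Ω) : (S.reg k ω).PosDef :=
  posDef_smul_one_add hlam (S.psum₁_transpose _ _ _) (S.quad_psum₁_nonneg _ _ _)

section Probability

variable [mΩ : MeasurableSpace Ω] {μ : Measure Ω} [IsProbabilityMeasure μ]

/-- The system noise enters the estimate through a self-normalized martingale. -/
theorem measure_exists_lt_colQuad_cross_le (hS : S.StochasticModel μ) (hH : 1 ≤ S.H)
    (hCw : 0 ≤ S.Cw) (hα : 0 < S.α) (hlam : 0 < S.lam) :
    μ {ω | ∃ k ∈ Icc 1 S.K, S.Cw ^ 2 * (2 * Real.log (2 / S.α)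
        + Real.log (1 + S.lam⁻¹ • S.gram k ω).det) < colQuad (S.reg k ω)⁻¹ (S.cross k ω)}
      ≤ ENNReal.ofReal (S.α / 2) := by
  -- linear time: step `t` is step `t % H + 1` of episode `t / H + 1`
  have hmem : ∀ t < S.K * S.H, t / S.H + 1 ∈ Icc 1 S.K ∧ t % S.H + 1 ∈ Icc 1 S.H := by
    intro t ht
    have h1 : t / S.H < S.K := Nat.div_lt_of_lt_mul (by rwa [Nat.mul_comm])
    have h2 := Nat.mod_lt t (show S.H > 0 by omega)
    constructor
    · exact mem_Icc.2 ⟨Nat.le_add_left 1 _, h1⟩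
    · exact mem_Icc.2 ⟨Nat.le_add_left 1 _, h2⟩
  have h := measure_exists_lt_colQuad_le (S.monotone_past_linear hH) (fun t => hS.past_le _ _)
    (fun t => S.measurable_z_past (k := t / S.H + 1) (h := t % S.H + 1) (Nat.le_add_left 1 _)
      (Nat.le_add_left 1 _)) (S.measurable_w_linear hH) (N := S.K * S.H)
    (fun t ht => hS.indep_w _ (hmem t ht).1 _ (hmem t ht).2) hCw
    (fun t ht => by
      filter_upwards [hS.norm_w] with ω hω using hω _ (hmem t ht).1 _ (hmem t ht).2)
    (fun t ht => hS.mean_w _ (hmem t ht).1 _ (hmem t ht).2) hlam (p := S.α / 2) (by positivity)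
  refine (measure_mono ?_).trans h
  rintro ω ⟨k, hk, hlt⟩
  have hk' := mem_Icc.1 hk
  refine ⟨(k - 1) * S.H, Nat.mul_le_mul_right _ (by omega), ?_⟩
  have e1 : ∑ s ∈ range ((k - 1) * S.H), Matrix.vecMulVec (S.z (s / S.H + 1) (s % S.H + 1) ω)
      (S.z (s / S.H + 1) (s % S.H + 1) ω) = S.gram k ω :=
    sum_range_mul_div_mod hH (fun k h => Matrix.vecMulVec (S.z k h ω) (S.z k h ω)) (k - 1)
  have e2 : crossSum (fun s => S.z (s / S.H + 1) (s % S.H + 1) ω)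
      (fun s => S.w (s / S.H + 1) (s % S.H + 1) ω) ((k - 1) * S.H) = S.cross k ω :=
    sum_range_mul_div_mod hH (fun k h => Matrix.vecMulVec (S.z k h ω) (S.w k h ω)) (k - 1)
  rw [regGram, e1, e2, one_div_div]
  exact hlt

/-- Conditional expectations of the prediction errors are controlled by the prediction errors. -/
theorem measure_lt_sum_integral_predErr_le (hS : S.StochasticModel μ) (hH : 1 ≤ S.H)
    (hB : S.Boundedness C CA CB) (hsum : CA + S.γ * CB + S.Cw ≤ 1) (hA : S.IsPrivateOFURL μ)
    (hα : 0 < S.α) :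
    μ {ω | 2 * ∑ k ∈ Icc 1 S.K,
          predErr S.Q S.R S.H S.Θs (S.Θt k ω) (fun i => S.w k i ω) (S.x₁ k ω)
          + 2 * (4 * (1 + S.γ) ^ 2 * S.H) * Real.log (8 / S.α)
        < ∑ k ∈ Icc 1 S.K, ∫ ω', predErr S.Q S.R S.H S.Θs (S.Θt k ω) (fun i => S.w k i ω')
          (S.x₁ k ω) ∂μ} ≤ ENNReal.ofReal (S.α / 8) := by
  have hγ := hB.γ_nonneg hH
  have hHr : (0 : ℝ) < S.H := by exact_mod_cast hH
  -- the noise of an episode as one variable, cut off outside the steps to which the model applies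
  set W : ℕ → Ω → (ℕ → Fin n → ℝ) := fun t ω i => if i ∈ Icc 1 S.H then S.w (t + 1) i ω else 0
    with hWdef
  set X : ℕ → Ω × (ℕ → Fin n → ℝ) → ℝ := fun t q =>
    predErr S.Q S.R S.H S.Θs (S.Θt (t + 1) q.1) q.2 (S.x₁ (t + 1) q.1) with hXdef
  have hWm : ∀ (m : MeasurableSpace Ω) t, (∀ i ∈ Icc 1 S.H, Measurable[m] (S.w (t + 1) i)) →
      Measurable[m] (W t) := by
    intro m t h
    refine measurable_pi_iff.2 fun i => ?_
    by_cases hi : i ∈ Icc 1 S.H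
    · simpa only [hWdef, hi, if_true] using h i hi
    · simp only [hWdef, hi, if_false]; exact measurable_const
  have hWm' : ∀ t, Measurable (W t) := fun t => hWm _ t fun i _ => hS.measurable_w _ _
  have hXm : ∀ t, Measurable[(S.past (t + 1) 1).prod inferInstance] (X t) := by
    intro t
    have hΘ := S.measurable_Θt_past (k := t + 1) (k' := t + 1) 1 (by omega) le_rfl
    have hx := S.measurable_x₁_past (k := t + 1) (k' := t + 1) 1 (by omega) le_rfl
    let _ : MeasurableSpace Ω := S.past (t + 1) 1
    exact measurable_predErr S.Q S.R S.Θs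
      (fun p q => (hΘ p q).comp (measurable_fst (α := Ω) (β := ℕ → Fin n → ℝ)))
      S.H (w := fun i q => q.2 i) (hx.comp measurable_fst)
      fun i _ => (measurable_pi_apply i).comp (measurable_snd (α := Ω) (β := ℕ → Fin n → ℝ))
  have hmem : ∀ t < S.K, t + 1 ∈ Icc 1 S.K := fun t ht => mem_Icc.2 ⟨by omega, ht⟩
  have hind : ∀ t < S.K, Indep (MeasurableSpace.comap (W t) inferInstance) (S.past (t + 1) 1) μ := by
    intro t ht
    refine indep_of_indep_of_le_left (hS.indep_episode (hmem t ht) le_rfl) ?_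
    refine Measurable.comap_le (hWm _ t fun i hi => ?_)
    exact Measurable.mono (comap_measurable _) (le_iSup₂_of_le i hi le_rfl) le_rfl
  have hmono : Monotone fun t => S.past (t + 1) 1 :=
    monotone_nat_of_le_succ fun t => S.past_le_past_succ (by omega) (by omega)
  have h := measure_two_mul_sum_lt_sum_integral_le (p := S.α / 8) hmono (fun t => hS.past_le _ _)
    hXm (fun t => hWm _ t fun i hi => S.measurable_w_past_of_lt _ (by omega) (by omega) hi) hind
    (b := 4 * (1 + S.γ) ^ 2 * S.H) (by positivity) (fun t ht => ?_) (by positivity)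
  · refine (measure_mono ?_).trans h
    intro ω hω
    have hω' : 2 * ∑ k ∈ Icc 1 S.K,
          predErr S.Q S.R S.H S.Θs (S.Θt k ω) (fun i => S.w k i ω) (S.x₁ k ω)
          + 2 * (4 * (1 + S.γ) ^ 2 * S.H) * Real.log (8 / S.α)
        < ∑ k ∈ Icc 1 S.K, ∫ ω', predErr S.Q S.R S.H S.Θs (S.Θt k ω) (fun i => S.w k i ω')
          (S.x₁ k ω) ∂μ := hω
    rw [sum_Icc_one_eq_sum_range, sum_Icc_one_eq_sum_range] at hω'
    simp only [add_comm 1] at hω'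
    change 2 * ∑ t ∈ range S.K, X t (ω, W t ω)
      + 2 * (4 * (1 + S.γ) ^ 2 * S.H) * Real.log (1 / (S.α / 8)) < _
    rw [one_div_div]
    have hcongr : ∀ t ω ω', X t (ω, W t ω') = predErr S.Q S.R S.H S.Θs (S.Θt (t + 1) ω)
        (fun i => S.w (t + 1) i ω') (S.x₁ (t + 1) ω) := fun t ω ω' =>
      predErr_congr _ _ _ _ _ (fun i hi => by simp only [hWdef, hi, if_true]) _
    refine lt_of_le_of_lt (le_of_eq ?_) (hω'.trans_le (le_of_eq ?_))
    · simp only [hcongr]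
    · refine sum_congr rfl fun t _ => ?_
      rw [integral_map (hWm' t).aemeasurable]
      · simp only [hcongr]
      · exact ((hXm t).comp
          (@measurable_prodMk_left Ω _ (S.past (t + 1) 1) _ ω)).aestronglyMeasurable
  · have hset : MeasurableSet {e : ℕ → Fin n → ℝ | ∀ i ∈ Icc 1 S.H, euclNorm (e i) ≤ S.Cw} := by
      have : {e : ℕ → Fin n → ℝ | ∀ i ∈ Icc 1 S.H, euclNorm (e i) ≤ S.Cw}
          = ⋂ i ∈ Icc 1 S.H, {e | euclNorm (e i) ≤ S.Cw} := by ext; simp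
      rw [this]
      exact Finset.measurableSet_biInter _ fun i _ =>
        measurableSet_le (measurable_euclNorm (measurable_pi_apply i)) measurable_const
    have hWn : ∀ᵐ e ∂(μ.map (W t)), ∀ i ∈ Icc 1 S.H, euclNorm (e i) ≤ S.Cw := by
      rw [ae_map_iff (hWm' t).aemeasurable hset]
      filter_upwards [hS.norm_w] with ω hω i hi
      simp only [hWdef, hi, if_true]
      exact hω _ (hmem t ht) i hi
    filter_upwards [hS.norm_x₁, hA] with ω hx hω
    filter_upwards [hWn] with e he
    exact hB.predErr_mem hsum hH (hω _ (hmem t ht)).1 he (hx _ (hmem t ht))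

end Probability

/-- On the good events the true system lies in the confidence set. -/
theorem mem_confSet (hB : S.Boundedness C CA CB) (hn : 1 ≤ n) (hlam : 0 < S.lam)
    (hCw : 0 ≤ S.Cw) (hα : 0 < S.α) (hα1 : S.α ≤ 1) {k : ℕ} {ω : Ω}
    (h1 : ∀ y, |quad (S.noise₁ k ω) y| ≤ S.lam * (y ⬝ᵥ y))
    (h2 : frobNorm (S.noise₂ k ω) / √S.lam ≤ S.nu)
    (h3 : colQuad (S.reg k ω)⁻¹ (S.cross k ω) ≤ S.Cw ^ 2 * (2 * Real.log (2 / S.α)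
        + Real.log (1 + S.lam⁻¹ • S.gram k ω).det)) :
    S.Θs ∈ S.confSet k ω ∧ (∀ v, quad (S.reg k ω) v ≤ quad (S.V k ω) v) ∧
      (S.V k ω)ᵀ = S.V k ω := by
  set M := S.noise₁ k ω + S.eta • (1 : Matrix (Fin n ⊕ Fin d) (Fin n ⊕ Fin d) ℝ) with hM
  have hV : S.V k ω = S.gram k ω + M := by rw [V, T₁_eq, hM, add_assoc]
  have hMt : Mᵀ = M := by
    rw [hM, Matrix.transpose_add, noise₁_transpose, Matrix.transpose_smul, Matrix.transpose_one]
  have hqM : ∀ v, quad M v = quad (S.noise₁ k ω) v + 2 * S.lam * (v ⬝ᵥ v) := fun v => by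
    rw [hM, quad_add_left, quad_smul_left, quad_one, eta]
  have hM0 : ∀ v, S.lam * (v ⬝ᵥ v) ≤ quad M v := fun v => by
    rw [hqM]; linarith [(abs_le.1 (h1 v)).1]
  have hM1 : ∀ v, quad M v ≤ S.lamMax * (v ⬝ᵥ v) := fun v => by
    rw [hqM, lamMax]; linarith [(abs_le.1 (h1 v)).2]
  have hVG : ∀ v, quad (S.reg k ω) v ≤ quad (S.V k ω) v := fun v => by
    rw [hV, reg, quad_add_left, quad_add_left, quad_smul_left, quad_one]
    linarith [hM0 v]
  have hVM : ∀ v, quad M v ≤ quad (S.V k ω) v := fun v => by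
    rw [hV, quad_add_left (S.gram k ω) M]
    have : 0 ≤ quad (S.gram k ω) v := quad_psum₁_nonneg _ _ _ _
    linarith
  have hVt : (S.V k ω)ᵀ = S.V k ω := by
    rw [hV, Matrix.transpose_add, hMt]
    congr 1
    exact S.psum₁_transpose _ _ _
  refine ⟨?_, hVG, hVt⟩
  have hVp : (S.V k ω).PosDef := posDef_of_quad hVt fun v hv => by
    have h := (posDef_reg hlam k ω).dotProduct_mulVec_pos hv
    refine lt_of_lt_of_le ?_ (hVG v)
    simpa [quad] using h
  have hE : S.V k ω * (S.Θs - S.Θhat k ω) = M * S.Θs - S.cross k ω - S.noise₂ k ω := by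
    rw [Matrix.mul_sub, Θhat, ← Matrix.mul_assoc,
      Matrix.mul_nonsing_inv _ ((Matrix.isUnit_iff_isUnit_det _).1 hVp.isUnit), Matrix.one_mul,
      T₂_eq, psum₂_eq, hV, Matrix.add_mul]
    abel
  have hle := weightedNorm_le_of_mul_eq (posDef_reg hlam k ω) hMt hVG hVM hlam hM0 hM1
    (by unfold lamMax; positivity) hB.mem_paramSet.1 hE
  have hdet : 1 ≤ (1 + S.lam⁻¹ • S.gram k ω).det := by
    have hq : ∀ v, 0 ≤ quad (S.lam⁻¹ • S.gram k ω) v := fun v => by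
      rw [quad_smul_left]
      exact mul_nonneg (by positivity) (quad_psum₁_nonneg _ _ _ _)
    have ht : (S.lam⁻¹ • S.gram k ω)ᵀ = S.lam⁻¹ • S.gram k ω := by
      rw [Matrix.transpose_smul, gram, psum₁_transpose]
    refine le_trans ?_ (one_add_trace_le_det ht hq)
    have : 0 ≤ (S.lam⁻¹ • S.gram k ω).trace := by
      unfold Matrix.trace
      refine sum_nonneg fun i _ => ?_
      have h := hq (Pi.single i 1)
      simpa [quad, Matrix.mulVec_single] using h
    linarith
  have hlog := Real.log_nonneg hdet
  have hlog2 : 0 ≤ Real.log (2 / S.α) := Real.log_nonneg (by rw [le_div_iff₀ hα]; linarith)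
  have hn' : (1 : ℝ) ≤ n := by exact_mod_cast hn
  -- the radius carries `n log det`, which exceeds the `log det` of the self-normalized bound
  have hsq : √(colQuad (S.reg k ω)⁻¹ (S.cross k ω)) ≤ S.Cw * √(2 * Real.log (2 / S.α) +
      n * Real.log (1 + S.lamMin⁻¹ • S.gram k ω).det) := by
    rw [lamMin]
    calc √(colQuad (S.reg k ω)⁻¹ (S.cross k ω))
        ≤ √(S.Cw ^ 2 * (2 * Real.log (2 / S.α) +
          n * Real.log (1 + S.lam⁻¹ • S.gram k ω).det)) := by
          refine Real.sqrt_le_sqrt (h3.trans ?_)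
          refine mul_le_mul_of_nonneg_left ?_ (sq_nonneg _)
          nlinarith
      _ = _ := by rw [Real.sqrt_mul (sq_nonneg _), Real.sqrt_sq hCw]
  change weightedNorm _ _ ≤ S.beta k ω
  unfold beta
  linarith

/-- A parameter of the confidence set has prediction errors controlled by the confidence radius. -/
theorem predErr_le_of_mem_confSet (hlam : 0 < S.lam) {k : ℕ} {ω : Ω}
    (hV : ∀ v, quad (S.reg k ω) v ≤ quad (S.V k ω) v) (hVt : (S.V k ω)ᵀ = S.V k ω)
    (h1 : S.Θs ∈ S.confSet k ω) (h2 : S.Θt k ω ∈ S.confSet k ω) :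
    predErr S.Q S.R S.H S.Θs (S.Θt k ω) (fun i => S.w k i ω) (S.x₁ k ω)
      ≤ 4 * S.beta k ω ^ 2 * ((S.reg k ω)⁻¹ * S.psum₁ k k ω).trace := by
  have hG := posDef_reg hlam k ω
  have hV0 : ∀ v, 0 ≤ quad (S.V k ω) v := fun v => (quad_nonneg_of_posDef hG v).trans (hV v)
  have hsq : ∀ Θ ∈ S.confSet k ω, colQuad (S.V k ω) (Θ - S.Θhat k ω) ≤ S.beta k ω ^ 2 := by
    intro Θ h
    have h' : weightedNorm _ _ ≤ S.beta k ω := h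
    rw [weightedNorm_eq] at h'
    rw [← Real.sq_sqrt (colQuad_nonneg hV0 _)]
    exact pow_le_pow_left₀ (Real.sqrt_nonneg _) h' 2
  have h3 : colQuad (S.reg k ω) (S.Θs - S.Θt k ω) ≤ 4 * S.beta k ω ^ 2 := by
    refine (colQuad_mono hV _).trans ?_
    have h4 := weightedNorm_sub_le hVt hV0 (S.Θs - S.Θhat k ω) (S.Θt k ω - S.Θhat k ω)
    rw [sub_sub_sub_cancel_right] at h4
    linarith [hsq _ h1, hsq _ h2]
  have htr : ((S.reg k ω)⁻¹ * S.psum₁ k k ω).trace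
      = ∑ h ∈ Icc 1 S.H, quad (S.reg k ω)⁻¹ (S.z k h ω) := by
    rw [psum₁, Icc_self, sum_singleton, Matrix.mul_sum, Matrix.trace_sum]
    exact sum_congr rfl fun h _ => trace_mul_vecMulVec _ _
  rw [predErr_eq_sum_z, htr, mul_sum]
  refine sum_le_sum fun h _ => (transpose_mulVec_sq_le_colQuad hG _ _).trans ?_
  exact mul_le_mul_of_nonneg_right h3 (quad_nonneg_of_posDef hG.inv _)

theorem trace_inv_reg_mul_nonneg (hlam : 0 < S.lam) (k : ℕ) (ω : Ω) :
    0 ≤ ((S.reg k ω)⁻¹ * S.psum₁ k k ω).trace := by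
  rw [psum₁, Icc_self, sum_singleton, Matrix.mul_sum, Matrix.trace_sum]
  refine sum_nonneg fun h _ => ?_
  rw [trace_mul_vecMulVec]
  exact quad_nonneg_of_posDef (posDef_reg hlam k ω).inv _

theorem log_det_gram_le (hlam : 0 < S.lam) (hγ : 0 ≤ S.γ) {K k : ℕ} (hk : k ≤ K + 1) {ω : Ω}
    (hz : ∀ k' ∈ Icc 1 K, ∀ h ∈ Icc 1 S.H, S.z k' h ω ⬝ᵥ S.z k' h ω ≤ (1 + S.γ) ^ 2) :
    Real.log (1 + S.lam⁻¹ • S.gram k ω).det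
      ≤ (n + d) * Real.log (1 + K * S.H * (1 + S.γ) ^ 2 / S.lam) := by
  have hq : ∀ v, 0 ≤ quad (S.lam⁻¹ • S.gram k ω) v := fun v => by
    rw [quad_smul_left]
    exact mul_nonneg (by positivity) (quad_psum₁_nonneg _ _ _ _)
  have ht : (S.lam⁻¹ • S.gram k ω)ᵀ = S.lam⁻¹ • S.gram k ω := by
    rw [Matrix.transpose_smul, gram, psum₁_transpose]
  have hpos : 0 < (1 + S.lam⁻¹ • S.gram k ω).det := by
    have h := (posDef_reg hlam k ω).det_pos
    rw [reg, det_smul_one_add hlam] at h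
    exact pos_of_mul_pos_right h (by positivity)
  have h1 := det_one_add_le ht hq
  have htr : (S.gram k ω).trace ≤ K * S.H * (1 + S.γ) ^ 2 := by
    rw [gram, psum₁, Matrix.trace_sum]
    simp only [Matrix.trace_sum, Matrix.trace_vecMulVec]
    calc _ ≤ ∑ k' ∈ Icc 1 (k - 1), ∑ h ∈ Icc 1 S.H, (1 + S.γ) ^ 2 :=
          sum_le_sum fun k' hk' => sum_le_sum fun h hh =>
            hz k' (by simp only [mem_Icc] at hk' ⊢; omega) h hh
      _ = ((k - 1 : ℕ) : ℝ) * S.H * (1 + S.γ) ^ 2 := by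
          simp only [sum_const, Nat.card_Icc, nsmul_eq_mul, Nat.add_sub_cancel]; ring
      _ ≤ _ := by
          have : ((k - 1 : ℕ) : ℝ) ≤ K := by exact_mod_cast (by omega : k - 1 ≤ K)
          gcongr
  have htr0 : 0 ≤ (S.lam⁻¹ • S.gram k ω).trace := by
    rw [Matrix.trace_smul, gram, psum₁, Matrix.trace_sum]
    simp only [Matrix.trace_sum, Matrix.trace_vecMulVec]
    exact mul_nonneg (by positivity)
      (sum_nonneg fun _ _ => sum_nonneg fun _ _ => dotProduct_self_nonneg_real _)
  have h2 : (1 + S.lam⁻¹ • S.gram k ω).det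
      ≤ (1 + K * S.H * (1 + S.γ) ^ 2 / S.lam) ^ (n + d) := by
    refine h1.trans ?_
    simp only [Fintype.card_sum, Fintype.card_fin]
    refine pow_le_pow_left₀ (by linarith) ?_ _
    rw [Matrix.trace_smul, smul_eq_mul, div_eq_inv_mul]
    gcongr
  have h3 := Real.log_le_log hpos h2
  rw [Real.log_pow] at h3
  exact_mod_cast h3

theorem min_one_le_two_mul_log {t : ℝ} (ht : 0 ≤ t) : min 1 t ≤ 2 * Real.log (1 + t) := by
  set s := min 1 t with hs
  have hs0 : 0 ≤ s := le_min zero_le_one ht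
  have hs1 : s ≤ 1 := min_le_left _ _
  have h1 := Real.one_sub_inv_le_log_of_pos (show 0 < 1 + s by linarith)
  have h2 : Real.log (1 + s) ≤ Real.log (1 + t) :=
    Real.log_le_log (by linarith) (by linarith [min_le_right 1 t])
  have h3 : s / 2 ≤ 1 - (1 + s)⁻¹ := by
    have : 1 - (1 + s)⁻¹ = s / (1 + s) := by field_simp; ring
    rw [this]
    exact div_le_div_of_nonneg_left hs0 (by linarith) (by linarith)
  linarith

/-- The elliptical potential bound with one rank-`H` update per episode. -/
theorem sum_min_one_trace_le (hlam : 0 < S.lam) (K : ℕ) (ω : Ω) :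
    ∑ k ∈ Icc 1 K, min 1 ((S.reg k ω)⁻¹ * S.psum₁ k k ω).trace
      ≤ 2 * Real.log (1 + S.lam⁻¹ • S.gram (K + 1) ω).det := by
  have hpos : ∀ k, 0 < (1 + S.lam⁻¹ • S.gram k ω).det := fun k => by
    have h := (posDef_reg hlam k ω).det_pos
    rw [reg, det_smul_one_add hlam] at h
    exact pos_of_mul_pos_right h (by positivity)
  induction K with
  | zero => simp [gram, psum₁]
  | succ K ih =>
    rw [sum_Icc_succ_top (by omega)]
    set t := ((S.reg (K + 1) ω)⁻¹ * S.psum₁ (K + 1) (K + 1) ω).trace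
    have ht : 0 ≤ t := trace_inv_reg_mul_nonneg hlam _ _
    have hg : S.gram (K + 1 + 1) ω = S.gram (K + 1) ω + S.psum₁ (K + 1) (K + 1) ω := by
      simp only [gram, psum₁, Nat.add_sub_cancel]
      rw [sum_Icc_succ_top (by omega), Icc_self, sum_singleton]
    have h := det_mul_one_add_trace_le (posDef_reg hlam (K + 1) ω)
      (S.psum₁_transpose (K + 1) (K + 1) ω) (S.quad_psum₁_nonneg _ _ _)
    nth_rewrite 1 [reg] at h
    nth_rewrite 2 [reg] at h
    rw [add_assoc, ← hg, det_smul_one_add hlam, det_smul_one_add hlam, mul_assoc] at h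
    have h2 := le_of_mul_le_mul_left h (by positivity)
    have h3 := Real.log_le_log (mul_pos (hpos _) (by linarith)) h2
    rw [Real.log_mul (hpos _).ne' (by linarith)] at h3
    linarith [min_one_le_two_mul_log ht]

end Run

end GoodEvents

end PrivateLQ

namespace PrivateLQ

/-! ### Size of the confidence radius -/

namespace Run

section Radius

variable {n d : ℕ} {Ω : Type*} (S : Run n d Ω)

/-- The logarithm bounding the growth of the Gram matrix per dimension. -/
noncomputable def logGram : ℝ := Real.log (1 + S.K * S.H * (1 + S.γ) ^ 2 / S.lam)

/-- A deterministic bound for the confidence radii. -/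
noncomputable def betaMax : ℝ :=
  S.Cw * √(2 * Real.log (2 / S.α) + n * ((n + d) * S.logGram)) + √S.lamMax + S.nu

/-- The order of magnitude of the privacy noise: the square of `ln(2/δ)^(1/4) / ε^(1/2)`. -/
noncomputable def privacyScale : ℝ := √(Real.log (2 / S.δ)) / S.ε

variable {S}

theorem m_le (hK : 2 ≤ S.K) : (S.m : ℝ) ≤ 3 * Real.log S.K := by
  have hKr : (2 : ℝ) ≤ S.K := by exact_mod_cast hK
  have hl2 := Real.log_two_gt_d9
  have hlK : Real.log 2 ≤ Real.log S.K := Real.log_le_log (by norm_num) hKr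
  have hm1 : 1 ≤ S.m := Nat.clog_pos one_lt_two hK
  have h := Nat.pow_pred_clog_lt_self one_lt_two (show 1 < S.K by omega)
  have h' : (2 : ℝ) ^ (S.m - 1) ≤ S.K := by exact_mod_cast h.le
  have h2 := Real.log_le_log (by positivity) h'
  rw [Real.log_pow, Nat.cast_sub hm1, Nat.cast_one] at h2
  nlinarith

theorem half_le_log (hK : 2 ≤ S.K) : 1 / 2 ≤ Real.log S.K := by
  have hKr : (2 : ℝ) ≤ S.K := by exact_mod_cast hK
  have := Real.log_le_log (by norm_num) hKr
  linarith [Real.log_two_gt_d9]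

theorem privacyScale_pos (hε : 0 < S.ε) (hδ : 0 < S.δ) (hδ1 : S.δ ≤ 1) : 0 < S.privacyScale := by
  have hl : 0 < Real.log (2 / S.δ) := Real.log_pos (by rw [lt_div_iff₀ hδ]; linarith)
  unfold privacyScale
  positivity

theorem lam_eq (hκ : 0 < S.κ) (hγ : 0 ≤ S.γ) (hε : 0 < S.ε) (hδ : 0 < S.δ) (hδ1 : S.δ ≤ 1) :
    S.lam = √S.κ * S.m * S.H * (1 + S.γ) ^ 2 * S.privacyScale *
      (4 * √((n : ℝ) + d) + √(8 * Real.log (4 * S.K / S.α))) := by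
  have hl : 0 ≤ Real.log (2 / S.δ) := Real.log_nonneg (by rw [le_div_iff₀ hδ]; linarith)
  have h1 : √S.var₁ * √(S.m : ℝ)
      = √S.κ * S.m * S.H * (1 + S.γ) ^ 2 * S.privacyScale := by
    rw [← Real.sqrt_mul (by unfold var₁; positivity), var₁]
    refine (Real.sqrt_eq_iff_mul_self_eq (by positivity) (by unfold privacyScale; positivity)).2 ?_
    unfold privacyScale
    field_simp
    rw [Real.sq_sqrt hκ.le, Real.sq_sqrt hl]
    ring
  rw [lam, h1]

theorem lam_pos (hK : 2 ≤ S.K) (hH : 1 ≤ S.H) (hn : 1 ≤ n) (hκ : 0 < S.κ) (hγ : 0 ≤ S.γ)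
    (hε : 0 < S.ε) (hδ : 0 < S.δ) (hδ1 : S.δ ≤ 1) : 0 < S.lam := by
  have hm : (0 : ℝ) < S.m := by exact_mod_cast Nat.clog_pos one_lt_two hK
  have hH' : (0 : ℝ) < S.H := by exact_mod_cast hH
  have hn' : (0 : ℝ) < n := by exact_mod_cast hn
  have := S.privacyScale_pos hε hδ hδ1
  rw [lam_eq hκ hγ hε hδ hδ1]
  have : 0 < 4 * √((n : ℝ) + d) + √(8 * Real.log (4 * S.K / S.α)) := by positivity
  positivity

/-- The growth of the Gram matrix is polynomial in `K`, because `Λ` is proportional to `H / ε` and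
`ε ≤ K ^ q`. -/
theorem logGram_le (hK : 2 ≤ S.K) (hH : 1 ≤ S.H) (hn : 1 ≤ n) (hκ : 0 < S.κ) (hγ : 0 ≤ S.γ)
    (hε : 0 < S.ε) (hδ : 0 < S.δ) (hδ1 : S.δ ≤ 1) {q : ℝ} (hq : S.ε ≤ (S.K : ℝ) ^ q) :
    S.logGram ≤ (2 * Real.log (1 + 1 / √S.κ) + 1 + |q|) * Real.log S.K := by
  have hKr : (2 : ℝ) ≤ S.K := by exact_mod_cast hK
  have hK0 : (0 : ℝ) < S.K := by linarith
  have hm : (1 : ℝ) ≤ S.m := by exact_mod_cast Nat.clog_pos one_lt_two hK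
  have hH' : (1 : ℝ) ≤ S.H := by exact_mod_cast hH
  have hn' : (1 : ℝ) ≤ n := by exact_mod_cast hn
  have hκ' : 0 < √S.κ := Real.sqrt_pos.2 hκ
  have hr := S.privacyScale_pos hε hδ hδ1
  have hlog := half_le_log hK
  have hlam := lam_pos hK hH hn hκ hγ hε hδ hδ1
  set r := S.privacyScale with hrdef
  have hKq : 0 < (S.K : ℝ) ^ |q| := Real.rpow_pos_of_pos hK0 _
  -- `Λ ≥ 4 √κ H (1 + γ)² r` and `r ≥ 1 / (2 K ^ |q|)`
  have hr2 : 1 ≤ 2 * r * (S.K : ℝ) ^ |q| := by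
    have h1 : 1 / 2 ≤ √(Real.log (2 / S.δ)) := by
      refine Real.le_sqrt_of_sq_le ?_
      have : Real.log 2 ≤ Real.log (2 / S.δ) :=
        Real.log_le_log (by norm_num) (by rw [le_div_iff₀ hδ]; linarith)
      linarith [Real.log_two_gt_d9]
    have h2 : S.ε ≤ (S.K : ℝ) ^ |q| :=
      hq.trans (Real.rpow_le_rpow_of_exponent_le (by linarith) (le_abs_self q))
    rw [hrdef, privacyScale]
    rw [← mul_div_assoc, div_mul_eq_mul_div, le_div_iff₀ hε]
    nlinarith
  have hlam2 : 4 * √S.κ * S.H * (1 + S.γ) ^ 2 * r ≤ S.lam := by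
    rw [lam_eq hκ hγ hε hδ hδ1]
    have h1 : 4 ≤ 4 * √((n : ℝ) + d) + √(8 * Real.log (4 * S.K / S.α)) := by
      have h2 : 1 ≤ √((n : ℝ) + d) := by
        rw [Real.one_le_sqrt]
        have : (0 : ℝ) ≤ d := Nat.cast_nonneg d
        linarith
      linarith [Real.sqrt_nonneg (8 * Real.log (4 * S.K / S.α))]
    calc 4 * √S.κ * S.H * (1 + S.γ) ^ 2 * r
        = √S.κ * 1 * S.H * (1 + S.γ) ^ 2 * r * 4 := by ring
      _ ≤ _ := by gcongr
  have hfrac : S.K * S.H * (1 + S.γ) ^ 2 / S.lam ≤ 1 / √S.κ * (S.K * (S.K : ℝ) ^ |q|) := by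
    rw [div_le_iff₀ hlam]
    have h0 : 0 ≤ 1 / √S.κ * (S.K * (S.K : ℝ) ^ |q|) := by positivity
    refine le_trans ?_ (mul_le_mul_of_nonneg_left hlam2 h0)
    have e : 1 / √S.κ * (S.K * (S.K : ℝ) ^ |q|) * (4 * √S.κ * S.H * (1 + S.γ) ^ 2 * r)
        = S.K * S.H * (1 + S.γ) ^ 2 * (2 * (2 * r * (S.K : ℝ) ^ |q|)) := by
      field_simp; ring
    rw [e]
    have h1 : (0 : ℝ) ≤ S.K * S.H * (1 + S.γ) ^ 2 := by positivity
    nlinarith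
  have hone : 1 ≤ S.K * (S.K : ℝ) ^ |q| := by
    have := Real.one_le_rpow (show (1 : ℝ) ≤ S.K by linarith) (abs_nonneg q)
    nlinarith
  have hb : 1 + S.K * S.H * (1 + S.γ) ^ 2 / S.lam
      ≤ (1 + 1 / √S.κ) * (S.K * (S.K : ℝ) ^ |q|) := by nlinarith
  have hpos : 0 < 1 + S.K * S.H * (1 + S.γ) ^ 2 / S.lam := by positivity
  have h := Real.log_le_log hpos hb
  rw [Real.log_mul (by positivity) (by positivity), Real.log_mul hK0.ne' hKq.ne',
    Real.log_rpow hK0] at h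
  have hl : 0 ≤ Real.log (1 + 1 / √S.κ) := Real.log_nonneg (by
    have : 0 ≤ 1 / √S.κ := by positivity
    linarith)
  unfold logGram
  nlinarith

theorem nu_nonneg : 0 ≤ S.nu := by unfold nu; positivity

theorem nu_sq_le (hK : 2 ≤ S.K) (hH : 1 ≤ S.H) (hn : 1 ≤ n) (hκ : 0 < S.κ) (hγ : 0 ≤ S.γ)
    (hε : 0 < S.ε) (hδ : 0 < S.δ) (hδ1 : S.δ ≤ 1) (hα : 0 < S.α) (hα1 : S.α ≤ 1) :
    S.nu ^ 2 ≤ √S.κ * S.m * S.H * S.privacyScale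
      * ((n : ℝ) * (n + d) + 3 * √(Real.log (4 * S.K / S.α))) := by
  have hKr : (2 : ℝ) ≤ S.K := by exact_mod_cast hK
  have hm : (1 : ℝ) ≤ S.m := by exact_mod_cast Nat.clog_pos one_lt_two hK
  have hH' : (1 : ℝ) ≤ S.H := by exact_mod_cast hH
  have hn' : (1 : ℝ) ≤ n := by exact_mod_cast hn
  have hd' : (0 : ℝ) ≤ d := Nat.cast_nonneg d
  have hκ' : 0 < √S.κ := Real.sqrt_pos.2 hκ
  have hr := S.privacyScale_pos hε hδ hδ1
  have hlam := lam_pos hK hH hn hκ hγ hε hδ hδ1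
  have hl : 0 < Real.log (2 / S.δ) := Real.log_pos (by rw [lt_div_iff₀ hδ]; linarith)
  have hL0 : 0 ≤ Real.log (2 * S.K / S.α) := Real.log_nonneg (by rw [le_div_iff₀ hα]; linarith)
  have hLL : Real.log (2 * S.K / S.α) ≤ Real.log (4 * S.K / S.α) :=
    Real.log_le_log (by positivity) (by gcongr; norm_num)
  have hvar : S.var₂ = (√S.κ) ^ 2 * S.m * (S.H * (1 + S.γ)) ^ 2 * S.privacyScale ^ 2 := by
    rw [Real.sq_sqrt hκ.le, privacyScale, div_pow, Real.sq_sqrt hl.le, var₂]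
    ring
  have hvar0 : 0 ≤ S.var₂ := by rw [hvar]; positivity
  have hlam' := lam_eq (n := n) (d := d) (S := S) hκ hγ hε hδ hδ1
  set D : ℝ := (n : ℝ) + d with hD
  set L := Real.log (4 * S.K / S.α)
  set L' := Real.log (2 * S.K / S.α)
  set Z := 4 * √D + √(8 * L) with hZ
  have hnudef : S.nu = √S.var₂ * √(S.m / S.lam) * (√(2 * n * D) + √(4 * L')) := rfl
  have hD1 : 1 ≤ D := by rw [hD]; linarith
  have hnD : 0 ≤ n * D := mul_nonneg (by linarith) (by linarith)
  clear_value L L' D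
  have hsD : 1 ≤ √D := by rw [Real.one_le_sqrt]; linarith
  have hZ0 : 0 < Z := by positivity
  have h8 : √(8 * L) = √8 * √L := Real.sqrt_mul (by norm_num) _
  have hs8 : 8 / 3 ≤ √8 := Real.le_sqrt_of_sq_le (by norm_num)
  have hLsq := Real.mul_self_sqrt (hL0.trans hLL)
  have hs : (√(2 * n * D) + √(4 * L')) ^ 2 ≤ Z * (n * D + 3 * √L) := by
    have a1 := Real.sq_sqrt (show 0 ≤ 2 * n * D by rw [mul_assoc]; linarith)
    have a2 := Real.sq_sqrt (show 0 ≤ 4 * L' by positivity)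
    have h1 : (√(2 * n * D) + √(4 * L')) ^ 2 ≤ 2 * (2 * n * D) + 2 * (4 * L') := by
      linarith [add_sq (√(2 * n * D)) (√(4 * L')), two_mul_le_add_sq (√(2 * n * D)) (√(4 * L'))]
    have h2 : 4 * (n * D) ≤ 4 * √D * (n * D) :=
      mul_le_mul_of_nonneg_right (by linarith) hnD
    have h3 : 8 * L ≤ √(8 * L) * (3 * √L) := by
      rw [h8]
      calc 8 * L = 8 / 3 * 3 * (√L * √L) := by rw [hLsq]; ring
        _ ≤ √8 * 3 * (√L * √L) := by gcongr
        _ = _ := by ring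
    have h4 : 0 ≤ √(8 * L) * (n * D) := mul_nonneg (Real.sqrt_nonneg _) hnD
    have h5 : 0 ≤ 4 * √D * (3 * √L) := by positivity
    have e : Z * (n * D + 3 * √L) = 4 * √D * (n * D) + 4 * √D * (3 * √L)
        + √(8 * L) * (n * D) + √(8 * L) * (3 * √L) := by rw [hZ]; ring
    rw [e]
    linarith
  have hnu : S.nu ^ 2 = √S.κ * S.m * S.H * S.privacyScale * ((√(2 * n * D) + √(4 * L')) ^ 2 / Z) := by
    have haux : ∀ a m H g r z s : ℝ, 0 < a → 0 < m → 0 < H → 0 < g → 0 < r → 0 < z →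
        a ^ 2 * m * (H * g) ^ 2 * r ^ 2 * (m / (a * m * H * g ^ 2 * r * z)) * s
          = a * m * H * r * (s / z) := by
      intros; field_simp
    rw [hnudef, mul_pow, mul_pow, Real.sq_sqrt hvar0, Real.sq_sqrt (by positivity), hvar, hlam']
    exact haux _ _ _ _ _ _ _ hκ' (by linarith) (by linarith) (by linarith) hr hZ0
  rw [hnu]
  gcongr
  rw [div_le_iff₀ hZ0]
  linarith

/-- The square of the confidence radius, up to constants. -/
theorem betaMax_sq_le (hK : 2 ≤ S.K) (hH : 1 ≤ S.H) (hn : 1 ≤ n) (hκ : 0 < S.κ) (hγ : 0 ≤ S.γ)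
    (hε : 0 < S.ε) (hδ : 0 < S.δ) (hδ1 : S.δ ≤ 1) (hα : 0 < S.α) (hα1 : S.α ≤ 1)
    (hCw : 0 ≤ S.Cw) (hCw1 : S.Cw ≤ 1) {cl : ℝ} (hcl : S.logGram ≤ cl * Real.log S.K) :
    S.betaMax ^ 2 ≤ (6 + 3 * cl) * (n * (n + d) * Real.log S.K + Real.log (1 / S.α))
      + 270 * √S.κ * (1 + S.γ) ^ 2 * S.H * Real.log S.K * S.privacyScale
        * (n * (n + d) + √(Real.log (S.K / S.α))) := by
  have hKr : (2 : ℝ) ≤ S.K := by exact_mod_cast hK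
  have hm : (1 : ℝ) ≤ S.m := by exact_mod_cast Nat.clog_pos one_lt_two hK
  have hm3 := m_le hK
  have hH' : (1 : ℝ) ≤ S.H := by exact_mod_cast hH
  have hn' : (1 : ℝ) ≤ n := by exact_mod_cast hn
  have hd' : (0 : ℝ) ≤ d := Nat.cast_nonneg d
  have hκ' : 0 < √S.κ := Real.sqrt_pos.2 hκ
  have hr := S.privacyScale_pos hε hδ hδ1
  have hlam := lam_pos hK hH hn hκ hγ hε hδ hδ1
  have hnu := nu_sq_le hK hH hn hκ hγ hε hδ hδ1 hα hα1
  have hlam' := lam_eq (n := n) (d := d) (S := S) hκ hγ hε hδ hδ1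
  have hlogK := half_le_log hK
  have hlog2K : Real.log 2 ≤ Real.log S.K := Real.log_le_log (by norm_num) hKr
  have ha : 0 ≤ Real.log (1 / S.α) := Real.log_nonneg (by rw [le_div_iff₀ hα]; linarith)
  have hα2 : Real.log (2 / S.α) = Real.log 2 + Real.log (1 / S.α) := by
    rw [← Real.log_mul (by norm_num) (by positivity)]; congr 1; ring
  have hlam0 : 0 ≤ Real.log (S.K / S.α) := Real.log_nonneg (by rw [le_div_iff₀ hα]; linarith)
  have hL : Real.log (4 * S.K / S.α) ≤ 3 * Real.log (S.K / S.α) := by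
    have h1 : Real.log (4 * S.K / S.α) = Real.log 4 + Real.log (S.K / S.α) := by
      rw [mul_div_assoc, Real.log_mul (by norm_num) (by positivity)]
    have h2 : Real.log 4 = 2 * Real.log 2 := by
      rw [show (4 : ℝ) = 2 ^ 2 by norm_num, Real.log_pow]; norm_num
    have h3 : Real.log 2 ≤ Real.log (S.K / S.α) :=
      Real.log_le_log (by norm_num) (by rw [le_div_iff₀ hα]; linarith)
    linarith
  have hsL : √(Real.log (4 * S.K / S.α)) ≤ 2 * √(Real.log (S.K / S.α)) := by
    rw [show (2 : ℝ) = √4 by rw [show (4 : ℝ) = 2 ^ 2 by norm_num, Real.sqrt_sq (by norm_num)],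
      ← Real.sqrt_mul (by norm_num)]
    exact Real.sqrt_le_sqrt (by linarith)
  set r := S.privacyScale
  set L := Real.log (4 * S.K / S.α)
  set lv := √(Real.log (S.K / S.α)) with hlv
  clear_value r L
  have hlv0 : 0 ≤ lv := Real.sqrt_nonneg _
  have hD1 : 1 ≤ (n : ℝ) + d := by linarith
  have hsD : √((n : ℝ) + d) ≤ n * (n + d) := by
    have h1 : √((n : ℝ) + d) ≤ n + d :=
      Real.sqrt_le_left (by linarith) |>.mpr (le_self_pow₀ hD1 two_ne_zero)
    exact h1.trans (le_mul_of_one_le_left (by linarith) hn')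
  have h8L : √(8 * L) ≤ 3 * √L := by
    rw [Real.sqrt_mul (by norm_num)]
    have : √8 ≤ 3 := Real.sqrt_le_left (by norm_num) |>.mpr (by norm_num)
    have := Real.sqrt_nonneg L
    gcongr
  set N : ℝ := n * (n + d) with hN
  have hN1 : 1 ≤ N := one_le_mul_of_one_le_of_one_le hn' hD1
  set E := √S.κ * S.m * S.H * r with hE
  have hE0 : 0 ≤ E := by
    have h1 : (0 : ℝ) ≤ S.m := by linarith
    have h2 : (0 : ℝ) ≤ S.H := by linarith
    exact mul_nonneg (mul_nonneg (mul_nonneg hκ'.le h1) h2) hr.le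
  clear_value E N
  have hg1 : 1 ≤ (1 + S.γ) ^ 2 := one_le_pow₀ (by linarith)
  have hlamle : S.lam ≤ (1 + S.γ) ^ 2 * E * (4 * N + 6 * lv) := by
    rw [hlam']
    calc _ = (1 + S.γ) ^ 2 * E * (4 * √((n : ℝ) + d) + √(8 * L)) := by rw [hE]; ring
      _ ≤ _ := by
        refine mul_le_mul_of_nonneg_left ?_ (by positivity)
        linarith
  have hnule : S.nu ^ 2 ≤ (1 + S.γ) ^ 2 * E * (N + 6 * lv) := by
    refine hnu.trans ?_
    have h1 : N + 3 * √L ≤ N + 6 * lv := by linarith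
    have h2 : 0 ≤ N + 6 * lv := by positivity
    calc E * (N + 3 * √L) ≤ E * (N + 6 * lv) := by gcongr
      _ ≤ (1 + S.γ) ^ 2 * (E * (N + 6 * lv)) := le_mul_of_one_le_left (by positivity) hg1
      _ = _ := by ring
  have hlg0 : 0 ≤ S.logGram := Real.log_nonneg (by
    have : 0 ≤ S.K * S.H * (1 + S.γ) ^ 2 / S.lam := by positivity
    linarith)
  have hroot : (S.Cw * √(2 * Real.log (2 / S.α) + n * ((n + d) * S.logGram))) ^ 2
      ≤ 2 * (Real.log S.K + Real.log (1 / S.α)) + N * (cl * Real.log S.K) := by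
    have h0 : 0 ≤ 2 * Real.log (2 / S.α) + n * ((n + d) * S.logGram) := by
      rw [hα2]
      have := Real.log_two_gt_d9
      positivity
    rw [mul_pow, Real.sq_sqrt h0]
    refine (mul_le_of_le_one_left h0 (pow_le_one₀ hCw hCw1)).trans ?_
    have h1 : (n : ℝ) * ((n + d) * S.logGram) ≤ N * (cl * Real.log S.K) := by
      rw [← mul_assoc, ← hN]
      exact mul_le_mul_of_nonneg_left hcl (by linarith)
    rw [hα2]
    linarith
  have hsq3 : ∀ x y z : ℝ, (x + y + z) ^ 2 ≤ 3 * (x ^ 2 + y ^ 2 + z ^ 2) := fun x y z => by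
    linarith [sq_nonneg (x - y), sq_nonneg (y - z), sq_nonneg (x - z)]
  have hmax : √S.lamMax ^ 2 = 3 * S.lam := by
    rw [Real.sq_sqrt (by unfold lamMax; positivity), lamMax]
  have hEle : E ≤ √S.κ * (3 * Real.log S.K) * S.H * r := by
    rw [hE]; gcongr
  have hfin : 3 * (3 * S.lam + S.nu ^ 2)
      ≤ 270 * √S.κ * (1 + S.γ) ^ 2 * S.H * Real.log S.K * r * (N + lv) := by
    calc 3 * (3 * S.lam + S.nu ^ 2)
        ≤ 3 * (3 * ((1 + S.γ) ^ 2 * E * (4 * N + 6 * lv)) + (1 + S.γ) ^ 2 * E * (N + 6 * lv)) := by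
          linarith
      _ = (1 + S.γ) ^ 2 * E * (39 * N + 72 * lv) := by ring
      _ ≤ (1 + S.γ) ^ 2 * (√S.κ * (3 * Real.log S.K) * S.H * r) * (90 * (N + lv)) := by
          have h1 : 39 * N + 72 * lv ≤ 90 * (N + lv) := by linarith
          gcongr
      _ = _ := by ring
  have hNK : Real.log S.K ≤ N * Real.log S.K := le_mul_of_one_le_left (by linarith) hN1
  have hcl0 : 0 ≤ cl := by
    by_contra! hc
    linarith [mul_neg_of_neg_of_pos hc (show 0 < Real.log S.K by linarith)]
  have hcla : 0 ≤ cl * Real.log (1 / S.α) := mul_nonneg hcl0 ha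
  refine (hsq3 _ _ _).trans ?_
  rw [hmax]
  have e : (6 + 3 * cl) * (N * Real.log S.K + Real.log (1 / S.α))
      = 6 * (N * Real.log S.K) + 3 * (N * (cl * Real.log S.K)) + 6 * Real.log (1 / S.α)
        + 3 * (cl * Real.log (1 / S.α)) := by ring
  rw [e]
  linarith

end Radius

end Run

end PrivateLQ

namespace PrivateLQ

/-! ### The regret on the good events -/

theorem sum_one_div_sqrt_le (K : ℕ) : ∑ k ∈ Icc 1 K, 1 / √(k : ℝ) ≤ 2 * √(K : ℝ) := by
  induction K with
  | zero => simp
  | succ K ih =>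
    rw [sum_Icc_succ_top (by omega)]
    have h0 : 0 < √((K : ℝ) + 1) := by positivity
    have h1 : √(K : ℝ) ≤ √((K : ℝ) + 1) := Real.sqrt_le_sqrt (by linarith)
    have a1 := Real.sq_sqrt (show (0 : ℝ) ≤ K by positivity)
    have a2 := Real.sq_sqrt (show (0 : ℝ) ≤ (K : ℝ) + 1 by positivity)
    have h2 : 1 / √((K : ℝ) + 1) ≤ 2 * (√((K : ℝ) + 1) - √(K : ℝ)) := by
      rw [div_le_iff₀ h0]
      nlinarith [Real.sqrt_nonneg (K : ℝ)]
    push_cast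
    linarith

namespace Run

variable {n d : ℕ} {Ω : Type*} {S : Run n d Ω} {C CA CB : ℝ}

theorem beta_nonneg (hCw : 0 ≤ S.Cw) (k : ℕ) (ω : Ω) : 0 ≤ S.beta k ω := by
  unfold beta
  have := S.nu_nonneg
  positivity

/-- The sum of the prediction errors, by the elliptical potential bound. -/
theorem sum_predErr_le (hlam : 0 < S.lam) (hγ : 0 ≤ S.γ) (hCw : 0 ≤ S.Cw) {ω : Ω}
    (hz : ∀ k ∈ Icc 1 S.K, ∀ h ∈ Icc 1 S.H, S.z k h ω ⬝ᵥ S.z k h ω ≤ (1 + S.γ) ^ 2)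
    (hX : ∀ k ∈ Icc 1 S.K, predErr S.Q S.R S.H S.Θs (S.Θt k ω) (fun i => S.w k i ω) (S.x₁ k ω)
      ≤ 4 * (1 + S.γ) ^ 2 * S.H)
    (hV : ∀ k ∈ Icc 1 S.K, ∀ v, quad (S.reg k ω) v ≤ quad (S.V k ω) v)
    (hVt : ∀ k ∈ Icc 1 S.K, (S.V k ω)ᵀ = S.V k ω)
    (h1 : ∀ k ∈ Icc 1 S.K, S.Θs ∈ S.confSet k ω)
    (h2 : ∀ k ∈ Icc 1 S.K, S.Θt k ω ∈ S.confSet k ω) :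
    ∑ k ∈ Icc 1 S.K, predErr S.Q S.R S.H S.Θs (S.Θt k ω) (fun i => S.w k i ω) (S.x₁ k ω)
      ≤ (4 * (1 + S.γ) ^ 2 * S.H + 4 * S.betaMax ^ 2) * (2 * ((n + d) * S.logGram)) := by
  have hb : 0 ≤ 4 * (1 + S.γ) ^ 2 * (S.H : ℝ) := by positivity
  have hlog : ∀ k ∈ Icc 1 S.K, S.beta k ω ^ 2 ≤ S.betaMax ^ 2 := by
    intro k hk
    refine pow_le_pow_left₀ (beta_nonneg hCw k ω) ?_ 2
    have h := log_det_gram_le hlam hγ (k := k) (by have := mem_Icc.1 hk; omega) hz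
    have hroot : √(2 * Real.log (2 / S.α) + n * Real.log (1 + S.lamMin⁻¹ • S.gram k ω).det)
        ≤ √(2 * Real.log (2 / S.α) + n * ((n + d) * S.logGram)) := by
      refine Real.sqrt_le_sqrt ?_
      rw [lamMin]
      unfold logGram
      gcongr
    unfold beta betaMax
    gcongr
  calc _ ≤ ∑ k ∈ Icc 1 S.K, (4 * (1 + S.γ) ^ 2 * S.H + 4 * S.betaMax ^ 2)
        * min 1 ((S.reg k ω)⁻¹ * S.psum₁ k k ω).trace := by
        refine sum_le_sum fun k hk => ?_
        have h3 := predErr_le_of_mem_confSet hlam (hV k hk) (hVt k hk) (h1 k hk) (h2 k hk)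
        have h4 := trace_inv_reg_mul_nonneg hlam k ω
        have h5 := hlog k hk
        set t := ((S.reg k ω)⁻¹ * S.psum₁ k k ω).trace
        rcases le_total 1 t with ht | ht
        · rw [min_eq_left ht]
          have := hX k hk
          nlinarith [sq_nonneg S.betaMax]
        · rw [min_eq_right ht]
          refine h3.trans ?_
          have := mul_nonneg hb h4
          nlinarith
    _ = (4 * (1 + S.γ) ^ 2 * S.H + 4 * S.betaMax ^ 2)
        * ∑ k ∈ Icc 1 S.K, min 1 ((S.reg k ω)⁻¹ * S.psum₁ k k ω).trace := by rw [mul_sum]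
    _ ≤ _ := by
        refine mul_le_mul_of_nonneg_left ?_ (by positivity)
        refine (sum_min_one_trace_le hlam S.K ω).trans ?_
        have := log_det_gram_le hlam hγ (k := S.K + 1) le_rfl hz
        unfold logGram
        linarith

section Probability

variable [MeasurableSpace Ω] {μ : Measure Ω} [IsProbabilityMeasure μ]

/-- The regret in terms of the prediction errors, with a free parameter `θ`. -/
theorem regret_le_of_sum_predErr_le (hS : S.StochasticModel μ) {c : ℝ}
    (hex : ∀ (w : ℕ → Ω → Fin n → ℝ), EpisodeNoise μ S.H S.Cw w →
      ∀ Θt ∈ paramSet n d, ∀ x : Fin n → ℝ, euclNorm x ≤ 1 →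
      optCost μ S.Q S.R S.H w Θt 1 x ≤ optCost μ S.Q S.R S.H w S.Θs 1 x + 1 →
      ∀ θ : ℝ, 0 < θ →
      policyCost μ S.Q S.R S.H w S.Θs (gainPolicy S.Q S.R S.H Θt) 1 x
          - optCost μ S.Q S.R S.H w Θt 1 x
        ≤ θ * ∫ ω, predErr S.Q S.R S.H S.Θs Θt (fun i => w i ω) x ∂μ
          + c * (S.H : ℝ) ^ 2 / θ)
    (hΘs : S.Θs ∈ paramSet n d) {ω : Ω} (hx : ∀ k ∈ Icc 1 S.K, euclNorm (S.x₁ k ω) ≤ 1)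
    (hA : ∀ k ∈ Icc 1 S.K, S.OptimisticChoice μ k ω)
    (h1 : ∀ k ∈ Icc 1 S.K, S.Θs ∈ S.confSet k ω) {Y : ℝ}
    (hY : ∑ k ∈ Icc 1 S.K, ∫ ω', predErr S.Q S.R S.H S.Θs (S.Θt k ω) (fun i => S.w k i ω')
      (S.x₁ k ω) ∂μ ≤ Y) {θ : ℝ} (hθ : 0 < θ) :
    S.regret μ ω ≤ θ * Y + c * (S.H : ℝ) ^ 2 / θ * S.K + 2 * √(S.K : ℝ) := by
  have hk : ∀ k ∈ Icc 1 S.K,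
      policyCost μ S.Q S.R S.H (S.w k) S.Θs (S.policy k ω) 1 (S.x₁ k ω) - S.optStart μ k S.Θs ω
        ≤ θ * (∫ ω', predErr S.Q S.R S.H S.Θs (S.Θt k ω) (fun i => S.w k i ω') (S.x₁ k ω) ∂μ)
          + c * (S.H : ℝ) ^ 2 / θ + 1 / √(k : ℝ) := by
    intro k hk
    have hopt := (hA k hk).2 ⟨S.Θs, h1 k hk, hΘs⟩
    have h2 := hopt.2 S.Θs ⟨h1 k hk, hΘs⟩
    have hk1 : (1 : ℝ) ≤ k := by exact_mod_cast (mem_Icc.1 hk).1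
    have h3 : 1 / √(k : ℝ) ≤ 1 := by
      rw [div_le_one (by positivity)]
      exact Real.one_le_sqrt.2 hk1
    have h4 := hex (S.w k) (hS.episodeNoise hk) (S.Θt k ω) (hA k hk).1 (S.x₁ k ω) (hx k hk)
      (by unfold optStart at h2; linarith) θ hθ
    unfold policy
    unfold optStart at h2 ⊢
    linarith
  unfold regret
  refine (sum_le_sum hk).trans ?_
  rw [sum_add_distrib, sum_add_distrib, ← mul_sum, sum_const, Nat.card_Icc, nsmul_eq_mul,
    Nat.add_sub_cancel]
  have h5 := sum_one_div_sqrt_le S.K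
  have h6 := mul_le_mul_of_nonneg_left hY hθ.le
  linarith

/-- The good events hold together with probability at least `1 - α`. -/
theorem measure_lt_regret_le (hS : S.StochasticModel μ) (hB : S.Boundedness C CA CB)
    (hA : S.IsPrivateOFURL μ) (hsum : CA + S.γ * CB + S.Cw ≤ 1) (hCw : 0 ≤ S.Cw) (hn : 1 ≤ n)
    (hH : 1 ≤ S.H) (hK : 2 ≤ S.K) (hκ : 0 < S.κ) (hε : 0 < S.ε) (hδ : 0 < S.δ) (hδ1 : S.δ ≤ 1)
    (hα : 0 < S.α) (hα1 : S.α ≤ 1) {c : ℝ}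
    (hex : ∀ (w : ℕ → Ω → Fin n → ℝ), EpisodeNoise μ S.H S.Cw w →
      ∀ Θt ∈ paramSet n d, ∀ x : Fin n → ℝ, euclNorm x ≤ 1 →
      optCost μ S.Q S.R S.H w Θt 1 x ≤ optCost μ S.Q S.R S.H w S.Θs 1 x + 1 →
      ∀ θ : ℝ, 0 < θ →
      policyCost μ S.Q S.R S.H w S.Θs (gainPolicy S.Q S.R S.H Θt) 1 x
          - optCost μ S.Q S.R S.H w Θt 1 x
        ≤ θ * ∫ ω, predErr S.Q S.R S.H S.Θs Θt (fun i => w i ω) x ∂μ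
          + c * (S.H : ℝ) ^ 2 / θ)
    {B : ℝ} (hBound : ∃ θ : ℝ, 0 < θ ∧
      θ * (2 * ((4 * (1 + S.γ) ^ 2 * S.H + 4 * S.betaMax ^ 2) * (2 * ((n + d) * S.logGram)))
        + 2 * (4 * (1 + S.γ) ^ 2 * S.H) * Real.log (8 / S.α))
        + c * (S.H : ℝ) ^ 2 / θ * S.K + 2 * √(S.K : ℝ) ≤ B) :
    μ {ω | B < S.regret μ ω} ≤ ENNReal.ofReal S.α := by
  obtain ⟨θ, hθ, hBθ⟩ := hBound
  have hγ := hB.γ_nonneg hH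
  have hlam : 0 < S.lam := lam_pos hK hH hn hκ hγ hε hδ hδ1
  have hKr : (2 : ℝ) ≤ S.K := by exact_mod_cast hK
  -- The bad events: the noise of either counter is large (`E₁`, `E₂`), the self-normalized sum of the
  -- system noises is large (`E₃`), or the expected prediction errors exceed the actual ones (`E₄`).
  set E₁ := ⋃ k ∈ Icc 1 S.K, {ω | ∃ y, S.lam * (y ⬝ᵥ y) < |quad (S.noise₁ k ω) y|}
  set E₂ := ⋃ k ∈ Icc 1 S.K, {ω | S.nu < frobNorm (S.noise₂ k ω) / √S.lam}
  set E₃ := {ω | ∃ k ∈ Icc 1 S.K, S.Cw ^ 2 * (2 * Real.log (2 / S.α)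
        + Real.log (1 + S.lam⁻¹ • S.gram k ω).det) < colQuad (S.reg k ω)⁻¹ (S.cross k ω)}
  set E₄ := {ω | 2 * ∑ k ∈ Icc 1 S.K,
          predErr S.Q S.R S.H S.Θs (S.Θt k ω) (fun i => S.w k i ω) (S.x₁ k ω)
          + 2 * (4 * (1 + S.γ) ^ 2 * S.H) * Real.log (8 / S.α)
        < ∑ k ∈ Icc 1 S.K, ∫ ω', predErr S.Q S.R S.H S.Θs (S.Θt k ω) (fun i => S.w k i ω')
          (S.x₁ k ω) ∂μ}
  have hE₁ : μ E₁ ≤ ENNReal.ofReal (S.α / 8) := by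
    refine (measure_biUnion_finset_le _ _).trans ((sum_le_sum fun k hk =>
      measure_exists_lt_abs_quad_noise₁_le hS hn hK (mem_Icc.1 hk).1 (mem_Icc.1 hk).2
        (S.var₁_pos hK hH hκ hγ hε hδ hδ1) hα hα1).trans (le_of_eq ?_))
    rw [← ENNReal.ofReal_sum_of_nonneg fun _ _ => by positivity, sum_const, Nat.card_Icc,
      nsmul_eq_mul, Nat.add_sub_cancel]
    congr 1
    field_simp
  have hE₂ : μ E₂ ≤ ENNReal.ofReal (S.α / 4) := by
    refine (measure_biUnion_finset_le _ _).trans ((sum_le_sum fun k hk =>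
      measure_lt_frobNorm_noise₂_le hS hn hK (mem_Icc.1 hk).1 (mem_Icc.1 hk).2
        (S.var₂_pos hK hH hκ hγ hε hδ hδ1) hα hα1 hlam).trans (le_of_eq ?_))
    rw [← ENNReal.ofReal_sum_of_nonneg fun _ _ => by positivity, sum_const, Nat.card_Icc,
      nsmul_eq_mul, Nat.add_sub_cancel]
    congr 1
    field_simp
  have hE₃ : μ E₃ ≤ ENNReal.ofReal (S.α / 2) :=
    measure_exists_lt_colQuad_cross_le hS hH hCw hα hlam
  have hE₄ : μ E₄ ≤ ENNReal.ofReal (S.α / 8) :=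
    measure_lt_sum_integral_predErr_le hS hH hB hsum hA hα
  have hsub : ∀ᵐ ω ∂μ, ω ∈ {ω | B < S.regret μ ω} → ω ∈ E₁ ∪ E₂ ∪ E₃ ∪ E₄ := by
    filter_upwards [hS.norm_x₁, hS.norm_w, hA] with ω hx hw hO hω
    by_contra hnot
    simp only [Set.mem_union, not_or] at hnot
    obtain ⟨⟨⟨n1, n2⟩, n3⟩, n4⟩ := hnot
    have g1 : ∀ k ∈ Icc 1 S.K, ∀ y, |quad (S.noise₁ k ω) y| ≤ S.lam * (y ⬝ᵥ y) := by
      intro k hk y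
      by_contra! hc
      exact n1 (Set.mem_biUnion hk ⟨y, hc⟩)
    have g2 : ∀ k ∈ Icc 1 S.K, frobNorm (S.noise₂ k ω) / √S.lam ≤ S.nu := by
      intro k hk
      by_contra! hc
      exact n2 (Set.mem_biUnion hk hc)
    have g3 : ∀ k ∈ Icc 1 S.K, colQuad (S.reg k ω)⁻¹ (S.cross k ω) ≤ S.Cw ^ 2 *
        (2 * Real.log (2 / S.α) + Real.log (1 + S.lam⁻¹ • S.gram k ω).det) := by
      intro k hk
      by_contra! hc
      exact n3 ⟨k, hk, hc⟩
    have g4 : ∑ k ∈ Icc 1 S.K, ∫ ω', predErr S.Q S.R S.H S.Θs (S.Θt k ω)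
        (fun i => S.w k i ω') (S.x₁ k ω) ∂μ
        ≤ 2 * ∑ k ∈ Icc 1 S.K,
          predErr S.Q S.R S.H S.Θs (S.Θt k ω) (fun i => S.w k i ω) (S.x₁ k ω)
          + 2 * (4 * (1 + S.γ) ^ 2 * S.H) * Real.log (8 / S.α) := by
      by_contra! hc
      exact n4 hc
    have hconf : ∀ k ∈ Icc 1 S.K, _ := fun k hk =>
      mem_confSet hB hn hlam hCw hα hα1 (g1 k hk) (g2 k hk) (g3 k hk)
    have hz : ∀ k ∈ Icc 1 S.K, ∀ h ∈ Icc 1 S.H, S.z k h ω ⬝ᵥ S.z k h ω ≤ (1 + S.γ) ^ 2 := by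
      intro k hk h hh
      obtain ⟨j, rfl⟩ : ∃ j, h = 1 + j := ⟨h - 1, by have := mem_Icc.1 hh; omega⟩
      have h1 := hB.sumElim_rollout_le hsum hH (hO k hk).1 (hw k hk) (hx k hk) (j := j)
        (by have := mem_Icc.1 hh; omega)
      simpa only [z, u, x, policy, Nat.add_sub_cancel_left] using h1
    have hsumX := sum_predErr_le hlam hγ hCw hz
      (fun k hk => (hB.predErr_mem hsum hH (hO k hk).1 (hw k hk) (hx k hk)).2)
      (fun k hk => (hconf k hk).2.1) (fun k hk => (hconf k hk).2.2)
      (fun k hk => (hconf k hk).1)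
      (fun k hk => ((hO k hk).2 ⟨S.Θs, (hconf k hk).1, hB.mem_paramSet⟩).1)
    have hreg := regret_le_of_sum_predErr_le hS hex hB.mem_paramSet hx hO
      (fun k hk => (hconf k hk).1)
      (g4.trans (add_le_add_left (mul_le_mul_of_nonneg_left hsumX zero_le_two) _)) hθ
    have hω' : B < S.regret μ ω := hω
    linarith
  calc μ {ω | B < S.regret μ ω} ≤ μ (E₁ ∪ E₂ ∪ E₃ ∪ E₄) := measure_mono_ae hsub
    _ ≤ ENNReal.ofReal (S.α / 8) + ENNReal.ofReal (S.α / 4) + ENNReal.ofReal (S.α / 2)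
        + ENNReal.ofReal (S.α / 8) := by
        refine (measure_union_le _ _).trans (add_le_add ?_ hE₄)
        refine (measure_union_le _ _).trans (add_le_add ?_ hE₃)
        exact (measure_union_le _ _).trans (add_le_add hE₁ hE₂)
    _ = ENNReal.ofReal S.α := by
        rw [← ENNReal.ofReal_add (by positivity) (by positivity),
          ← ENNReal.ofReal_add (by positivity) (by positivity),
          ← ENNReal.ofReal_add (by positivity) (by positivity)]
        congr 1; ring

end Probability

end Run

end PrivateLQ

namespace PrivateLQ

/-! ### The rate -/

/-- The bound on the sum of the prediction errors is at most a multiple of `H * T ^ 2`, where `T` is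
the sum of the two rates in the regret bound without the factor `H ^ (3 / 2) * √K`; `a`, `s`, `ρ` stand
for `log (1 / α)`, `√(log (K / α))` and the dependence on the privacy parameters. -/
theorem errorSum_le_sq {D N l a s ρ H G b cb cl c2 e : ℝ} (hD : 1 ≤ D) (hDN : D ≤ N)
    (hl : 1 / 2 ≤ l) (ha : 0 ≤ a) (hs : 0 ≤ s) (hρ : 0 ≤ ρ) (hH : 1 ≤ H) (hcb : 0 ≤ cb)
    (hcl : 0 ≤ cl) (hc2 : 0 ≤ c2) (hG : G ≤ cl * l) (hb0 : 0 ≤ b)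
    (hb : b ≤ (6 + 3 * cl) * (N * l + a) + c2 * H * l * ρ ^ 2 * (N + s)) (he : e ≤ 3 * l + a) :
    2 * ((cb * H + 4 * b) * (2 * (D * G))) + 2 * (cb * H) * e
      ≤ (8 * cl * cb + 96 * cl + 48 * cl ^ 2 + 12 * cb + 16 * cl * c2) * H
        * (N * l + a + l * (N + s) * ρ) ^ 2 := by
  obtain ⟨P, hP⟩ : ∃ P, P = N * l + a := ⟨_, rfl⟩
  have hl0 : 0 ≤ l := by linarith
  have hN : 1 ≤ N := hD.trans hDN
  have hlN : l ≤ N * l := le_mul_of_one_le_left hl0 hN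
  have hP2 : 1 / 2 ≤ P := by linarith
  have hPP : P ≤ 2 * P ^ 2 := by nlinarith
  have hDl : D * l ≤ P := by
    have := mul_le_mul_of_nonneg_right hDN hl0
    linarith
  have hDG : D * G ≤ cl * (D * l) := by
    have := mul_le_mul_of_nonneg_left hG (by linarith : 0 ≤ D)
    linarith
  have hDl0 : 0 ≤ D * l := by positivity
  have h1 : 2 * ((cb * H + 4 * b) * (2 * (D * G)))
      ≤ 4 * cl * cb * H * (D * l) + 16 * cl * (D * l) * b := by
    have := mul_le_mul_of_nonneg_left hDG (by positivity : 0 ≤ cb * H + 4 * b)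
    linarith
  have h2 : 4 * cl * cb * H * (D * l) ≤ 8 * cl * cb * H * P ^ 2 := by
    have := mul_le_mul_of_nonneg_left (hDl.trans hPP) (by positivity : 0 ≤ 4 * cl * cb * H)
    linarith
  have h3 : 16 * cl * (D * l) * b
      ≤ 16 * cl * (6 + 3 * cl) * H * P ^ 2 + 16 * cl * c2 * H * (l * (N + s) * ρ) ^ 2 := by
    rw [← hP] at hb
    have e1 := mul_le_mul_of_nonneg_left hb (by positivity : 0 ≤ 16 * cl * (D * l))
    have e2 : 16 * cl * (6 + 3 * cl) * (D * l * P) ≤ 16 * cl * (6 + 3 * cl) * (H * P ^ 2) := by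
      refine mul_le_mul_of_nonneg_left ?_ (by positivity)
      have := mul_le_mul_of_nonneg_right hDl (by linarith : 0 ≤ P)
      nlinarith [sq_nonneg P]
    -- `D ≤ N + s` completes the square of the privacy term
    have e3 : 16 * cl * c2 * H * (l ^ 2 * ρ ^ 2 * (N + s)) * D
        ≤ 16 * cl * c2 * H * (l ^ 2 * ρ ^ 2 * (N + s)) * (N + s) :=
      mul_le_mul_of_nonneg_left (by linarith) (by positivity)
    linarith
  have h4 : 2 * (cb * H) * e ≤ 12 * cb * H * P ^ 2 := by
    have := mul_le_mul_of_nonneg_left (by linarith : e ≤ 6 * P ^ 2)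
      (by positivity : 0 ≤ 2 * (cb * H))
    linarith
  have hq : 0 ≤ l * (N + s) * ρ := by positivity
  rw [← hP]
  generalize l * (N + s) * ρ = y at hq h3 ⊢
  have h5 : P ^ 2 ≤ (P + y) ^ 2 := pow_le_pow_left₀ (by linarith) (by linarith) 2
  have h6 : y ^ 2 ≤ (P + y) ^ 2 := pow_le_pow_left₀ hq (by linarith) 2
  have h7 := mul_le_mul_of_nonneg_left h5
    (by positivity : 0 ≤ (8 * cl * cb + 96 * cl + 48 * cl ^ 2 + 12 * cb) * H)
  have h8 := mul_le_mul_of_nonneg_left h6 (by positivity : 0 ≤ 16 * cl * c2 * H)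
  linarith

/-- The choice of the free parameter: `θ` balances the two terms. -/
theorem exists_pos_balanced_le {Y c6 c H K T P : ℝ} (hc6 : 0 < c6) (hH : 1 ≤ H)
    (hK : 0 < K) (hP : 1 / 2 ≤ P) (hPT : P ≤ T) (hY : Y ≤ c6 * H * T ^ 2) :
    ∃ θ : ℝ, 0 < θ ∧ θ * Y + c * H ^ 2 / θ * K + 2 * √K
      ≤ ((1 + c) * √c6 + 4) * (H ^ (3 / 2 : ℝ) * √K * T) := by
  have hH0 : 0 < H := by linarith
  have hT : 0 < T := by linarith
  have hrpow : H ^ (3 / 2 : ℝ) = H * √H := by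
    rw [Real.sqrt_eq_rpow, show (3 / 2 : ℝ) = 1 + 1 / 2 by norm_num, Real.rpow_add hH0,
      Real.rpow_one]
  have k0 : 0 < √K := by positivity
  have h0 : 0 < √H := by positivity
  have g0 : 0 < √c6 := by positivity
  have k2 := Real.sq_sqrt hK.le
  have h2 := Real.sq_sqrt hH0.le
  have g2 := Real.sq_sqrt hc6.le
  have hh1 : 1 ≤ √H := Real.one_le_sqrt.2 hH
  rw [hrpow]
  generalize √K = k at *
  generalize √H = h at *
  generalize √c6 = g at *
  subst k2 h2 g2
  refine ⟨h * k / (g * T), by positivity, ?_⟩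
  have e1 : h * k / (g * T) * Y ≤ g * (h ^ 2 * h * k * T) := by
    calc _ ≤ h * k / (g * T) * (g ^ 2 * h ^ 2 * T ^ 2) :=
          mul_le_mul_of_nonneg_left hY (by positivity)
      _ = _ := by field_simp
  have e2 : c * (h ^ 2) ^ 2 / (h * k / (g * T)) * k ^ 2 = c * g * (h ^ 2 * h * k * T) := by
    field_simp
  have e3 : 2 * k ≤ 4 * (h ^ 2 * h * k * T) := by
    have f1 : 1 ≤ h ^ 2 * h := one_le_mul_of_one_le_of_one_le hH hh1
    have f2 : 1 / 2 ≤ h ^ 2 * h * T := by nlinarith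
    have := mul_le_mul_of_nonneg_right f2 k0.le
    linarith
  rw [e2]
  linarith

namespace Run

variable {n d : ℕ} {Ω : Type*} {S : Run n d Ω} {C CA CB : ℝ}

theorem privacyScale_eq_sq (hε : 0 < S.ε) (hδ : 0 < S.δ) (hδ1 : S.δ ≤ 1) :
    S.privacyScale = (Real.log (2 / S.δ) ^ (1 / 4 : ℝ) / S.ε ^ (1 / 2 : ℝ)) ^ 2 := by
  have hL : 0 ≤ Real.log (2 / S.δ) := Real.log_nonneg (by rw [le_div_iff₀ hδ]; linarith)
  rw [privacyScale, div_pow, ← Real.rpow_mul_natCast hL, ← Real.rpow_mul_natCast hε.le,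
    Real.sqrt_eq_rpow]
  norm_num

variable [MeasurableSpace Ω] {μ : Measure Ω}

/-- Without states or without steps there is nothing to control. -/
theorem regret_eq_zero (h : n = 0 ∨ S.H = 0) (ω : Ω) : S.regret μ ω = 0 := by
  unfold regret
  refine sum_eq_zero fun k _ => ?_
  rcases h with rfl | hH
  · have h0 : ∀ (h : ℕ) (y : Fin 0 → ℝ), S.policy k ω h y = 0 := fun h y => by
      simp [policy, gainPolicy, Subsingleton.elim y 0]
    simp [policyCost, optStart, optCost, stepCost, h0]
  · simp [policyCost, optStart, optCost, Pmat, riccati, hH]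

theorem Cw_nonneg [IsProbabilityMeasure μ] (hS : S.StochasticModel μ) (hK : 1 ≤ S.K)
    (hH : 1 ≤ S.H) : 0 ≤ S.Cw := by
  obtain ⟨ω, hω⟩ := hS.norm_w.exists
  exact (norm_nonneg _).trans (hω 1 (mem_Icc.2 ⟨le_rfl, hK⟩) 1 (mem_Icc.2 ⟨le_rfl, hH⟩))

/-- In the trivial cases the regret vanishes, and the bound is nonnegative. -/
theorem measure_lt_regret_eq_zero (h : n = 0 ∨ S.H = 0) (hK : 2 ≤ S.K) (hε : 0 < S.ε)
    (hδ : 0 < S.δ) (hδ1 : S.δ ≤ 1) (hα : 0 < S.α) (hα1 : S.α ≤ 1) {M : ℝ} (hM : 0 ≤ M) :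
    μ {ω | M * ((S.H : ℝ) ^ (3 / 2 : ℝ) * √(S.K : ℝ) *
              ((n : ℝ) * ((n : ℝ) + d) * Real.log S.K + Real.log (1 / S.α)))
            + M * ((S.H : ℝ) ^ (3 / 2 : ℝ) * √(S.K : ℝ) * Real.log S.K *
              ((n : ℝ) * ((n : ℝ) + d) + √(Real.log (S.K / S.α))) *
              (Real.log (2 / S.δ) ^ (1 / 4 : ℝ) / S.ε ^ (1 / 2 : ℝ)))
          < S.regret μ ω} = 0 := by
  have ha : 0 ≤ Real.log (1 / S.α) := Real.log_nonneg (by rw [le_div_iff₀ hα]; linarith)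
  have hL : 0 ≤ Real.log (2 / S.δ) := Real.log_nonneg (by rw [le_div_iff₀ hδ]; linarith)
  have hl : 0 ≤ Real.log (S.K : ℝ) := by linarith [half_le_log hK]
  refine measure_mono_null (fun ω hω => ?_) measure_empty
  refine absurd hω ?_
  rw [Set.mem_ofPred_eq, regret_eq_zero h, not_lt]
  positivity

end Run

end PrivateLQ

theorem mainTheorem4 (C CA CB Cw γ κ q : ℝ) (hCA : CA < 1) (hCB : CB < 1) (hCw : Cw < 1)
    (hsum : CA + γ * CB + Cw ≤ 1) (hκ : 0 < κ) :
    ∃ M : ℝ, 0 < M ∧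
      ∀ (n d : ℕ) (Ω : Type*) [MeasurableSpace Ω] (μ : Measure Ω) [IsProbabilityMeasure μ]
        (S : Run n d Ω),
        S.γ = γ → S.Cw = Cw → S.κ = κ →
        2 ≤ S.K →
        0 < S.ε → S.ε ≤ (S.K : ℝ) ^ q →
        0 < S.δ → S.δ ≤ 1 →
        0 < S.α → S.α ≤ 1 →
        S.Boundedness C CA CB →
        S.StochasticModel μ →
        S.IsPrivateOFURL μ →
        μ {ω | M * ((S.H : ℝ) ^ (3 / 2 : ℝ) * √(S.K : ℝ) *
                  ((n : ℝ) * ((n : ℝ) + d) * Real.log S.K + Real.log (1 / S.α)))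
                + M * ((S.H : ℝ) ^ (3 / 2 : ℝ) * √(S.K : ℝ) * Real.log S.K *
                  ((n : ℝ) * ((n : ℝ) + d) + √(Real.log (S.K / S.α))) *
                  (Real.log (2 / S.δ) ^ (1 / 4 : ℝ) / S.ε ^ (1 / 2 : ℝ)))
              < S.regret μ ω} ≤ ENNReal.ofReal S.α := by
  by_cases hsign : 0 ≤ C ∧ 0 ≤ CA ∧ 0 ≤ CB ∧ 0 ≤ Cw ∧ 0 ≤ γ
  swap
  -- Constants of the wrong sign admit a run only without states or without steps.
  · refine ⟨1, one_pos, ?_⟩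
    intro n d Ω _ μ _ S hγ hCwS hκS hK hε hεq hδ hδ1 hα hα1 hB hS hA
    have hz : n = 0 ∨ S.H = 0 := by
      by_contra! hcon
      have hH : 1 ≤ S.H := Nat.one_le_iff_ne_zero.2 hcon.2
      exact hsign ⟨hB.C_nonneg, hB.CA_nonneg, hB.CB_nonneg,
        hCwS ▸ Run.Cw_nonneg hS (by omega) hH, hγ ▸ hB.γ_nonneg hH⟩
    exact (Run.measure_lt_regret_eq_zero hz hK hε hδ hδ1 hα hα1 zero_le_one).trans_le zero_le
  obtain ⟨hC0, hCA0, hCB0, hCw0, hγ0⟩ := hsign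
  obtain ⟨c, hc, hex⟩ := exists_excess_le C CA CB Cw γ hC0 hCA0 hCA hCB0 hCw0 hγ0 hsum
  set cl := 2 * Real.log (1 + 1 / √κ) + 1 + |q| with hcl
  have hcl0 : 0 < cl := by
    have : 0 ≤ Real.log (1 + 1 / √κ) := Real.log_nonneg (by
      have : 0 ≤ 1 / √κ := by positivity
      linarith)
    have := abs_nonneg q
    linarith
  set cb := 4 * (1 + γ) ^ 2 with hcb
  set c2 := 270 * √κ * (1 + γ) ^ 2 with hc2
  set c6 := 8 * cl * cb + 96 * cl + 48 * cl ^ 2 + 12 * cb + 16 * cl * c2 with hc6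
  have hc60 : 0 < c6 := by positivity
  refine ⟨(1 + c) * √c6 + 4, by positivity, ?_⟩
  intro n d Ω _ μ _ S hγ hCwS hκS hK hε hεq hδ hδ1 hα hα1 hB hS hA
  by_cases hz : n = 0 ∨ S.H = 0
  · exact (Run.measure_lt_regret_eq_zero hz hK hε hδ hδ1 hα hα1 (by positivity)).trans_le zero_le
  push Not at hz
  have hn : 1 ≤ n := Nat.one_le_iff_ne_zero.2 hz.1
  have hH : 1 ≤ S.H := Nat.one_le_iff_ne_zero.2 hz.2
  have hnr : (1 : ℝ) ≤ n := by exact_mod_cast hn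
  have hHr : (1 : ℝ) ≤ S.H := by exact_mod_cast hH
  have hKr : (2 : ℝ) ≤ S.K := by exact_mod_cast hK
  have hd : (0 : ℝ) ≤ d := Nat.cast_nonneg d
  have hG : S.logGram ≤ cl * Real.log S.K := by
    have := Run.logGram_le hK hH hn (hκS ▸ hκ) (hγ ▸ hγ0) hε hδ hδ1 hεq
    rwa [hκS] at this
  have hb := Run.betaMax_sq_le hK hH hn (hκS ▸ hκ) (hγ ▸ hγ0) hε hδ hδ1 hα hα1 (hCwS ▸ hCw0)
    (hCwS ▸ hCw.le) hG
  have hD : (1 : ℝ) ≤ n + d := by linarith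
  have hDN : (n : ℝ) + d ≤ n * (n + d) := le_mul_of_one_le_left (by linarith) hnr
  have hl := Run.half_le_log hK
  have ha : 0 ≤ Real.log (1 / S.α) := Real.log_nonneg (by rw [le_div_iff₀ hα]; linarith)
  have he : Real.log (8 / S.α) ≤ 3 * Real.log S.K + Real.log (1 / S.α) := by
    rw [Real.log_div (by norm_num) hα.ne', Real.log_div one_ne_zero hα.ne', Real.log_one,
      show (8 : ℝ) = 2 ^ 3 by norm_num, Real.log_pow]
    have := Real.log_le_log two_pos hKr
    push_cast
    linarith
  have hL : 0 ≤ Real.log (2 / S.δ) := Real.log_nonneg (by rw [le_div_iff₀ hδ]; linarith)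
  rw [Run.privacyScale_eq_sq hε hδ hδ1, hκS, hγ] at hb
  have hρ : 0 ≤ Real.log (2 / S.δ) ^ (1 / 4 : ℝ) / S.ε ^ (1 / 2 : ℝ) := by positivity
  have hs : 0 ≤ √(Real.log (S.K / S.α)) := Real.sqrt_nonneg _
  have hsum' : CA + S.γ * CB + S.Cw ≤ 1 := by rw [hγ, hCwS]; exact hsum
  refine Run.measure_lt_regret_le hS hB hA hsum' (hCwS ▸ hCw0) hn hH hK (hκS ▸ hκ) hε hδ hδ1 hα
    hα1 (c := c) (fun w hw => hex μ S hγ hn hH hB w (hCwS ▸ hw)) ?_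
  rw [hγ, ← hcb]
  generalize Real.log (2 / S.δ) ^ (1 / 4 : ℝ) / S.ε ^ (1 / 2 : ℝ) = ρ at hb hρ ⊢
  generalize √(Real.log (S.K / S.α)) = s at hb hs ⊢
  have hY := errorSum_le_sq hD hDN hl ha hs hρ hHr (by positivity : 0 ≤ cb) hcl0.le
    (by positivity : 0 ≤ c2) hG (sq_nonneg S.betaMax) (by rw [hc2]; linarith) he
  have hNl : Real.log S.K ≤ n * (n + d) * Real.log S.K :=
    le_mul_of_one_le_left (by linarith) (hD.trans hDN)
  have hq : 0 ≤ Real.log S.K * (n * (n + d) + s) * ρ := by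
    have : 0 ≤ Real.log (S.K : ℝ) := by linarith
    positivity
  obtain ⟨θ, hθ, hle⟩ := exists_pos_balanced_le (c := c) (K := S.K) hc60 hHr (by linarith)
    (by linarith : 1 / 2 ≤ n * (n + d) * Real.log S.K + Real.log (1 / S.α))
    (le_add_of_nonneg_right hq) hY
  exact ⟨θ, hθ, hle.trans (le_of_eq (by ring))⟩
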